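/- **Setting.** Work over $\mathbb{C}$. Let $\mathrm{QSym}$ be the graded Hopf algebra of quasisymmetric functions, with basis the monomial functions $M_\alpha$ ($\alpha$ a composition), quasi-shuffle product, deconcatenation coproduct, and canonical character $\zeta(f)=f(1,0,0,\dots)$; let $\mathrm{Sym}\subset\mathrm{QSym}$ be the Hopf subalgebra of symmetric functions, with the restricted character, and put $p_n=\frac1n M_{(n)}$. Let $\mathrm{NSym}$ be the free algebra on $H_1,H_2,\dots$ with $\Delta(H_n)=\sum_{i+j=n}H_i\otimes H_j$ ($H_0=1$), paired with $\mathrm{QSym}$ by $\langle H_\alpha,M_\beta\rangle=\delta_{\alpha,\beta}$, where $H_\alpha=H_{\alpha_1}\cdots H_{\alpha_\ell}$. For a character $\zeta$ of a graded connected Hopf algebra let $\zeta^{-1}$ be its convolution inverse and let $\overline{\zeta}=(-1)^n\zeta$ in degree $n$. For $\mathsf H=\mathrm{QSym}$ and for $\mathsf H=\mathrm{Sym}$ there is a unique morphism of graded Hopf algebras $\Theta_{\mathsf H}:\mathsf H\to\mathsf H$ with $\zeta\circ\Theta_{\mathsf H}=\overline{\zeta^{-1}}\,\zeta$ (convolution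 product). Put $\Pi=\Theta_{\mathrm{QSym}}(\mathrm{QSym})$ (the peak algebra) and $\Omega=\Theta_{\mathrm{Sym}}(\mathrm{Sym})$ (the algebra of Schur $Q$-functions), with the induced graded Hopf algebra structures. For a composition $\alpha$ define the shuffle function $$S_\alpha=\sum_{\beta}\ \prod_i\frac1{o_i!\,e_i!}\;M_\beta ,$$ where $\beta$ runs over the compositions obtained by cutting $\alpha$ into consecutive nonempty blocks, none of which contains an odd part immediately followed by an even part, and replacing each block by its sum; $o_i$ and $e_i$ are the numbers of odd and even parts of the $i$-th block. There is a unique family $(S^*_\alpha)$ in $\mathrm{NSym}$ with $\langle S^*_\alpha,S_\beta\rangle=\delta_{\alpha,\beta}$, and a unique Hopf algebra endomorphism $\Theta_{\mathrm{NSym}}$ of $\mathrm{NSym}$ with $\Theta_{\mathrm{NSym}}(S^*_\alpha)=2^{\ell(\alpha)}S^*_\alpha$ if all parts of $\alpha$ are odd and $\Theta_{\mathrm{NSym}}(S^*_\alpha)=0$ otherwise. Let $O$ be the graded vector space with basis $v_1,v_3,v_5,\dots$, $\deg v_i=i$. Let $\mathrm S(O)$ be its shuffle algebra (words $v_\alpha=v_{\alpha_1}\cdots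 v_{\alpha_\ell}$, shuffle product, deconcatenation) and $\mathrm{Sym}(O)$ its symmetric algebra (with the $v_i$ primitive). **Corollary.** 1. There is an isomorphism of graded Hopf algebras $\mathrm S(O)\cong\Pi$ with $v_\alpha\mapsto S_\alpha$ for every composition $\alpha$ with odd parts. 2. There is an isomorphism of graded Hopf algebras $\mathrm{Sym}(O)\cong\Omega$ with $v_i\mapsto p_i$ for every odd $i$. 3. $\Omega$ is self-dual: it is isomorphic, as a graded Hopf algebra, to its graded dual $\Omega^*$. 4. The image of $\Theta_{\mathrm{NSym}}$ is isomorphic, as a graded Hopf algebra, to the graded dual $\Pi^*$. -/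

import Mathlib

noncomputable section

open TensorProduct

/-! ### Quasi-shuffle and shuffle algebras on words -/

/-- A commutative and associative partial product on an alphabet `A`
(`none` stands for the zero product). -/
structure LetterProduct (A : Type) where
  op : A → A → Option A
  comm : ∀ a b, op a b = op b a
  assoc : ∀ a b c, (op a b).bind (fun s => op s c) = (op b c).bind (fun s => op a s)

/-- The zero product of letters. -/
def LetterProduct.zero (A : Type) : LetterProduct A where
  op _ _ := none
  comm _ _ := rfl
  assoc _ _ _ := rfl

/-- Positive integers as letters, with addition as the product of letters. -/
def LetterProduct.add : LetterProduct ℕ+ where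
  op a b := some (a + b)
  comm a b := by rw [add_comm]
  assoc a b c := by simp [add_assoc]

/-- The complex vector space with basis the words on the alphabet `A`. It carries the quasi-shuffle
product attached to the letter product (the shuffle product when the letter product is zero) and the
deconcatenation coproduct, defined below. -/
def QSh {A : Type} (_L : LetterProduct A) : Type := List A →₀ ℂ

namespace QSh

variable {A : Type} {L : LetterProduct A}

instance : AddCommGroup (QSh L) := inferInstanceAs (AddCommGroup (List A →₀ ℂ))
instance : Module ℂ (QSh L) := inferInstanceAs (Module ℂ (List A →₀ ℂ))

/-- The basis of words. -/
def basis (L : LetterProduct A) : Module.Basis (List A) ℂ (QSh L) :=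
  Module.Basis.ofRepr (LinearEquiv.refl ℂ (List A →₀ ℂ))

/-- The basis element of a word. -/
def word (L : LetterProduct A) (w : List A) : QSh L := basis L w

/-- The coefficient of the word `w`. -/
def coeff (w : List A) : QSh L →ₗ[ℂ] ℂ := (basis L).coord w

/-- Prepending the letter `x` to every word. -/
def cons (x : A) : QSh L →ₗ[ℂ] QSh L :=
  (basis L).constr ℂ (fun w => word L (x :: w))

/-- Prepending the value of a product of letters, which may be zero. -/
def consOpt : Option A → QSh L →ₗ[ℂ] QSh L
  | none => 0
  | some x => cons x

/-- The quasi-shuffle of two words: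
`xu * yv = x (u * yv) + y (xu * v) + (x·y) (u * v)`, where `x·y` is the product of letters. -/
def mulWord : List A → List A → QSh L
  | [], v => word L v
  | x :: u, [] => word L (x :: u)
  | x :: u, y :: v =>
      cons x (mulWord u (y :: v)) + cons y (mulWord (x :: u) v)
        + consOpt (L.op x y) (mulWord u v)
termination_by u v => u.length + v.length

/-- The bilinear extension of `mulWord`. -/
def mulLin (L : LetterProduct A) : QSh L →ₗ[ℂ] QSh L →ₗ[ℂ] QSh L :=
  (basis L).constr ℂ (fun u => (basis L).constr ℂ (fun v => mulWord u v))

instance : Mul (QSh L) := ⟨fun f g => mulLin L f g⟩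
instance : One (QSh L) := ⟨word L []⟩

theorem one_def : (1 : QSh L) = word L [] := rfl

theorem cons_word (x : A) (w : List A) : cons x (word L w) = word L (x :: w) := by
  simp [cons, word, Module.Basis.constr_basis]

theorem mul_def (f g : QSh L) : f * g = mulLin L f g := rfl

theorem word_mul_word (u v : List A) : word L u * word L v = mulWord u v := by
  rw [mul_def]; simp [mulLin, word, Module.Basis.constr_basis]

theorem lin_ext {N : Type*} [AddCommMonoid N] [Module ℂ N] {f g : QSh L →ₗ[ℂ] N}
    (h : ∀ w, f (word L w) = g (word L w)) : f = g := (basis L).ext h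

theorem word_cons_mul_word_cons (x y : A) (u v : List A) :
    word L (x :: u) * word L (y :: v) =
      cons x (word L u * word L (y :: v)) + cons y (word L (x :: u) * word L v)
        + consOpt (L.op x y) (word L u * word L v) := by
  simp only [word_mul_word]; rw [mulWord]

instance instDistrib : NonUnitalNonAssocRing (QSh L) where
  left_distrib f g h := by simp [mul_def]
  right_distrib f g h := by simp [mul_def]
  zero_mul f := by simp [mul_def]
  mul_zero f := by simp [mul_def]

protected theorem smul_mul' (c : ℂ) (f g : QSh L) : (c • f) * g = c • (f * g) := by simp [mul_def]
protected theorem mul_smul' (c : ℂ) (f g : QSh L) : f * (c • g) = c • (f * g) := by simp [mul_def]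

instance : IsScalarTower ℂ (QSh L) (QSh L) := ⟨fun c f g => QSh.smul_mul' c f g⟩
instance : SMulCommClass ℂ (QSh L) (QSh L) := ⟨fun c f g => (QSh.mul_smul' c f g).symm⟩

theorem induction {P : QSh L → Prop} (f : QSh L) (hw : ∀ w, P (word L w))
    (hadd : ∀ f g, P f → P g → P (f + g)) (hsmul : ∀ (c : ℂ) f, P f → P (c • f)) : P f := by
  have h : f ∈ Submodule.span ℂ (Set.range (basis L)) := by rw [(basis L).span_eq]; trivial
  induction h using Submodule.span_induction with
  | mem x hx => obtain ⟨w, rfl⟩ := hx; exact hw w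
  | zero => simpa using hsmul 0 _ (hw [])
  | add x y _ _ hx hy => exact hadd x y hx hy
  | smul c x _ hx => exact hsmul c x hx

theorem mulWord_nil (v : List A) : mulWord (L := L) v [] = word L v := by
  cases v <;> simp [mulWord]

theorem cons_mul_cons (x y : A) (f g : QSh L) :
    cons x f * cons y g =
      cons x (f * cons y g) + cons y (cons x f * g) + consOpt (L.op x y) (f * g) := by
  induction f using QSh.induction with
  | hw u =>
    induction g using QSh.induction with
    | hw v => simp only [cons_word, word_cons_mul_word_cons]
    | hadd f g hf hg => simp only [map_add, mul_add, hf, hg]; abel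
    | hsmul c f hf => simp only [map_smul, mul_smul_comm, hf, smul_add]
  | hadd f g hf hg => simp only [map_add, add_mul, hf, hg]; abel
  | hsmul c f hf => simp only [map_smul, smul_mul_assoc, hf, smul_add]

protected theorem one_mul' (f : QSh L) : 1 * f = f := by
  induction f using QSh.induction with
  | hw u => rw [one_def, word_mul_word, mulWord]
  | hadd f g hf hg => rw [mul_add, hf, hg]
  | hsmul c f hf => rw [mul_smul_comm, hf]

protected theorem mul_one' (f : QSh L) : f * 1 = f := by
  induction f using QSh.induction with
  | hw u => rw [one_def, word_mul_word, mulWord_nil]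
  | hadd f g hf hg => rw [add_mul, hf, hg]
  | hsmul c f hf => rw [smul_mul_assoc, hf]

protected theorem mul_comm' (f g : QSh L) : f * g = g * f := by
  induction f using QSh.induction with
  | hw u =>
    induction g using QSh.induction with
    | hw v =>
      induction u generalizing v with
      | nil => rw [← one_def, QSh.one_mul', QSh.mul_one']
      | cons x u ihu =>
        induction v with
        | nil => rw [← one_def, QSh.one_mul', QSh.mul_one']
        | cons y v ihv =>
          rw [word_cons_mul_word_cons, word_cons_mul_word_cons, ihv, ihu, ihu, L.comm x y]
          abel
    | hadd f g hf hg => rw [mul_add, add_mul, hf, hg]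
    | hsmul c f hf => rw [mul_smul_comm, smul_mul_assoc, hf]
  | hadd f f' hf hg => rw [mul_add, add_mul, hf, hg]
  | hsmul c f hf => rw [mul_smul_comm, smul_mul_assoc, hf]

theorem consOpt_mul_cons (o : Option A) (z : A) (f g : QSh L) :
    consOpt o f * cons z g =
      consOpt o (f * cons z g) + cons z (consOpt o f * g)
        + consOpt (o.bind (fun s => L.op s z)) (f * g) := by
  cases o with
  | none => simp [consOpt]
  | some s => simp [consOpt, cons_mul_cons]

theorem cons_mul_consOpt (o : Option A) (z : A) (f g : QSh L) :
    cons z f * consOpt o g =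
      cons z (f * consOpt o g) + consOpt o (cons z f * g)
        + consOpt (o.bind (fun s => L.op z s)) (f * g) := by
  cases o with
  | none => simp [consOpt]
  | some s => simp [consOpt, cons_mul_cons]

theorem word_mul_assoc (u v w : List A) :
    word L u * word L v * word L w = word L u * (word L v * word L w) := by
  induction u generalizing v w with
  | nil => rw [← one_def, QSh.one_mul', QSh.one_mul']
  | cons x a iha =>
    induction v generalizing w with
    | nil => rw [← one_def, QSh.one_mul', QSh.mul_one']
    | cons y b ihb =>
      induction w with
      | nil => rw [← one_def, QSh.mul_one', QSh.mul_one']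
      | cons z c ihc =>
        have hb := ihb (z :: c)
        have ha := iha (y :: b) (z :: c)
        have hab := iha b (z :: c)
        have hac := iha (y :: b) c
        have hbc := ihb c
        have habc := iha b c
        simp only [← cons_word] at *
        generalize word L a = a, word L b = b, word L c = c at *
        have hz : cons x (a * cons y b) * c + cons y (cons x a * b) * c
            + consOpt (L.op x y) (a * b) * c = cons x a * (cons y b * c) := by
          rw [← add_mul, ← add_mul, ← cons_mul_cons, ihc]
        have hx : a * cons y (b * cons z c) + a * cons z (cons y b * c)
            + a * consOpt (L.op y z) (b * c) = a * (cons y b * cons z c) := by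
          rw [← mul_add, ← mul_add, ← cons_mul_cons]
        rw [cons_mul_cons x y, cons_mul_cons y z]
        simp only [add_mul, mul_add, cons_mul_cons, consOpt_mul_cons, cons_mul_consOpt]
        rw [ha, hb, hab, hac, hbc, habc, L.assoc x y z, ← hx]
        have hz' := congrArg (cons z) hz
        simp only [map_add] at hz' ⊢
        rw [← hz']
        abel

instance : CommRing (QSh L) where
  __ := (inferInstance : AddCommGroup (QSh L))
  __ := instDistrib
  one_mul := QSh.one_mul'
  mul_one := QSh.mul_one'
  mul_assoc f g h := by
    induction f using QSh.induction with
    | hw u =>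
      induction g using QSh.induction with
      | hw v =>
        induction h using QSh.induction with
        | hw w => exact word_mul_assoc u v w
        | hadd f g hf hg => simp only [mul_add, hf, hg]
        | hsmul c f hf => simp only [mul_smul_comm, hf]
      | hadd f g hf hg => simp only [mul_add, add_mul, hf, hg]
      | hsmul c f hf => simp only [mul_smul_comm, smul_mul_assoc, hf]
    | hadd f g hf hg => simp only [add_mul, hf, hg]
    | hsmul c f hf => simp only [smul_mul_assoc, hf]
  mul_comm := QSh.mul_comm'

instance : Algebra ℂ (QSh L) :=
  Algebra.ofModule QSh.smul_mul' QSh.mul_smul'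

/-- Deconcatenation: a word is sent to the sum of all `prefix ⊗ suffix`. -/
def comulLin : QSh L →ₗ[ℂ] QSh L ⊗[ℂ] QSh L :=
  (basis L).constr ℂ fun w =>
    ∑ i ∈ Finset.range (w.length + 1), word L (w.take i) ⊗ₜ[ℂ] word L (w.drop i)

theorem comulLin_word (w : List A) : comulLin (word L w) =
    ∑ i ∈ Finset.range (w.length + 1), word L (w.take i) ⊗ₜ[ℂ] word L (w.drop i) := by
  simp [comulLin, word, Module.Basis.constr_basis]

theorem comulLin_one : comulLin (1 : QSh L) = 1 := by
  rw [one_def, comulLin_word]; simp [Algebra.TensorProduct.one_def, one_def]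

theorem comulLin_cons (x : A) (f : QSh L) :
    comulLin (cons x f) = 1 ⊗ₜ[ℂ] cons x f + (cons x).rTensor (QSh L) (comulLin f) := by
  induction f using QSh.induction with
  | hw w =>
    rw [cons_word, comulLin_word, comulLin_word, List.length_cons, Finset.sum_range_succ', add_comm]
    simp [one_def, cons_word]
  | hadd f g hf hg => simp only [map_add, hf, hg, tmul_add]; abel
  | hsmul c f hf => simp only [map_smul, hf, tmul_smul, smul_add]

theorem coeff_word (u v : List A) [Decidable (u = v)] :
    coeff u (word L v) = if u = v then 1 else 0 := by
  classical
  simp [coeff, word, Finsupp.single_apply, eq_comm]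

theorem coeff_nil_cons (x : A) (f : QSh L) : coeff [] (cons x f) = 0 := by
  classical
  induction f using QSh.induction with
  | hw w => rw [cons_word, coeff_word]; simp
  | hadd f g hf hg => simp only [map_add, hf, hg, add_zero]
  | hsmul c f hf => simp only [map_smul, hf, smul_zero]

instance : Coalgebra ℂ (QSh L) where
  comul := comulLin
  counit := coeff []
  coassoc := by
    refine lin_ext fun w => ?_
    simp only [LinearMap.coe_comp, Function.comp_apply, LinearEquiv.coe_coe]
    induction w with
    | nil => rw [← one_def, comulLin_one, Algebra.TensorProduct.one_def]; simp [comulLin_one, Algebra.TensorProduct.one_def]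
    | cons x w ih =>
      have key1 : ∀ t : QSh L ⊗[ℂ] QSh L,
          TensorProduct.assoc ℂ _ _ _ (comulLin.rTensor (QSh L) ((cons x).rTensor (QSh L) t)) =
            (1 : QSh L) ⊗ₜ[ℂ] (cons x).rTensor (QSh L) t + (cons x).rTensor (QSh L ⊗[ℂ] QSh L)
              (TensorProduct.assoc ℂ _ _ _ (comulLin.rTensor (QSh L) t)) := by
        intro t
        induction t using TensorProduct.induction_on with
        | zero => simp
        | add a b ha hb => simp only [map_add, ha, hb, tmul_add]; abel
        | tmul f g =>
          simp only [LinearMap.rTensor_tmul, comulLin_cons, add_tmul, map_add, assoc_tmul]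
          congr 1
          generalize comulLin f = s
          induction s using TensorProduct.induction_on with
          | zero => simp
          | add a b ha hb => simp only [map_add, ha, hb, add_tmul]
          | tmul p q => simp
      have key2 : ∀ t : QSh L ⊗[ℂ] QSh L,
          comulLin.lTensor (QSh L) ((cons x).rTensor (QSh L) t) =
            (cons x).rTensor (QSh L ⊗[ℂ] QSh L) (comulLin.lTensor (QSh L) t) := by
        intro t
        induction t using TensorProduct.induction_on with
        | zero => simp
        | add a b ha hb => simp only [map_add, ha, hb]
        | tmul f g => simp
      rw [← cons_word, comulLin_cons, map_add, map_add, map_add, key1, key2, ih]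
      simp only [LinearMap.rTensor_tmul, LinearMap.lTensor_tmul, comulLin_one, comulLin_cons,
        Algebra.TensorProduct.one_def, assoc_tmul, tmul_add]
      abel
  rTensor_counit_comp_comul := by
    refine lin_ext fun w => ?_
    simp only [LinearMap.coe_comp, Function.comp_apply, TensorProduct.mk_apply]
    cases w with
    | nil =>
      classical
      rw [← one_def, comulLin_one, Algebra.TensorProduct.one_def, LinearMap.rTensor_tmul, one_def,
        coeff_word]; simp
    | cons x w =>
      have key : ∀ t : QSh L ⊗[ℂ] QSh L,
          (coeff []).rTensor (QSh L) ((cons x).rTensor (QSh L) t) = 0 := by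
        intro t
        induction t using TensorProduct.induction_on with
        | zero => simp
        | add a b ha hb => simp only [map_add, ha, hb, add_zero]
        | tmul f g => simp [coeff_nil_cons]
      classical
      rw [← cons_word, comulLin_cons, map_add, key, LinearMap.rTensor_tmul, one_def, coeff_word]
      simp
  lTensor_counit_comp_comul := by
    refine lin_ext fun w => ?_
    simp only [LinearMap.coe_comp, Function.comp_apply, TensorProduct.mk_apply,
      LinearMap.flip_apply]
    induction w with
    | nil =>
      classical
      rw [← one_def, comulLin_one, Algebra.TensorProduct.one_def, LinearMap.lTensor_tmul, one_def,
        coeff_word]; simp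
    | cons x w ih =>
      have key : ∀ t : QSh L ⊗[ℂ] QSh L,
          (coeff []).lTensor (QSh L) ((cons x).rTensor (QSh L) t)
            = (cons x).rTensor ℂ ((coeff []).lTensor (QSh L) t) := by
        intro t
        induction t using TensorProduct.induction_on with
        | zero => simp
        | add a b ha hb => simp only [map_add, ha, hb]
        | tmul f g => simp
      rw [← cons_word, comulLin_cons, map_add, key, ih, LinearMap.lTensor_tmul, coeff_nil_cons]
      simp

theorem comul_def (f : QSh L) : Coalgebra.comul (R := ℂ) f = comulLin f := rfl
theorem counit_def (f : QSh L) : Coalgebra.counit (R := ℂ) f = coeff [] f := rfl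

theorem coeff_nil_consOpt (o : Option A) (f : QSh L) : coeff [] (consOpt o f) = 0 := by
  cases o with
  | none => simp [consOpt]
  | some s => exact coeff_nil_cons s f

theorem coeff_nil_mul (f g : QSh L) : coeff [] (f * g) = coeff [] f * coeff [] g := by
  induction f using QSh.induction with
  | hw u =>
    induction g using QSh.induction with
    | hw v =>
      classical
      cases u with
      | nil => rw [← one_def, one_mul, one_def, coeff_word [] [], if_pos rfl, one_mul]
      | cons x u =>
        cases v with
        | nil => rw [← one_def, mul_one, one_def, coeff_word [] [], if_pos rfl, mul_one]
        | cons y v =>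
          rw [← cons_word, ← cons_word, cons_mul_cons]
          simp [coeff_nil_cons, coeff_nil_consOpt]
    | hadd f g hf hg => simp only [mul_add, map_add, hf, hg]
    | hsmul c f hf => simp only [mul_smul_comm, map_smul, hf, smul_eq_mul]; ring
  | hadd f g hf hg => simp only [add_mul, map_add, hf, hg]
  | hsmul c f hf => simp only [smul_mul_assoc, map_smul, hf, smul_eq_mul]; ring

theorem comulLin_consOpt (o : Option A) (f : QSh L) :
    comulLin (consOpt o f) = 1 ⊗ₜ[ℂ] consOpt o f + (consOpt o).rTensor (QSh L) (comulLin f) := by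
  cases o with
  | none => simp [consOpt]
  | some s => exact comulLin_cons s f

theorem rTensor_cons_mul (x : A) (s : QSh L ⊗[ℂ] QSh L) (g : QSh L) :
    (cons x).rTensor (QSh L) s * 1 ⊗ₜ[ℂ] g = (cons x).rTensor (QSh L) (s * 1 ⊗ₜ[ℂ] g) := by
  induction s using TensorProduct.induction_on with
  | zero => simp
  | add a b ha hb => simp only [map_add, add_mul, ha, hb]
  | tmul p q => simp

theorem rTensor_cons_mul_rTensor_cons (x y : A) (s t : QSh L ⊗[ℂ] QSh L) :
    (cons x).rTensor (QSh L) s * (cons y).rTensor (QSh L) t =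
      (cons x).rTensor (QSh L) (s * (cons y).rTensor (QSh L) t)
        + (cons y).rTensor (QSh L) ((cons x).rTensor (QSh L) s * t)
        + (consOpt (L.op x y)).rTensor (QSh L) (s * t) := by
  induction s using TensorProduct.induction_on with
  | zero => simp
  | add a b ha hb => simp only [map_add, add_mul, ha, hb]; abel
  | tmul p q =>
    induction t using TensorProduct.induction_on with
    | zero => simp
    | add a b ha hb => simp only [map_add, mul_add, ha, hb]; abel
    | tmul p' q' =>
      simp only [LinearMap.rTensor_tmul, Algebra.TensorProduct.tmul_mul_tmul, cons_mul_cons,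
        add_tmul]

theorem comulLin_mul (f g : QSh L) : comulLin (f * g) = comulLin f * comulLin g := by
  induction f using QSh.induction with
  | hw u =>
    induction g using QSh.induction with
    | hw v =>
      induction u generalizing v with
      | nil => rw [← one_def, one_mul, comulLin_one, one_mul]
      | cons x u ihu =>
        induction v with
        | nil => rw [← one_def, mul_one, comulLin_one, mul_one]
        | cons y v ihv =>
          have h1 := ihu (y :: v)
          have h2 := ihu v
          simp only [← cons_word] at *
          generalize word L u = a, word L v = b at *
          rw [cons_mul_cons, map_add, map_add, comulLin_cons, comulLin_cons, comulLin_consOpt,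
            h1, ihv, h2, comulLin_cons x a, comulLin_cons y b]
          simp only [mul_add, add_mul, map_add]
          rw [rTensor_cons_mul, rTensor_cons_mul_rTensor_cons,
            mul_comm ((1 : QSh L) ⊗ₜ[ℂ] cons x a) ((cons y).rTensor (QSh L) (comulLin b)),
            rTensor_cons_mul, mul_comm ((1 : QSh L) ⊗ₜ[ℂ] cons x a) (comulLin b),
            Algebra.TensorProduct.tmul_mul_tmul, cons_mul_cons, one_mul, tmul_add, tmul_add]
          abel
    | hadd f g hf hg => simp only [mul_add, map_add, hf, hg]
    | hsmul c f hf => simp only [mul_smul_comm, map_smul, hf]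
  | hadd f g hf hg => simp only [add_mul, map_add, hf, hg]
  | hsmul c f hf => simp only [smul_mul_assoc, map_smul, hf]

instance : Bialgebra ℂ (QSh L) :=
  Bialgebra.mk' ℂ (QSh L)
    (by classical exact (coeff_word [] []).trans (if_pos rfl))
    (fun {a b} => coeff_nil_mul a b) comulLin_one (fun {a b} => comulLin_mul a b)

end QSh

/-! ### Sub-bialgebras and images -/

/-- A subalgebra `P` with `Δ(P) ⊆ P ⊗ P`, the latter viewed inside `B ⊗ B`. -/
structure Subbialgebra (B : Type) [Ring B] [Bialgebra ℂ B] extends Subalgebra ℂ B where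
  comul_mem' : ∀ x ∈ carrier, Coalgebra.comul (R := ℂ) x ∈
    LinearMap.range (TensorProduct.map toSubalgebra.val.toLinearMap toSubalgebra.val.toLinearMap)

namespace Subbialgebra

variable {B : Type} [Ring B] [Bialgebra ℂ B]

instance : CoeSort (Subbialgebra B) Type := ⟨fun P => P.toSubalgebra⟩

/-- The inclusion. -/
def incl (P : Subbialgebra B) : P →ₗ[ℂ] B := P.toSubalgebra.val.toLinearMap

theorem incl_injective (P : Subbialgebra B) : Function.Injective P.incl := Subtype.val_injective

theorem map_incl_injective (P : Subbialgebra B) :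
    Function.Injective (TensorProduct.map P.incl P.incl) :=
  Module.Flat.tensorProduct_mapIncl_injective_of_right
    (Subalgebra.toSubmodule P.toSubalgebra) (Subalgebra.toSubmodule P.toSubalgebra)

/-- The restriction of the comultiplication of `B` to a map `P → P ⊗ P`. -/
def comulLin (P : Subbialgebra B) : P →ₗ[ℂ] P ⊗[ℂ] P :=
  (LinearEquiv.ofInjective _ P.map_incl_injective).symm.toLinearMap ∘ₗ
    LinearMap.codRestrict (LinearMap.range (TensorProduct.map P.incl P.incl))
      (Coalgebra.comul ∘ₗ P.incl) (fun x => P.comul_mem' x.1 x.2)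

theorem map_incl_comulLin (P : Subbialgebra B) (x : P) :
    TensorProduct.map P.incl P.incl (P.comulLin x) = Coalgebra.comul (R := ℂ) (x : B) := by
  have h := LinearEquiv.ofInjective_symm_apply (f := TensorProduct.map P.incl P.incl)
    (h := P.map_incl_injective) (LinearMap.codRestrict (LinearMap.range (TensorProduct.map P.incl P.incl))
      (Coalgebra.comul ∘ₗ P.incl) (fun x => P.comul_mem' x.1 x.2) x)
  exact h

set_option synthInstance.maxHeartbeats 200000 in
instance (P : Subbialgebra B) : Coalgebra ℂ P.toSubalgebra where
  comul := P.comulLin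
  counit := Coalgebra.counit ∘ₗ P.incl
  coassoc := by
    ext x
    have inj : Function.Injective (TensorProduct.map P.incl (TensorProduct.map P.incl P.incl)) :=
      TensorProduct.map_injective_of_flat_flat _ _ P.incl_injective P.map_incl_injective
    apply inj
    have key1 : ∀ t : P ⊗[ℂ] P, TensorProduct.map P.incl (TensorProduct.map P.incl P.incl)
        (TensorProduct.assoc ℂ P P P (P.comulLin.rTensor P t)) =
        TensorProduct.assoc ℂ B B B
          (Coalgebra.comul.rTensor B (TensorProduct.map P.incl P.incl t)) := by
      intro t
      induction t using TensorProduct.induction_on with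
      | zero => simp
      | add a b ha hb => simp only [map_add, ha, hb]
      | tmul p q =>
        rw [LinearMap.rTensor_tmul, TensorProduct.map_tmul, LinearMap.rTensor_tmul,
          show P.incl p = (p : B) from rfl, ← map_incl_comulLin]
        generalize P.comulLin p = s
        induction s using TensorProduct.induction_on with
        | zero => simp
        | add a b ha hb => simp only [map_add, add_tmul, ha, hb]
        | tmul a b => simp
    have key2 : ∀ t : P ⊗[ℂ] P, TensorProduct.map P.incl (TensorProduct.map P.incl P.incl)
        (P.comulLin.lTensor P t) =
          (Coalgebra.comul.lTensor B (TensorProduct.map P.incl P.incl t)) := by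
      intro t
      induction t using TensorProduct.induction_on with
      | zero => simp
      | add a b ha hb => simp only [map_add, ha, hb]
      | tmul p q =>
        rw [LinearMap.lTensor_tmul, TensorProduct.map_tmul, TensorProduct.map_tmul,
          LinearMap.lTensor_tmul, map_incl_comulLin]; rfl
    simp only [LinearMap.coe_comp, Function.comp_apply, LinearEquiv.coe_coe]
    rw [key1, key2, map_incl_comulLin]
    exact Coalgebra.coassoc_apply _
  rTensor_counit_comp_comul := by
    ext x
    have inj : Function.Injective (TensorProduct.map (LinearMap.id (R := ℂ) (M := ℂ)) P.incl) :=
      TensorProduct.map_injective_of_flat_flat _ _ Function.injective_id P.incl_injective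
    apply inj
    have key : ∀ t : P ⊗[ℂ] P, TensorProduct.map (LinearMap.id (R := ℂ) (M := ℂ)) P.incl
        ((Coalgebra.counit ∘ₗ P.incl).rTensor P t) =
          (Coalgebra.counit.rTensor B (TensorProduct.map P.incl P.incl t)) := by
      intro t
      induction t using TensorProduct.induction_on with
      | zero => simp
      | add a b ha hb => simp only [map_add, ha, hb]
      | tmul p q => simp
    simp only [LinearMap.coe_comp, Function.comp_apply]
    rw [key, map_incl_comulLin, Coalgebra.rTensor_counit_comul]
    simp [incl]
  lTensor_counit_comp_comul := by
    ext x
    have inj : Function.Injective (TensorProduct.map P.incl (LinearMap.id (R := ℂ) (M := ℂ))) :=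
      TensorProduct.map_injective_of_flat_flat _ _ P.incl_injective Function.injective_id
    apply inj
    have key : ∀ t : P ⊗[ℂ] P, TensorProduct.map P.incl (LinearMap.id (R := ℂ) (M := ℂ))
        ((Coalgebra.counit ∘ₗ P.incl).lTensor P t) =
          (Coalgebra.counit.lTensor B (TensorProduct.map P.incl P.incl t)) := by
      intro t
      induction t using TensorProduct.induction_on with
      | zero => simp
      | add a b ha hb => simp only [map_add, ha, hb]
      | tmul p q => simp
    simp only [LinearMap.coe_comp, Function.comp_apply]
    rw [key, map_incl_comulLin, Coalgebra.lTensor_counit_comul]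
    simp [incl]

theorem map_incl_mul (P : Subbialgebra B) (s t : P ⊗[ℂ] P) :
    TensorProduct.map P.incl P.incl (s * t) =
      TensorProduct.map P.incl P.incl s * TensorProduct.map P.incl P.incl t := by
  induction s using TensorProduct.induction_on with
  | zero => simp
  | add a b ha hb => simp only [map_add, add_mul, ha, hb]
  | tmul p q =>
    induction t using TensorProduct.induction_on with
    | zero => simp
    | add a b ha hb => simp only [map_add, mul_add, ha, hb]
    | tmul p' q' => simp [incl]

instance (P : Subbialgebra B) : Bialgebra ℂ P.toSubalgebra :=
  Bialgebra.mk' ℂ P.toSubalgebra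
    (Bialgebra.counit_one (R := ℂ) (A := B))
    (fun {a b} => Bialgebra.counit_mul (R := ℂ) (a : B) (b : B))
    (P.map_incl_injective (by
      refine (P.map_incl_comulLin 1).trans ?_
      simp [Algebra.TensorProduct.one_def, incl]))
    (fun {a b} => P.map_incl_injective (by
      refine (P.map_incl_comulLin (a * b)).trans ?_
      refine Eq.trans ?_ (P.map_incl_mul (P.comulLin a) (P.comulLin b)).symm
      rw [map_incl_comulLin, map_incl_comulLin]
      exact Bialgebra.comul_mul (R := ℂ) (a : B) (b : B)))

/-- The image of a bialgebra morphism, as a sub-bialgebra of its target. -/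
def range {A : Type} [Ring A] [Bialgebra ℂ A] (f : A →ₐc[ℂ] B) : Subbialgebra B where
  __ := (f : A →ₐ[ℂ] B).range
  comul_mem' := by
    rintro _ ⟨a, rfl⟩
    refine ⟨TensorProduct.map (f : A →ₐ[ℂ] B).rangeRestrict.toLinearMap
      (f : A →ₐ[ℂ] B).rangeRestrict.toLinearMap (Coalgebra.comul (R := ℂ) a), ?_⟩
    rw [← LinearMap.comp_apply, ← TensorProduct.map_comp]
    exact CoalgHomClass.map_comp_comul_apply f a

/-- The grading induced on a sub-bialgebra: `P ∩ 𝒜 n`. -/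
def grading (P : Subbialgebra B) (𝒜 : ℕ → Submodule ℂ B) (n : ℕ) : Submodule ℂ P :=
  (𝒜 n).comap P.incl

end Subbialgebra

/-! ### Quasisymmetric functions -/

namespace QSh

variable {A : Type} {L : LetterProduct A}

/-- The grading in which the word `a₁ ⋯ aₗ` has degree `deg a₁ + ⋯ + deg aₗ`. -/
def grading (L : LetterProduct A) (deg : A → ℕ) (n : ℕ) : Submodule ℂ (QSh L) :=
  Submodule.span ℂ (word L '' {w | (w.map deg).sum = n})
end QSh

theorem QSh.op_add (a b : ℕ+) : LetterProduct.add.op a b = some (a + b) := rfl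

/-- Quasisymmetric functions: the basis word `α = (α₁, …, αₗ)`, a composition, is the monomial
quasisymmetric function `M_α = ∑_{i₁ < ⋯ < iₗ} x_{i₁}^{α₁} ⋯ x_{iₗ}^{αₗ}`; such functions multiply
by quasi-shuffle of compositions, and their coproduct is deconcatenation. -/
abbrev QSym : Type := QSh LetterProduct.add

namespace QSym

/-- The monomial quasisymmetric function `M_α`. -/
abbrev M (α : List ℕ+) : QSym := QSh.word LetterProduct.add α

/-- `QSym_n` is spanned by the `M_α` with `α` a composition of `n`. -/
def grading : ℕ → Submodule ℂ QSym := QSh.grading LetterProduct.add (fun a : ℕ+ => (a : ℕ))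

/-- The linear form `f(x₁, x₂, …) ↦ f(1, 0, 0, …)`: it sends `M_α` to `1` if `α` has at most one
part and to `0` otherwise. -/
def zetaLin : QSym →ₗ[ℂ] ℂ :=
  (QSh.basis LetterProduct.add).constr ℂ (fun α => if α.length ≤ 1 then 1 else 0)

theorem zetaLin_M (α : List ℕ+) : zetaLin (M α) = if α.length ≤ 1 then 1 else 0 := by
  simp [zetaLin, M, QSh.word, Module.Basis.constr_basis]

theorem zetaLin_cons (x : ℕ+) (f : QSym) : zetaLin (QSh.cons x f) = QSh.coeff [] f := by
  induction f using QSh.induction with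
  | hw w => rw [QSh.cons_word, zetaLin_M, QSh.coeff_word]; cases w <;> simp
  | hadd f g hf hg => simp only [map_add, hf, hg]
  | hsmul c f hf => simp only [map_smul, hf]

theorem zetaLin_one : zetaLin 1 = 1 := by
  rw [QSh.one_def, zetaLin_M]; simp

theorem zetaLin_mul (f g : QSym) : zetaLin (f * g) = zetaLin f * zetaLin g := by
  induction f using QSh.induction with
  | hw u =>
    induction g using QSh.induction with
    | hw v =>
      cases u with
      | nil => rw [← QSh.one_def, one_mul, zetaLin_one, one_mul]
      | cons x u =>
        cases v with
        | nil => rw [← QSh.one_def, mul_one, zetaLin_one, mul_one]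
        | cons y v =>
          rw [← QSh.cons_word, ← QSh.cons_word, QSh.cons_mul_cons]
          simp only [QSh.op_add, QSh.consOpt, map_add, zetaLin_cons, QSh.coeff_nil_cons,
            QSh.coeff_nil_mul]
          simp
    | hadd f g hf hg => simp only [mul_add, map_add, hf, hg]
    | hsmul c f hf => simp only [mul_smul_comm, map_smul, hf, smul_eq_mul]; ring
  | hadd f g hf hg => simp only [add_mul, map_add, hf, hg]
  | hsmul c f hf => simp only [smul_mul_assoc, map_smul, hf, smul_eq_mul]; ring

/-- The canonical character of `QSym`, `f(x₁, x₂, …) ↦ f(1, 0, 0, …)`. -/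
def zeta : QSym →ₐ[ℂ] ℂ := AlgHom.ofLinearMap zetaLin zetaLin_one zetaLin_mul

/-- `f = ∑ c_α M_α` is a symmetric function: `c_α` only depends on the multiset of parts of `α`. -/
def IsSymm (f : QSym) : Prop := ∀ α β : List ℕ+, α.Perm β → QSh.coeff α f = QSh.coeff β f


theorem ext_coeff {f g : QSym} (h : ∀ w, QSh.coeff w f = QSh.coeff w g) : f = g :=
  (QSh.basis LetterProduct.add).ext_elem h

/-- Removing a first letter `x`; words that do not begin with `x` are sent to `0`. -/
def strip (x : ℕ+) : QSym →ₗ[ℂ] QSym :=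
  (QSh.basis LetterProduct.add).constr ℂ fun w => match w with
    | [] => 0
    | y :: w => if y = x then M w else 0

theorem strip_one (x : ℕ+) : strip x 1 = 0 := by
  simp [QSh.one_def, strip, QSh.word, Module.Basis.constr_basis]

theorem strip_cons (x y : ℕ+) (f : QSym) : strip x (QSh.cons y f) = if y = x then f else 0 := by
  induction f using QSh.induction with
  | hw u => rw [QSh.cons_word]; simp [strip, QSh.word, Module.Basis.constr_basis, M]
  | hadd f g hf hg => simp only [map_add, hf, hg]; split_ifs <;> simp
  | hsmul c f hf => simp only [map_smul, hf]; split_ifs <;> simp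

theorem coeff_strip (x : ℕ+) (f : QSym) (w : List ℕ+) :
    QSh.coeff w (strip x f) = QSh.coeff (x :: w) f := by
  induction f using QSh.induction with
  | hw u =>
    cases u with
    | nil => rw [← QSh.one_def, strip_one, QSh.one_def, QSh.coeff_word]; simp
    | cons y u =>
      rw [← QSh.cons_word, strip_cons, QSh.cons_word, QSh.coeff_word]
      by_cases h : y = x
      · subst h; simp [QSh.coeff_word]
      · simp [h, Ne.symm h]
  | hadd f g hf hg => simp only [map_add, hf, hg]
  | hsmul c f hf => simp only [map_smul, hf]

/-- The ways to write `x` as an ordered sum of two positive integers. -/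
def splits (x : ℕ+) : Finset (ℕ+ × ℕ+) :=
  (Finset.Icc 1 x ×ˢ Finset.Icc 1 x).filter fun p => p.1 + p.2 = x

theorem mem_splits (x : ℕ+) (p : ℕ+ × ℕ+) : p ∈ splits x ↔ p.1 + p.2 = x := by
  simp only [splits, Finset.mem_filter, Finset.mem_product, Finset.mem_Icc, one_le, true_and,
    and_iff_right_iff_imp]
  rintro rfl
  exact ⟨(PNat.lt_add_right _ _).le, (PNat.lt_add_left _ _).le⟩

theorem strip_mul (x : ℕ+) (f g : QSym) :
    strip x (f * g) = strip x f * g + f * strip x g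
      + ∑ p ∈ splits x, strip p.1 f * strip p.2 g := by
  induction f using QSh.induction with
  | hw u =>
    induction g using QSh.induction with
    | hw v =>
      cases u with
      | nil => rw [← QSh.one_def]; simp [strip_one]
      | cons y u =>
        cases v with
        | nil => rw [← QSh.one_def]; simp [strip_one]
        | cons z v =>
          rw [← QSh.cons_word, ← QSh.cons_word]
          generalize QSh.word LetterProduct.add u = f, QSh.word LetterProduct.add v = g
          rw [QSh.cons_mul_cons, QSh.op_add, QSh.consOpt, map_add, map_add]
          simp only [strip_cons]
          congr 1
          · congr 1 <;> split_ifs <;> simp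
          · by_cases h : y + z = x
            · rw [if_pos h, Finset.sum_eq_single (y, z)]
              · simp
              · rintro ⟨a, b⟩ _ hne
                by_cases h1 : y = a <;> by_cases h2 : z = b <;> simp_all
              · intro h'; exact absurd ((mem_splits x (y, z)).2 h) h'
            · rw [if_neg h, Finset.sum_eq_zero]
              rintro ⟨a, b⟩ hp
              rw [mem_splits] at hp
              by_cases h1 : y = a <;> by_cases h2 : z = b <;> simp_all
    | hadd f g hf hg =>
      simp only [mul_add, map_add, hf, hg, Finset.sum_add_distrib]; abel
    | hsmul c f hf => simp only [mul_smul_comm, map_smul, hf, Finset.smul_sum, smul_add]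
  | hadd f g hf hg => simp only [add_mul, map_add, hf, hg, Finset.sum_add_distrib]; abel
  | hsmul c f hf => simp only [smul_mul_assoc, map_smul, hf, Finset.smul_sum, smul_add]

theorem IsSymm.strip {f : QSym} (hf : IsSymm f) (x : ℕ+) : IsSymm (strip x f) := by
  intro α β h
  rw [coeff_strip, coeff_strip]
  exact hf _ _ (h.cons x)

theorem IsSymm.strip_comm {f : QSym} (hf : IsSymm f) (x y : ℕ+) :
    QSym.strip x (QSym.strip y f) = QSym.strip y (QSym.strip x f) := by
  refine ext_coeff fun w => ?_
  simp only [coeff_strip]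
  exact hf _ _ (List.Perm.swap x y w)

theorem IsSymm.strip_comm_mul {f g : QSym} (hf : IsSymm f) (hg : IsSymm g) (x y : ℕ+) :
    QSym.strip x (QSym.strip y (f * g)) = QSym.strip y (QSym.strip x (f * g)) := by
  simp only [strip_mul, map_add, map_sum, Finset.sum_add_distrib]
  rw [Finset.sum_comm (s := splits y) (t := splits x)]
  have e1 : ∀ a b : ℕ+, QSym.strip a (QSym.strip b f) = QSym.strip b (QSym.strip a f) :=
    hf.strip_comm
  have e2 : ∀ a b : ℕ+, QSym.strip a (QSym.strip b g) = QSym.strip b (QSym.strip a g) :=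
    hg.strip_comm
  have h3 : ∑ a ∈ splits x, ∑ b ∈ splits y,
      QSym.strip a.1 (QSym.strip b.1 f) * QSym.strip a.2 (QSym.strip b.2 g) =
      ∑ a ∈ splits x, ∑ b ∈ splits y,
        QSym.strip b.1 (QSym.strip a.1 f) * QSym.strip b.2 (QSym.strip a.2 g) :=
    Finset.sum_congr rfl fun a _ => Finset.sum_congr rfl fun b _ => by rw [e1 a.1, e2 a.2]
  have h1 (u v : ℕ+) : ∑ a ∈ splits u, QSym.strip a.1 (QSym.strip v f) * QSym.strip a.2 g =
      ∑ a ∈ splits u, QSym.strip v (QSym.strip a.1 f) * QSym.strip a.2 g :=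
    Finset.sum_congr rfl fun a _ => by rw [e1 a.1]
  have h2 (u v : ℕ+) : ∑ a ∈ splits u, QSym.strip a.1 f * QSym.strip a.2 (QSym.strip v g) =
      ∑ a ∈ splits u, QSym.strip a.1 f * QSym.strip v (QSym.strip a.2 g) :=
    Finset.sum_congr rfl fun a _ => by rw [e2 a.2]
  rw [h1, h2, h1, h2, h3, e1 x y, e2 x y]
  abel

theorem IsSymm.mul {f g : QSym} (hf : IsSymm f) (hg : IsSymm g) : IsSymm (f * g) := by
  intro α β h
  induction h generalizing f g with
  | nil => rfl
  | cons x h ih =>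
    simp only [← coeff_strip, strip_mul, map_add, map_sum]
    rw [ih (hf.strip x) hg, ih hf (hg.strip x)]
    congr 1
    exact Finset.sum_congr rfl fun p _ => ih (hf.strip _) (hg.strip _)
  | swap x y w =>
    rw [← coeff_strip, ← coeff_strip, ← coeff_strip, ← coeff_strip, hf.strip_comm_mul hg]
  | trans _ _ ih1 ih2 => exact (ih1 hf hg).trans (ih2 hf hg)

/-- The compositions whose multiset of parts is `s`. -/
def arrangements (s : Multiset ℕ+) : Finset (List ℕ+) := s.lists.toFinset

theorem mem_arrangements (s : Multiset ℕ+) (α : List ℕ+) :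
    α ∈ arrangements s ↔ s = (α : Multiset ℕ+) := by
  simp [arrangements, Multiset.mem_lists_iff]

/-- The monomial symmetric function of a partition. -/
def m (s : Multiset ℕ+) : QSym := ∑ α ∈ arrangements s, M α

theorem isSymm_m (s : Multiset ℕ+) : IsSymm (m s) := by
  intro α β h
  simp only [m, map_sum, QSh.coeff_word, Finset.sum_ite_eq, mem_arrangements]
  rw [Multiset.coe_eq_coe.2 h]

theorem IsSymm.eq_sum {f : QSym} (hf : IsSymm f) :
    ∃ (t : Finset (Multiset ℕ+)) (c : Multiset ℕ+ → ℂ), f = ∑ s ∈ t, c s • m s := by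
  classical
  refine ⟨Finset.image (fun α : List ℕ+ => (α : Multiset ℕ+))
      ((QSh.basis LetterProduct.add).repr f).support,
    fun s => QSh.coeff s.toList f, ext_coeff fun w => ?_⟩
  simp only [m, map_sum, map_smul, QSh.coeff_word, Finset.sum_ite_eq, mem_arrangements,
    smul_eq_mul, mul_ite, mul_one, mul_zero]
  have hw : QSh.coeff (Multiset.toList (w : Multiset ℕ+)) f = QSh.coeff w f :=
    hf _ _ (Multiset.coe_eq_coe.1 (Multiset.coe_toList _))
  rw [Finset.sum_ite_eq', hw]
  split_ifs with h
  · rfl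
  · by_contra h0
    exact h (Finset.mem_image.2 ⟨w, Finsupp.mem_support_iff.2 h0, rfl⟩)

theorem comul_m (s : Multiset ℕ+) : Coalgebra.comul (R := ℂ) (m s) =
    ∑ p ∈ s.antidiagonal.toFinset, m p.1 ⊗ₜ[ℂ] m p.2 := by
  classical
  simp only [m, map_sum, QSh.comul_def, QSh.comulLin_word, sum_tmul, tmul_sum]
  have h : ∀ p : Multiset ℕ+ × Multiset ℕ+,
      (∑ β ∈ arrangements p.2, ∑ α ∈ arrangements p.1, M α ⊗ₜ[ℂ] M β)
        = ∑ q ∈ arrangements p.1 ×ˢ arrangements p.2, M q.1 ⊗ₜ[ℂ] M q.2 :=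
    fun p => by rw [Finset.sum_product_right]
  simp only [h]
  rw [Finset.sum_sigma', Finset.sum_sigma']
  refine Finset.sum_bij'
    (fun a _ => ⟨((a.1.take a.2 : List ℕ+), (a.1.drop a.2 : List ℕ+)),
      (a.1.take a.2, a.1.drop a.2)⟩)
    (fun b _ => ⟨b.2.1 ++ b.2.2, b.2.1.length⟩) ?_ ?_ ?_ ?_ ?_
  · rintro ⟨α, i⟩ ha
    simp only [Finset.mem_sigma, mem_arrangements, Finset.mem_range] at ha
    simp only [Finset.mem_sigma, Finset.mem_product, Multiset.mem_toFinset,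
      Multiset.mem_antidiagonal, mem_arrangements, ha.1, Multiset.coe_add,
      List.take_append_drop, and_self]
  · rintro ⟨⟨s1, s2⟩, ⟨u, v⟩⟩ hb
    simp only [Finset.mem_sigma, mem_arrangements, Finset.mem_product, Multiset.mem_toFinset,
      Multiset.mem_antidiagonal] at hb
    obtain ⟨h1, rfl, rfl⟩ := hb
    simp [mem_arrangements, ← h1]
  · rintro ⟨α, i⟩ ha
    simp only [Finset.mem_sigma, Finset.mem_range] at ha
    simp
    omega
  · rintro ⟨⟨s1, s2⟩, ⟨u, v⟩⟩ hb
    simp only [Finset.mem_sigma, mem_arrangements, Finset.mem_product, Multiset.mem_toFinset,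
      Multiset.mem_antidiagonal] at hb
    obtain ⟨h1, rfl, rfl⟩ := hb
    simp
  · rintro ⟨α, i⟩ ha
    rfl

theorem isSymm_one : IsSymm 1 := by
  intro α β h
  rw [QSh.one_def, QSh.coeff_word, QSh.coeff_word]
  have : α = [] ↔ β = [] := ⟨fun e => by subst e; exact h.nil_eq.symm, fun e => by subst e; exact h.eq_nil⟩
  simp [this]

end QSym

/-- The Hopf algebra of symmetric functions, inside `QSym`. -/
def SymFn : Subbialgebra QSym where
  carrier := {f | QSym.IsSymm f}
  mul_mem' hf hg := QSym.IsSymm.mul hf hg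
  one_mem' := QSym.isSymm_one
  add_mem' hf hg α β h := by simp only [map_add, hf α β h, hg α β h]
  algebraMap_mem' c α β h := by
    simp only [Algebra.algebraMap_eq_smul_one, map_smul, QSym.isSymm_one α β h]
  zero_mem' α β h := by simp
  comul_mem' f hf := by
    obtain ⟨t, c, rfl⟩ := QSym.IsSymm.eq_sum hf
    rw [map_sum]
    refine Submodule.sum_mem _ fun s _ => ?_
    rw [map_smul, QSym.comul_m]
    refine Submodule.smul_mem _ _ (Submodule.sum_mem _ fun p _ => ?_)
    exact ⟨⟨_, QSym.isSymm_m p.1⟩ ⊗ₜ ⟨_, QSym.isSymm_m p.2⟩, rfl⟩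

/-! ### Noncommutative symmetric functions -/

/-- Noncommutative symmetric functions: the free algebra on `H₁, H₂, …`. -/
abbrev NSym : Type := FreeAlgebra ℂ ℕ+

namespace NSym

/-- The generator `H_n`, with `H_0 = 1`. -/
def H (n : ℕ) : NSym := if h : 0 < n then FreeAlgebra.ι ℂ ⟨n, h⟩ else 1

/-- `Δ(H_n) = ∑_{i+j=n} H_i ⊗ H_j`. -/
def comulAlg : NSym →ₐ[ℂ] NSym ⊗[ℂ] NSym :=
  FreeAlgebra.lift ℂ fun n : ℕ+ => ∑ p ∈ Finset.HasAntidiagonal.antidiagonal (n : ℕ), H p.1 ⊗ₜ[ℂ] H p.2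

/-- The counit sends `H_n` to `0` for `n ≥ 1`. -/
def counitAlg : NSym →ₐ[ℂ] ℂ := FreeAlgebra.lift ℂ fun _ => 0

theorem H_zero : H 0 = 1 := by simp [H]

theorem H_pnat (n : ℕ+) : H n = FreeAlgebra.ι ℂ n := dif_pos n.pos

theorem comulAlg_H (n : ℕ) : comulAlg (H n) = ∑ p ∈ Finset.HasAntidiagonal.antidiagonal n, H p.1 ⊗ₜ[ℂ] H p.2 := by
  rcases Nat.eq_zero_or_pos n with rfl | h
  · simp [H_zero, Algebra.TensorProduct.one_def]
  · obtain ⟨n, rfl⟩ : ∃ m : ℕ+, n = m := ⟨⟨n, h⟩, rfl⟩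
    rw [H_pnat, comulAlg, FreeAlgebra.lift_ι_apply]

theorem counitAlg_H (n : ℕ) : counitAlg (H n) = if n = 0 then 1 else 0 := by
  rcases Nat.eq_zero_or_pos n with rfl | h
  · simp [H_zero]
  · obtain ⟨n, rfl⟩ : ∃ m : ℕ+, n = m := ⟨⟨n, h⟩, rfl⟩
    rw [H_pnat, counitAlg, FreeAlgebra.lift_ι_apply]
    simp

instance : Bialgebra ℂ NSym :=
  Bialgebra.ofAlgHom comulAlg counitAlg
    (by
      ext n
      simp only [AlgHom.coe_comp, Function.comp_apply, ← H_pnat, comulAlg_H, map_sum,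
        Algebra.TensorProduct.map_tmul, sum_tmul, tmul_sum, AlgHom.coe_id, id_eq,
        AlgEquiv.toAlgHom_apply, Algebra.TensorProduct.assoc_tmul]
      rw [Finset.sum_sigma', Finset.sum_sigma']
      exact Finset.sum_nbij' (fun a => ⟨(a.2.1, a.2.2 + a.1.2), (a.2.2, a.1.2)⟩)
        (fun a => ⟨(a.1.1 + a.2.1, a.2.2), (a.1.1, a.2.1)⟩)
        (by simp; grind) (by simp; grind) (by simp; grind) (by simp; grind) (by simp))
    (by
      ext n
      simp only [AlgHom.coe_comp, Function.comp_apply, ← H_pnat, comulAlg_H, map_sum,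
        Algebra.TensorProduct.map_tmul, AlgHom.coe_id, id_eq, counitAlg_H]
      rw [Finset.sum_eq_single (0, (n : ℕ))]
      · simp
      · rintro ⟨a, b⟩ h hne
        have ha : a ≠ 0 := by rintro rfl; simp at h; simp [h] at hne
        simp [ha]
      · simp)
    (by
      ext n
      simp only [AlgHom.coe_comp, Function.comp_apply, ← H_pnat, comulAlg_H, map_sum,
        Algebra.TensorProduct.map_tmul, AlgHom.coe_id, id_eq, counitAlg_H]
      rw [Finset.sum_eq_single ((n : ℕ), 0)]
      · simp
      · rintro ⟨a, b⟩ h hne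
        have ha : b ≠ 0 := by rintro rfl; simp at h; simp [h] at hne
        simp [ha]
      · simp)

end NSym

/-! ### Graded morphisms, characters, graded duals -/

/-- The bialgebra isomorphism `e` identifies the two gradings. -/
def IsGradedEquiv {H K : Type} [Ring H] [Bialgebra ℂ H] [Ring K] [Bialgebra ℂ K]
    (𝒜 : ℕ → Submodule ℂ H) (ℬ : ℕ → Submodule ℂ K) (e : H ≃ₐc[ℂ] K) : Prop :=
  ∀ n x, x ∈ 𝒜 n ↔ e x ∈ ℬ n

/-- Characters of `H`, with the convolution product. -/
abbrev Character (H : Type) [Ring H] [Bialgebra ℂ H] : Type := WithConv (H →ₐ[ℂ] ℂ)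

/-- A morphism of combinatorial Hopf algebras `(H, ζ) → (K, η)`: a morphism of graded Hopf algebras
`f` with `η ∘ f = ζ`. -/
structure IsCHAMorphism {H K : Type} [Ring H] [Bialgebra ℂ H] [Ring K] [Bialgebra ℂ K]
    (𝒜 : ℕ → Submodule ℂ H) (ζ : Character H) (ℬ : ℕ → Submodule ℂ K) (η : Character K)
    (f : H →ₐc[ℂ] K) : Prop where
  map_mem : ∀ n, ∀ x ∈ 𝒜 n, f x ∈ ℬ n
  character : ∀ x, η (f x) = ζ x

/-- `ξ` is the convolution inverse of `ζ`. -/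
def IsInverseCharacter {H : Type} [Ring H] [Bialgebra ℂ H] (ζ ξ : Character H) : Prop :=
  ξ * ζ = 1 ∧ ζ * ξ = 1

/-- `χ` is the character that equals `(-1)^n ξ` in degree `n`. -/
def IsBarCharacter {H : Type} [Ring H] [Bialgebra ℂ H] (𝒜 : ℕ → Submodule ℂ H)
    (ξ χ : Character H) : Prop :=
  ∀ n, ∀ x ∈ 𝒜 n, χ x = (-1) ^ n * ξ x

/-- `Θ` is a morphism of combinatorial Hopf algebras from `H` with the character `χ ζ`, where `χ` is
the bar of the inverse of `ζ`, to `H` with the character `ζ`. -/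
def IsThetaMorphism {H : Type} [Ring H] [Bialgebra ℂ H] (𝒜 : ℕ → Submodule ℂ H)
    (ζ : Character H) (Θ : H →ₐc[ℂ] H) : Prop :=
  ∃ ξ χ : Character H, IsInverseCharacter ζ ξ ∧ IsBarCharacter 𝒜 ξ χ ∧
    IsCHAMorphism 𝒜 (χ * ζ) 𝒜 ζ Θ

/-- The linear forms on `H` that vanish on `𝒜 m` for all `m ≠ n`: the dual of `𝒜 n`. -/
def gradedDualPiece {H : Type} [AddCommGroup H] [Module ℂ H] (𝒜 : ℕ → Submodule ℂ H) (n : ℕ) :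
    Submodule ℂ (Module.Dual ℂ H) :=
  ⨅ (m : ℕ) (_ : m ≠ n), (𝒜 m).dualAnnihilator

/-- The graded dual, the sum of the duals of the homogeneous components. -/
def gradedDual {H : Type} [AddCommGroup H] [Module ℂ H] (𝒜 : ℕ → Submodule ℂ H) :
    Submodule ℂ (Module.Dual ℂ H) :=
  ⨆ n, gradedDualPiece 𝒜 n

/-- The linear isomorphism `e` from `K` onto the graded dual of `H` is an isomorphism of graded Hopf
algebras. The product and the unit of the graded dual are the transposes of the coproduct and the
counit of `H`; its coproduct `φ ↦ ∑ φ₁ ⊗ φ₂` and its counit are the transposes of the product and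
the unit: `φ(h k) = ∑ φ₁(h) φ₂(k)` and `ε(φ) = φ(1)`. -/
structure IsHopfIsoGradedDual {K H : Type} [Ring K] [Bialgebra ℂ K] [Ring H] [Bialgebra ℂ H]
    (𝒦 : ℕ → Submodule ℂ K) (ℋ : ℕ → Submodule ℂ H) (e : K ≃ₗ[ℂ] gradedDual ℋ) : Prop where
  graded : ∀ n x, x ∈ 𝒦 n ↔ (e x : Module.Dual ℂ H) ∈ gradedDualPiece ℋ n
  map_one : (e 1 : Module.Dual ℂ H) = Coalgebra.counit
  map_mul : ∀ x y, (e (x * y) : Module.Dual ℂ H) =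
    LinearMap.mul' ℂ ℂ ∘ₗ TensorProduct.map (e x : Module.Dual ℂ H) (e y : Module.Dual ℂ H)
      ∘ₗ Coalgebra.comul
  map_counit : ∀ x, (e x : Module.Dual ℂ H) 1 = Coalgebra.counit (R := ℂ) x
  map_comul : ∀ x h k, (e x : Module.Dual ℂ H) (h * k) =
    LinearMap.mul' ℂ ℂ (TensorProduct.map
      (Module.Dual.eval ℂ H h ∘ₗ (gradedDual ℋ).subtype ∘ₗ e.toLinearMap)
      (Module.Dual.eval ℂ H k ∘ₗ (gradedDual ℋ).subtype ∘ₗ e.toLinearMap)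
      (Coalgebra.comul (R := ℂ) x))

/-! ### The theta maps of `QSym` and `Sym` -/

/-- `Θ` is the theta map of `QSym`; its image is the peak algebra `Π`. -/
def IsThetaQSym (Θ : QSym →ₐc[ℂ] QSym) : Prop :=
  IsThetaMorphism QSym.grading (WithConv.toConv QSym.zeta) Θ

/-- The grading of symmetric functions by degree. -/
def SymFn.grading : ℕ → Submodule ℂ SymFn := Subbialgebra.grading SymFn QSym.grading

/-- The restriction of the canonical character to symmetric functions. -/
def SymFn.zeta : SymFn →ₐ[ℂ] ℂ := QSym.zeta.comp SymFn.toSubalgebra.val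

/-- `Θ` is the theta map of `Sym`; its image is the algebra `Ω` of Schur `Q`-functions. -/
def IsThetaSym (Θ : SymFn →ₐc[ℂ] SymFn) : Prop :=
  IsThetaMorphism SymFn.grading (WithConv.toConv SymFn.zeta) Θ

/-! ### The shuffle basis -/

namespace QSym

/-- All ways to cut a composition into consecutive nonempty blocks. They correspond to the
compositions `β ≤ α`: the parts of `β` are the sums of the blocks. -/
def blockings : List ℕ+ → List (List (List ℕ+))
  | [] => [[]]
  | a :: α => (blockings α).flatMap fun B => match B with
    | [] => [[[a]]]
    | b :: B' => [[a] :: b :: B', (a :: b) :: B']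

/-- The sum of a nonempty block. -/
def blockSum (b : List ℕ+) : ℕ+ := (b.map PNat.val).sum.toPNat'

/-- `1 / (o! e!)`, where the block has `o` odd and `e` even parts. -/
def blockCoeff (b : List ℕ+) : ℂ :=
  1 / (((b.countP fun a : ℕ+ => Odd (a : ℕ)).factorial : ℂ) *
    ((b.countP fun a : ℕ+ => Even (a : ℕ)).factorial : ℂ))

/-- No odd part of the block is immediately followed by an even part. -/
def NoOtE (b : List ℕ+) : Prop :=
  b.IsChain fun a a' : ℕ+ => ¬ (Odd (a : ℕ) ∧ Even (a' : ℕ))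

open Classical in
/-- The shuffle function `S_α`, the sum of `c_α^β M_β` over `m_o(α) ≤ β ≤ α`: the lower bound says
that `α` is cut wherever an odd part is followed by an even one. -/
def S (α : List ℕ+) : QSym :=
  ((blockings α).map fun B =>
    if ∀ b ∈ B, NoOtE b then (B.map blockCoeff).prod • M (B.map blockSum) else 0).sum

/-- The scaled power sum `p_n = M_n / n`. -/
def p (n : ℕ+) : QSym := (1 / (n : ℂ)) • M [n]

end QSym

/-! ### The theta map of `NSym` -/

namespace NSym

/-- `NSym_n` is spanned by the products `H_α = H_{α₁} ⋯ H_{αₗ}` with `α` a composition of `n`. -/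
def grading (n : ℕ) : Submodule ℂ NSym :=
  Submodule.span ℂ ((fun α : List ℕ+ => (α.map fun a : ℕ+ => H a).prod) ''
    {α | (α.map fun a : ℕ+ => (a : ℕ)).sum = n})

/-- The pairing with `⟨H_α, M_β⟩ = δ_{α,β}`; the basis used for `NSym` is that of the `H_α`. -/
def pairing : NSym →ₗ[ℂ] QSym →ₗ[ℂ] ℂ :=
  (FreeAlgebra.basisFreeMonoid ℂ ℕ+).constr ℂ fun w => QSh.coeff (FreeMonoid.toList w)

/-- `b` is the family dual to the shuffle basis: `⟨b_α, S_β⟩ = δ_{α,β}`. -/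
def IsDualShuffleBasis (b : List ℕ+ → NSym) : Prop :=
  ∀ α β, pairing (b α) (QSym.S β) = if α = β then 1 else 0

open Classical in
/-- `Θ` multiplies `b_α` by `2^{ℓ(α)}` if all parts of `α` are odd and kills it otherwise. -/
def IsThetaNSym (b : List ℕ+ → NSym) (Θ : NSym →ₐc[ℂ] NSym) : Prop :=
  ∀ α, Θ (b α) = if ∀ a ∈ α, Odd (a : ℕ) then (2 : ℂ) ^ α.length • b α else 0

end NSym

/-! ### The shuffle and the symmetric algebra on odd generators

`V` has basis `v₁, v₂, …` with `deg vᵢ = i`, and `O(V)` is spanned by the `vᵢ` with `i` odd. -/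

/-- The index set of the basis of `O(V)`. -/
abbrev OddPos : Type := {n : ℕ+ // Odd (n : ℕ)}

/-- The shuffle algebra on `O(V)`. -/
abbrev ShuffleOdd : Type := QSh (LetterProduct.zero OddPos)

/-- The grading of the shuffle algebra with `deg vᵢ = i`. -/
def ShuffleOdd.grading : ℕ → Submodule ℂ ShuffleOdd :=
  QSh.grading (LetterProduct.zero OddPos) (fun a : OddPos => (a.1 : ℕ))

/-- The word `v_α` in the shuffle algebra. -/
def ShuffleOdd.word (α : List OddPos) : ShuffleOdd := QSh.word (LetterProduct.zero OddPos) α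

/-- The symmetric algebra on `O(V)`, with primitive generators. -/
abbrev SymOdd : Type := SymmetricAlgebra ℂ (OddPos →₀ ℂ)

/-- The generator `vᵢ` of the symmetric algebra. -/
def SymOdd.gen (a : OddPos) : SymOdd := SymmetricAlgebra.ι ℂ (OddPos →₀ ℂ) (Finsupp.single a 1)

/-- The grading of the symmetric algebra with `deg vᵢ = i`. -/
def SymOdd.grading (n : ℕ) : Submodule ℂ SymOdd :=
  Submodule.span ℂ ((fun l : List OddPos => (l.map SymOdd.gen).prod) ''
    {l | (l.map fun a : OddPos => (a.1 : ℕ)).sum = n})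

/-- The peak algebra `Π`, for `Θ` the theta map of `QSym`. -/
abbrev peakAlgebra (Θ : QSym →ₐc[ℂ] QSym) : Subbialgebra QSym := Subbialgebra.range Θ

/-- The grading of `Π` by degree. -/
def peakGrading (Θ : QSym →ₐc[ℂ] QSym) : ℕ → Submodule ℂ (peakAlgebra Θ) :=
  (peakAlgebra Θ).grading QSym.grading

/-- The algebra `Ω` of Schur `Q`-functions, for `Θ` the theta map of `Sym`. -/
abbrev schurQAlgebra (Θ : SymFn →ₐc[ℂ] SymFn) : Subbialgebra SymFn := Subbialgebra.range Θ

/-- The grading of `Ω` by degree. -/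
def schurQGrading (Θ : SymFn →ₐc[ℂ] SymFn) : ℕ → Submodule ℂ (schurQAlgebra Θ) :=
  (schurQAlgebra Θ).grading SymFn.grading

/-- The grading by degree of the image of the theta map of `NSym`. -/
def imageGrading (Θ : NSym →ₐc[ℂ] NSym) : ℕ → Submodule ℂ (Subbialgebra.range Θ) :=
  (Subbialgebra.range Θ).grading NSym.grading

end

/-! All four statements become transparent once `QSym` is identified with a shuffle algebra. Let
`ShufflePos` be the shuffle algebra on the positive integers. For a weight `t` on letters, the form
sending a word of length n to the product of its weights divided by n! is a character, and for a
fixed letter function the weights c·o form a one-parameter group under convolution (the binomial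
theorem, `QSh.expChar_mul`). Write E(c) and O(c) for the groups of the even and of the odd letters.
The character E(1)O(1) vanishes on a word unless its even letters precede its odd ones, and is then
1/(o! e!): exactly the block coefficients in S_α (`ShufflePos.shuffleChar_word`).

Hence α ↦ S_α is the coalgebra map to `QSym` induced by E(1)O(1). A coalgebra map into `QSym` is
determined by its one-letter coefficients (`QSh.coalgHom_ext`), and in each degree these are values
of ζ (`QSym.coeff_singleton`). This uniqueness yields multiplicativity without computation
(`ShufflePos.toQSymLin_mul`); bijectivity holds because S_α is M_α plus shorter words. The result is
`ShufflePos.equivQSym`.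

Under this isomorphism the inverse of ζ is O(-1)E(-1). The bar changes the sign of the odd parameter
only, so the character defining Θ is O(1)E(-1)E(1)O(1) = O(2), which is E(1)O(1) composed with the
endomorphism doubling odd letters and killing even ones (`ShufflePos.comap_doubleOdd`). So Θ is
diagonal in the basis S_α, with eigenvalue 2^ℓ(α) on odd compositions and 0 on the others, and Π is
the shuffle algebra on the odd letters.

For Sym, the power sums M_(n) = S_(n) generate (`QSym.m_mem_adjoin`) and are eigenvectors of Θ;
therefore Θ restricts to Sym, and Ω is generated by the odd power sums. They are algebraically
independent because shuffle products of letters with different multisets of letters have disjoint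
supports (`QSh.coeff_letterProd_ne_zero`).

Both duality statements use one principle, `IsHopfPairing.exists_equiv_gradedDual`: a Hopf pairing
with homogeneous spanning families that are dual up to non-zero scalars gives an isomorphism with
the graded dual. For Ω the monomials are orthogonal for a pairing read off from shuffle
coefficients. For `NSym` the theta map is the adjoint of Θ, and the pairing with `QSym` restricts to
the image and to Π with the odd S*_α and the odd S_α as dual families. -/

noncomputable section

open TensorProduct

/-! ### Graded families of subspaces -/

section GradedFamilies

variable {A B ι : Type} [AddCommGroup A] [Module ℂ A] [AddCommGroup B] [Module ℂ B]

/-- The span of the members of a family whose degree is `n`. -/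
def spanDegree (C : ι → A) (deg : ι → ℕ) (n : ℕ) : Submodule ℂ A :=
  Submodule.span ℂ (C '' {i | deg i = n})

theorem mem_spanDegree (C : ι → A) (deg : ι → ℕ) (i : ι) : C i ∈ spanDegree C deg (deg i) :=
  Submodule.subset_span ⟨i, rfl, rfl⟩

theorem iSup_spanDegree {C : ι → A} (hC : Submodule.span ℂ (Set.range C) = ⊤) (deg : ι → ℕ) :
    ⨆ n, spanDegree C deg n = ⊤ := by
  rw [eq_top_iff, ← hC, Submodule.span_le]
  rintro _ ⟨i, rfl⟩
  exact Submodule.mem_iSup_of_mem (deg i) (mem_spanDegree C deg i)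

theorem iSupIndep_spanDegree (b : Module.Basis ι ℂ A) (deg : ι → ℕ) :
    iSupIndep (spanDegree b deg) := by
  intro n
  have h : (⨆ (m) (_ : m ≠ n), spanDegree b deg m) ≤ Submodule.span ℂ (b '' {i | deg i ≠ n}) :=
    iSup₂_le fun m hm => Submodule.span_mono (Set.image_mono
      fun i (hi : deg i = m) => show deg i ≠ n from hi ▸ hm)
  exact (b.linearIndependent.disjoint_span_image
    (Set.disjoint_left.2 fun i (hi : deg i = n) (hi' : deg i ≠ n) => hi' hi)).mono_right h

/-- Split x into its degree n part and the rest. The image of the rest lies in `ℬ n` and also in the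
sum of the other pieces, so it vanishes by independence, and injectivity kills the rest itself. -/
theorem mem_of_map_mem {𝒜 : ℕ → Submodule ℂ A} {ℬ : ℕ → Submodule ℂ B} (hA : ⨆ n, 𝒜 n = ⊤)
    (hB : iSupIndep ℬ) {f : A →ₗ[ℂ] B} (hf : Function.Injective f)
    (hm : ∀ n, ∀ x ∈ 𝒜 n, f x ∈ ℬ n) {n : ℕ} {x : A} (hx : f x ∈ ℬ n) : x ∈ 𝒜 n := by
  have hx' : x ∈ 𝒜 n ⊔ ⨆ (m) (_ : m ≠ n), 𝒜 m := by
    rw [← iSup_split_single, hA]; trivial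
  obtain ⟨y, hy, z, hz, rfl⟩ := Submodule.mem_sup.1 hx'
  have h1 : f z ∈ ℬ n := by
    have := Submodule.sub_mem _ hx (hm n y hy)
    rwa [map_add, add_sub_cancel_left] at this
  have h2 : f z ∈ ⨆ (m) (_ : m ≠ n), ℬ m := by
    have : (⨆ (m) (_ : m ≠ n), 𝒜 m) ≤ (⨆ (m) (_ : m ≠ n), ℬ m).comap f :=
      iSup₂_le fun m hmn w hw => Submodule.mem_iSup_of_mem m
        (Submodule.mem_iSup_of_mem hmn (hm m w hw))
    exact this hz
  have h3 : f z = 0 := Submodule.disjoint_def.1 (hB n) _ h1 h2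
  rw [hf (h3.trans (map_zero f).symm), add_zero]
  exact hy

/-- Describes the gradings induced on images: homogeneity only has to be checked on a spanning
family, and the converse implication is automatic. -/
theorem mem_spanDegree_iff {C : ι → A} (hC : Submodule.span ℂ (Set.range C) = ⊤) {deg : ι → ℕ}
    {ℬ : ℕ → Submodule ℂ B} (hB : iSupIndep ℬ) {f : A →ₗ[ℂ] B} (hf : Function.Injective f)
    (hm : ∀ i, f (C i) ∈ ℬ (deg i)) (n : ℕ) (x : A) :
    x ∈ spanDegree C deg n ↔ f x ∈ ℬ n := by
  have hm' : ∀ n, ∀ x ∈ spanDegree C deg n, f x ∈ ℬ n := by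
    intro n
    change spanDegree C deg n ≤ (ℬ n).comap f
    refine Submodule.span_le.2 ?_
    rintro _ ⟨i, rfl, rfl⟩
    exact hm i
  exact ⟨hm' n x, mem_of_map_mem (iSup_spanDegree hC deg) hB hf hm'⟩

end GradedFamilies

/-! ### Hopf pairings -/

/-- A pairing of bialgebras for which product and coproduct are transposes of each other. -/
structure IsHopfPairing {K H : Type} [Ring K] [Bialgebra ℂ K] [Ring H] [Bialgebra ℂ H]
    (Φ : K →ₗ[ℂ] Module.Dual ℂ H) : Prop where
  map_one : Φ 1 = Coalgebra.counit
  map_mul : ∀ x y, Φ (x * y) =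
    LinearMap.mul' ℂ ℂ ∘ₗ TensorProduct.map (Φ x) (Φ y) ∘ₗ Coalgebra.comul
  map_counit : ∀ x, Φ x 1 = Coalgebra.counit (R := ℂ) x
  map_comul : ∀ x h k, Φ x (h * k) =
    LinearMap.mul' ℂ ℂ (TensorProduct.map (Φ.flip h) (Φ.flip k) (Coalgebra.comul (R := ℂ) x))

section HopfPairings

variable {K H : Type} [Ring K] [Bialgebra ℂ K] [Ring H] [Bialgebra ℂ H]

/-- The product rule for the transpose of the coproduct only has to be checked on generators. -/
theorem isHopfPairing_of_generators {Φ : K →ₗ[ℂ] Module.Dual ℂ H} {s : Set K}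
    (hs : Algebra.adjoin ℂ s = ⊤) (one : Φ 1 = Coalgebra.counit)
    (mul : ∀ x y, Φ (x * y) =
      LinearMap.mul' ℂ ℂ ∘ₗ TensorProduct.map (Φ x) (Φ y) ∘ₗ Coalgebra.comul)
    (counit : ∀ x ∈ s, Φ x 1 = Coalgebra.counit (R := ℂ) x)
    (comul : ∀ x ∈ s, ∀ h k, Φ x (h * k) = LinearMap.mul' ℂ ℂ
      (TensorProduct.map (Φ.flip h) (Φ.flip k) (Coalgebra.comul (R := ℂ) x))) :
    IsHopfPairing Φ where
  map_one := one
  map_mul := mul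
  map_counit x := by
    have hx : x ∈ Algebra.adjoin ℂ s := hs ▸ Algebra.mem_top
    induction hx using Algebra.adjoin_induction with
    | mem x hx => exact counit x hx
    | algebraMap r => simp [Algebra.algebraMap_eq_smul_one, one]
    | add x y _ _ hx hy => simp [hx, hy]
    | mul x y _ _ hx hy =>
      rw [mul, Bialgebra.counit_mul, ← hx, ← hy]
      simp [Algebra.TensorProduct.one_def]
  map_comul x := by
    have hx : x ∈ Algebra.adjoin ℂ s := hs ▸ Algebra.mem_top
    induction hx using Algebra.adjoin_induction with
    | mem x hx => exact comul x hx
    | algebraMap r =>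
      intro h k
      simp [Algebra.algebraMap_eq_smul_one, one, Algebra.TensorProduct.one_def]
    | add x y _ _ hx hy => intro h k; simp [hx, hy]
    | mul x y _ _ hx hy =>
      intro h k
      have mul' : ∀ x y h, Φ (x * y) h = LinearMap.mul' ℂ ℂ
          (TensorProduct.map (Φ x) (Φ y) (Coalgebra.comul h)) :=
        fun x y h => by rw [mul]; rfl
      rw [mul', Bialgebra.comul_mul, Bialgebra.comul_mul]
      let rx := Coalgebra.Repr.arbitrary ℂ x
      let ry := Coalgebra.Repr.arbitrary ℂ y
      let rh := Coalgebra.Repr.arbitrary ℂ h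
      let rk := Coalgebra.Repr.arbitrary ℂ k
      rw [← rh.eq, ← rk.eq, ← rx.eq, ← ry.eq]
      simp only [Finset.sum_mul_sum, map_sum, Algebra.TensorProduct.tmul_mul_tmul,
        TensorProduct.map_tmul, LinearMap.mul'_apply, LinearMap.flip_apply, hx, hy, mul',
        ← rh.eq, ← rk.eq, ← rx.eq, ← ry.eq]
      simp only [← Finset.sum_product']
      -- Both sides are the same fourfold sum over the components of the coproducts of x, y, h, k;
      -- only the order of summation differs.
      exact Finset.sum_nbij' (fun z => (z.2.2.1, z.2.2.2, z.1, z.2.1))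
        (fun z => (z.2.2.1, z.2.2.2, z.1, z.2.1)) (by simp; tauto) (by simp; tauto)
        (fun _ _ => rfl) (fun _ _ => rfl) (fun _ _ => by ring)

/-- Hopf pairings pull back along bialgebra morphisms. -/
theorem IsHopfPairing.comp {Φ : K →ₗ[ℂ] Module.Dual ℂ H} (hΦ : IsHopfPairing Φ) {K' H' : Type}
    [Ring K'] [Bialgebra ℂ K'] [Ring H'] [Bialgebra ℂ H'] (f : K' →ₐc[ℂ] K) (g : H' →ₐc[ℂ] H) :
    IsHopfPairing (Φ.compl₁₂ (f : K' →ₗ[ℂ] K) (g : H' →ₗ[ℂ] H)) where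
  map_one := by
    ext x
    simp [hΦ.map_one]
  map_mul x y := by
    have h : ∀ p, Coalgebra.comul (g p) =
        TensorProduct.map (g : H' →ₗ[ℂ] H) (g : H' →ₗ[ℂ] H) (Coalgebra.comul p) :=
      fun p => (CoalgHomClass.map_comp_comul_apply g p).symm
    ext p
    change Φ (f (x * y)) (g p) = _
    rw [_root_.map_mul, hΦ.map_mul, LinearMap.comp_apply, LinearMap.comp_apply, h,
      ← LinearMap.comp_apply (TensorProduct.map _ _), ← TensorProduct.map_comp]
    rfl
  map_counit x := by
    simp [hΦ.map_counit]
  map_comul x p q := by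
    have h : Coalgebra.comul (f x) =
        TensorProduct.map (f : K' →ₗ[ℂ] K) (f : K' →ₗ[ℂ] K) (Coalgebra.comul x) :=
      (CoalgHomClass.map_comp_comul_apply f x).symm
    change Φ (f x) (g (p * q)) = _
    rw [_root_.map_mul, hΦ.map_comul, h, ← LinearMap.comp_apply (TensorProduct.map _ _),
      ← TensorProduct.map_comp]
    rfl

/-- A Hopf pairing with homogeneous dual spanning families (up to non-zero scalars) identifies the
first factor with the graded dual of the second one. -/
theorem IsHopfPairing.exists_equiv_gradedDual {Φ : K →ₗ[ℂ] Module.Dual ℂ H}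
    (hΦ : IsHopfPairing Φ) {ι : Type} {C : ι → K} {B : ι → H} {deg : ι → ℕ}
    (hfin : ∀ n, {i | deg i = n}.Finite)
    (hC : Submodule.span ℂ (Set.range C) = ⊤) (hB : Submodule.span ℂ (Set.range B) = ⊤)
    (hne : ∀ i, Φ (C i) (B i) ≠ 0) (hzero : ∀ i j, i ≠ j → Φ (C i) (B j) = 0)
    {𝒦 : ℕ → Submodule ℂ K} (h𝒦 : ∀ n, 𝒦 n = spanDegree C deg n)
    {ℋ : ℕ → Submodule ℂ H} (hℋ : ∀ n, ℋ n = spanDegree B deg n) :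
    ∃ e : K ≃ₗ[ℂ] gradedDual ℋ, IsHopfIsoGradedDual 𝒦 ℋ e := by
  classical
  have hinj : Function.Injective Φ := by
    rw [injective_iff_map_eq_zero]
    intro x hx
    obtain ⟨a, rfl⟩ := (Finsupp.mem_span_range_iff_exists_finsupp (R := ℂ) (v := C) (x := x)).1
      (hC ▸ Submodule.mem_top)
    -- Pairing a combination of the `C i` with `B j` isolates the j-th coefficient, up to the
    -- non-zero factor `Φ (C j) (B j)`.
    have ha : a = 0 := by
      ext j
      have := LinearMap.congr_fun hx (B j)
      rw [Finsupp.sum, map_sum, LinearMap.sum_apply, Finset.sum_eq_single j] at this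
      · simpa [hne] using this
      · intro i _ hij; simp [hzero i j hij]
      · intro h; simp [Finsupp.notMem_support_iff.1 h]
    simp [ha]
  have hmem : ∀ n, ∀ x ∈ 𝒦 n, Φ x ∈ gradedDualPiece ℋ n := by
    intro n
    rw [h𝒦]
    change spanDegree C deg n ≤ (gradedDualPiece ℋ n).comap Φ
    refine Submodule.span_le.2 ?_
    rintro _ ⟨i, rfl, rfl⟩
    simp only [SetLike.mem_coe, Submodule.mem_comap, gradedDualPiece, Submodule.mem_iInf,
      Submodule.mem_dualAnnihilator]
    intro m hm w hw
    rw [hℋ] at hw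
    have : spanDegree B deg m ≤ LinearMap.ker (Φ (C i)) := by
      refine Submodule.span_le.2 ?_
      rintro _ ⟨j, rfl, rfl⟩
      exact hzero i j (by rintro rfl; exact hm rfl)
    exact this hw
  have hsurj : ∀ n, ∀ φ ∈ gradedDualPiece ℋ n, ∃ x ∈ 𝒦 n, Φ x = φ := by
    intro n φ hφ
    -- Expansion of φ in the dual family; finiteness in each degree makes the sum available, and
    -- outside degree n both sides vanish on `B`.
    refine ⟨∑ i ∈ (hfin n).toFinset, (φ (B i) / Φ (C i) (B i)) • C i, ?_, ?_⟩
    · rw [h𝒦]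
      refine Submodule.sum_mem _ fun i hi => Submodule.smul_mem _ _ ?_
      rw [Set.Finite.mem_toFinset] at hi
      exact (hi : deg i = n) ▸ mem_spanDegree C deg i
    · refine LinearMap.ext_on_range hB fun j => ?_
      simp only [map_sum, map_smul, LinearMap.sum_apply, LinearMap.smul_apply, smul_eq_mul]
      by_cases hj : deg j = n
      · rw [Finset.sum_eq_single j]
        · field_simp [hne j]
        · intro i _ hij; simp [hzero i j hij]
        · intro h; exact absurd ((hfin n).mem_toFinset.2 hj) h
      · rw [Finset.sum_eq_zero]
        · simp only [gradedDualPiece, Submodule.mem_iInf, Submodule.mem_dualAnnihilator] at hφ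
          exact (hφ (deg j) hj (B j) (hℋ _ ▸ mem_spanDegree B deg j)).symm
        · intro i hi
          rw [hzero i j, mul_zero]
          rintro rfl
          exact hj ((hfin n).mem_toFinset.1 hi)
  have hrange : LinearMap.range Φ = gradedDual ℋ := by
    apply le_antisymm
    · rw [LinearMap.range_eq_map, ← hC, Submodule.map_span, Submodule.span_le]
      rintro _ ⟨_, ⟨i, rfl⟩, rfl⟩
      exact Submodule.mem_iSup_of_mem (deg i) (hmem _ _ (h𝒦 _ ▸ mem_spanDegree C deg i))
    · refine iSup_le fun n φ hφ => ?_
      obtain ⟨x, _, rfl⟩ := hsurj n φ hφ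
      exact ⟨x, rfl⟩
  refine ⟨(LinearEquiv.ofInjective Φ hinj).trans (LinearEquiv.ofEq _ _ hrange), ?_, ?_, ?_, ?_, ?_⟩
  · refine fun n x => ⟨hmem n x, fun h => ?_⟩
    obtain ⟨y, hy, hxy⟩ := hsurj n _ h
    exact hinj hxy ▸ hy
  · exact hΦ.map_one
  · exact hΦ.map_mul
  · exact hΦ.map_counit
  · exact hΦ.map_comul

end HopfPairings

/-! ### Bialgebra morphisms from linear maps -/

/-- A linear map compatible with all structure maps, as a bialgebra morphism. -/
def bialgHomOfLinearMap {H K : Type} [Ring H] [Bialgebra ℂ H] [Ring K] [Bialgebra ℂ K]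
    (F : H →ₗ[ℂ] K) (one : F 1 = 1) (mul : ∀ x y, F (x * y) = F x * F y)
    (counit : ∀ x, Coalgebra.counit (R := ℂ) (F x) = Coalgebra.counit (R := ℂ) x)
    (comul : ∀ x, Coalgebra.comul (R := ℂ) (F x) =
      TensorProduct.map F F (Coalgebra.comul (R := ℂ) x)) : H →ₐc[ℂ] K :=
  BialgHom.ofAlgHom (AlgHom.ofLinearMap F one mul) (AlgHom.ext counit)
    (AlgHom.ext fun x => (comul x).symm)

theorem BialgHom.comul_apply {H K : Type} [Ring H] [Bialgebra ℂ H] [Ring K] [Bialgebra ℂ K]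
    (f : H →ₐc[ℂ] K) (x : H) : Coalgebra.comul (R := ℂ) (f x) =
      TensorProduct.map (f : H →ₗ[ℂ] K) (f : H →ₗ[ℂ] K) (Coalgebra.comul (R := ℂ) x) :=
  (CoalgHomClass.map_comp_comul_apply f x).symm

theorem BialgHom.counit_apply {H K : Type} [Ring H] [Bialgebra ℂ H] [Ring K] [Bialgebra ℂ K]
    (f : H →ₐc[ℂ] K) (x : H) :
    Coalgebra.counit (R := ℂ) (f x) = Coalgebra.counit (R := ℂ) x :=
  CoalgHomClass.counit_comp_apply f x

/-! ### Word algebras: gradings, coefficients and coalgebra morphisms -/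

namespace QSh

variable {A B : Type} {L : LetterProduct A}

theorem span_word : Submodule.span ℂ (Set.range (word L)) = ⊤ := (basis L).span_eq

theorem iSup_grading (deg : A → ℕ) : ⨆ n, grading L deg n = ⊤ :=
  iSup_spanDegree span_word _

theorem iSupIndep_grading (deg : A → ℕ) : iSupIndep (grading L deg) :=
  iSupIndep_spanDegree (basis L) _

theorem word_mem_grading (deg : A → ℕ) (w : List A) :
    word L w ∈ grading L deg (w.map deg).sum :=
  mem_spanDegree (word L) (fun w => (w.map deg).sum) w

theorem cons_mem_grading {deg : A → ℕ} (x : A) {n : ℕ} {f : QSh L} (hf : f ∈ grading L deg n) :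
    cons x f ∈ grading L deg (deg x + n) := by
  have h : grading L deg n ≤ (grading L deg (deg x + n)).comap (cons x) := by
    refine Submodule.span_le.2 ?_
    rintro _ ⟨w, rfl, rfl⟩
    rw [SetLike.mem_coe, Submodule.mem_comap, cons_word]
    exact word_mem_grading (L := L) deg (x :: w)
  exact h hf

theorem word_mul_word_mem_grading {deg : A → ℕ}
    (hdeg : ∀ a b c, L.op a b = some c → deg c = deg a + deg b) (u v : List A) :
    word L u * word L v ∈ grading L deg ((u.map deg).sum + (v.map deg).sum) := by
  induction u generalizing v with
  | nil => rw [← one_def, one_mul]; simpa using word_mem_grading (L := L) deg v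
  | cons x u ihu =>
    induction v with
    | nil => rw [← one_def, mul_one]; simpa using word_mem_grading (L := L) deg (x :: u)
    | cons y v ihv =>
      rw [word_cons_mul_word_cons]
      refine add_mem (add_mem ?_ ?_) ?_
      · have := cons_mem_grading x (ihu (y :: v))
        simpa [add_assoc] using this
      · have := cons_mem_grading y ihv
        simpa [add_left_comm] using this
      · cases h : L.op x y with
        | none => simp [consOpt]
        | some z =>
          have := cons_mem_grading z (ihu v)
          rw [hdeg x y z h] at this
          simpa [consOpt, add_assoc, add_left_comm] using this

/-- Concatenation is dual to deconcatenation. -/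
theorem coeff_append (u v : List A) (f : QSh L) : coeff (u ++ v) f =
    LinearMap.mul' ℂ ℂ (TensorProduct.map (coeff u) (coeff v) (Coalgebra.comul (R := ℂ) f)) := by
  classical
  induction f using QSh.induction with
  | hw w =>
    simp only [comul_def, comulLin_word, map_sum, TensorProduct.map_tmul, LinearMap.mul'_apply,
      coeff_word]
    by_cases h : u ++ v = w
    · subst h
      rw [Finset.sum_eq_single u.length]
      · simp
      · intro i hi hne
        rw [if_neg, zero_mul]
        intro h
        have := congrArg List.length h
        simp at this hi
        omega
      · simp
    · rw [if_neg h, Finset.sum_eq_zero]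
      intro i _
      by_cases h1 : u = w.take i
      · by_cases h2 : v = w.drop i
        · exact absurd (by rw [h1, h2, List.take_append_drop]) h
        · simp [h2]
      · simp [h1]
  | hadd f g hf hg => simp only [map_add, hf, hg]
  | hsmul c f hf => simp only [map_smul, hf]

/-- A morphism of coalgebras into `QSh L` is determined by the coefficients of the letters. -/
theorem coalgHom_ext {C : Type} [AddCommGroup C] [Module ℂ C] [Coalgebra ℂ C]
    {F G : C →ₗc[ℂ] QSh L} (h : ∀ (a : A) (c : C), coeff [a] (F c) = coeff [a] (G c)) : F = G := by
  have key : ∀ w : List A, ∀ c : C, coeff w (F c) = coeff w (G c) := by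
    intro w
    induction w with
    | nil =>
      intro c
      -- The coefficient of the empty word is the counit.
      exact (CoalgHomClass.counit_comp_apply F c).trans (CoalgHomClass.counit_comp_apply G c).symm
    | cons a w ih =>
      intro c
      have e1 : coeff [a] ∘ₗ (F : C →ₗ[ℂ] QSh L) = coeff [a] ∘ₗ (G : C →ₗ[ℂ] QSh L) :=
        LinearMap.ext (h a)
      have e2 : coeff w ∘ₗ (F : C →ₗ[ℂ] QSh L) = coeff w ∘ₗ (G : C →ₗ[ℂ] QSh L) :=
        LinearMap.ext ih
      -- The coefficient of `a :: w` is the coefficient of [a] ⊗ w in the coproduct, which a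
      -- coalgebra morphism pulls back to the coproduct of c.
      rw [← List.singleton_append, coeff_append, coeff_append,
        ← CoalgHomClass.map_comp_comul_apply F c, ← CoalgHomClass.map_comp_comul_apply G c,
        ← LinearMap.comp_apply (TensorProduct.map _ _), ← LinearMap.comp_apply
        (TensorProduct.map _ _), ← TensorProduct.map_comp, ← TensorProduct.map_comp]
      exact congrArg (fun l => LinearMap.mul' ℂ ℂ (l (Coalgebra.comul c)))
        (congrArg₂ TensorProduct.map e1 e2)
  exact CoalgHom.ext fun c => (basis L).ext_elem fun w => key w c

/-! ### Morphisms of shuffle algebras induced by maps of letters -/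

theorem cons_shuffle_cons (x y : A) (f g : QSh (LetterProduct.zero A)) :
    cons x f * cons y g = cons x (f * cons y g) + cons y (cons x f * g) :=
  (cons_mul_cons x y f g).trans (add_zero _)

/-- The linear map that replaces each letter `x` by `t x • g x`. -/
def letterMapLin (t : A → ℂ) (g : A → B) :
    QSh (LetterProduct.zero A) →ₗ[ℂ] QSh (LetterProduct.zero B) :=
  (basis _).constr ℂ fun w => (w.map t).prod • word _ (w.map g)

theorem letterMapLin_word (t : A → ℂ) (g : A → B) (w : List A) :
    letterMapLin t g (word _ w) = (w.map t).prod • word _ (w.map g) := by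
  simp [letterMapLin, word, Module.Basis.constr_basis]

theorem letterMapLin_cons (t : A → ℂ) (g : A → B) (x : A) (f : QSh (LetterProduct.zero A)) :
    letterMapLin t g (cons x f) = t x • cons (g x) (letterMapLin t g f) := by
  induction f using QSh.induction with
  | hw w => simp [cons_word, letterMapLin_word, mul_smul]
  | hadd f g hf hg => simp only [map_add, hf, hg, smul_add]
  | hsmul c f hf => simp only [map_smul, hf, smul_comm c]

theorem letterMapLin_one (t : A → ℂ) (g : A → B) : letterMapLin t g 1 = 1 := by
  simp [one_def, letterMapLin_word]

theorem letterMapLin_word_mul_word (t : A → ℂ) (g : A → B) (u v : List A) :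
    letterMapLin t g (word _ u * word _ v) =
      letterMapLin t g (word _ u) * letterMapLin t g (word _ v) := by
  induction u generalizing v with
  | nil => rw [← one_def, one_mul, letterMapLin_one, one_mul]
  | cons x u ihu =>
    induction v with
    | nil => rw [← one_def, mul_one, letterMapLin_one, mul_one]
    | cons y v ihv =>
      have hu := ihu (y :: v)
      simp only [← cons_word] at *
      rw [cons_shuffle_cons, map_add, letterMapLin_cons, letterMapLin_cons, hu, ihv]
      simp only [letterMapLin_cons, cons_shuffle_cons, smul_mul_assoc,
        mul_smul_comm, map_smul, smul_smul, smul_add, mul_comm (t y)]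

theorem comul_cons (x : A) (f : QSh L) : Coalgebra.comul (R := ℂ) (cons x f) =
    1 ⊗ₜ[ℂ] cons x f + TensorProduct.map (cons x) LinearMap.id (Coalgebra.comul (R := ℂ) f) :=
  comulLin_cons x f

theorem comul_letterMapLin_word (t : A → ℂ) (g : A → B) (w : List A) :
    Coalgebra.comul (R := ℂ) (letterMapLin t g (word _ w)) =
      TensorProduct.map (letterMapLin t g) (letterMapLin t g)
        (Coalgebra.comul (R := ℂ) (word (LetterProduct.zero A) w)) := by
  induction w with
  | nil =>
    rw [← one_def, letterMapLin_one, Bialgebra.comul_one, Bialgebra.comul_one]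
    simp [Algebra.TensorProduct.one_def, letterMapLin_one]
  | cons x w ih =>
    rw [← cons_word, letterMapLin_cons, map_smul, comul_cons, comul_cons, ih, map_add,
      TensorProduct.map_tmul, letterMapLin_one, letterMapLin_cons, smul_add, tmul_smul]
    congr 1
    generalize Coalgebra.comul (R := ℂ) (word (LetterProduct.zero A) w) = s
    induction s using TensorProduct.induction_on with
    | zero => simp
    | add a b ha hb =>
      simp only [map_add, smul_add, ha, hb]
    | tmul a b => simp [letterMapLin_cons, smul_tmul']

/-- The bialgebra morphism of shuffle algebras that replaces each letter `x` by `t x • g x`. -/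
def letterMap (t : A → ℂ) (g : A → B) :
    QSh (LetterProduct.zero A) →ₐc[ℂ] QSh (LetterProduct.zero B) :=
  bialgHomOfLinearMap (letterMapLin t g) (letterMapLin_one t g)
    (fun f f' => by
      induction f using QSh.induction with
      | hw u =>
        induction f' using QSh.induction with
        | hw v => exact letterMapLin_word_mul_word t g u v
        | hadd f g hf hg => simp only [mul_add, map_add, hf, hg]
        | hsmul c f hf => simp only [mul_smul_comm, map_smul, hf]
      | hadd f g hf hg => simp only [add_mul, map_add, hf, hg]
      | hsmul c f hf => simp only [smul_mul_assoc, map_smul, hf])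
    (fun f => by
      classical
      rw [counit_def, counit_def]
      induction f using QSh.induction with
      | hw u => cases u <;> simp [letterMapLin_word, coeff_word]
      | hadd f g hf hg => simp only [map_add, hf, hg]
      | hsmul c f hf => simp only [map_smul, hf])
    (fun f => by
      induction f using QSh.induction with
      | hw u => exact comul_letterMapLin_word t g u
      | hadd f g hf hg => simp only [map_add, hf, hg]
      | hsmul c f hf => simp only [map_smul, hf])

theorem letterMap_word (t : A → ℂ) (g : A → B) (w : List A) :
    letterMap t g (word _ w) = (w.map t).prod • word _ (w.map g) :=
  letterMapLin_word t g w

/-! ### Exponential characters of shuffle algebras -/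

/-- The linear form that sends every word of length `n` to `1 / n!`. -/
def expLin : QSh (LetterProduct.zero A) →ₗ[ℂ] ℂ :=
  (basis _).constr ℂ fun w => 1 / (w.length.factorial : ℂ)

theorem expLin_word (w : List A) :
    expLin (word (LetterProduct.zero A) w) = 1 / (w.length.factorial : ℂ) := by
  simp [expLin, word, Module.Basis.constr_basis]

/-- The grading with all letters in degree 1 records word length, so prepending a letter replaces
1/n! by 1/(n+1)! uniformly on homogeneous elements. -/
theorem expLin_cons (x : A) {n : ℕ} {f : QSh (LetterProduct.zero A)}
    (hf : f ∈ grading (LetterProduct.zero A) (fun _ => 1) n) :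
    expLin (cons x f) = expLin f / (n + 1) := by
  induction hf using Submodule.span_induction with
  | mem f hf =>
    obtain ⟨w, h, rfl⟩ := hf
    have : w.length = n := by simpa using h
    rw [cons_word, expLin_word, expLin_word, List.length_cons, this, Nat.factorial_succ]
    push_cast
    field_simp
  | add f g _ _ hf hg => simp only [map_add, hf, hg, add_div]
  | smul c f _ hf => simp only [map_smul, hf, smul_eq_mul, mul_div_assoc]
  | zero => simp

/-- For words of lengths p, q ≥ 1 the shuffle recursion and induction give (1/((p-1)! q!) + 1/(p!
(q-1)!)) / (p+q), which equals 1/(p! q!). -/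
theorem expLin_word_mul_word (u v : List A) :
    expLin (word (LetterProduct.zero A) u * word _ v) =
      expLin (word (LetterProduct.zero A) u) * expLin (word (LetterProduct.zero A) v) := by
  have hmem : ∀ u v : List A, word (LetterProduct.zero A) u * word _ v ∈
      grading (LetterProduct.zero A) (fun _ => 1) (u.length + v.length) := fun u v => by
    simpa using word_mul_word_mem_grading (L := LetterProduct.zero A) (deg := fun _ => 1)
      (by simp [LetterProduct.zero]) u v
  induction u generalizing v with
  | nil => rw [← one_def, one_mul, one_def, expLin_word []]; simp
  | cons x u ihu =>
    induction v with
    | nil => rw [← one_def, mul_one, one_def, expLin_word []]; simp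
    | cons y v ihv =>
      rw [← cons_word x u, ← cons_word y v, cons_shuffle_cons, cons_word, cons_word, map_add,
        expLin_cons x (hmem u (y :: v)), expLin_cons y (hmem (x :: u) v), ihu, ihv]
      simp only [expLin_word, List.length_cons, Nat.factorial_succ]
      push_cast
      have h1 : (u.length.factorial : ℂ) ≠ 0 := mod_cast u.length.factorial_ne_zero
      have h2 : (v.length.factorial : ℂ) ≠ 0 := mod_cast v.length.factorial_ne_zero
      have h3 : (u.length : ℂ) + 1 ≠ 0 := mod_cast u.length.succ_ne_zero
      have h4 : (v.length : ℂ) + 1 ≠ 0 := mod_cast v.length.succ_ne_zero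
      have h5 : (u.length : ℂ) + (v.length + 1) + 1 ≠ 0 :=
        mod_cast (u.length + (v.length + 1)).succ_ne_zero
      have h6 : (u.length : ℂ) + 1 + v.length + 1 ≠ 0 :=
        mod_cast (u.length + 1 + v.length).succ_ne_zero
      field_simp
      ring

/-- The character that sends a word of length `n` to `t(x₁) ⋯ t(xₙ) / n!`. -/
def expChar (t : A → ℂ) : QSh (LetterProduct.zero A) →ₐ[ℂ] ℂ :=
  (AlgHom.ofLinearMap expLin (by simp [one_def, expLin_word]) (fun f f' => by
      induction f using QSh.induction with
      | hw u =>
        induction f' using QSh.induction with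
        | hw v => exact expLin_word_mul_word u v
        | hadd f g hf hg => simp only [mul_add, map_add, hf, hg]
        | hsmul c f hf => simp only [mul_smul_comm, map_smul, hf]
      | hadd f g hf hg => simp only [add_mul, map_add, hf, hg]
      | hsmul c f hf => simp only [smul_mul_assoc, map_smul, hf])).comp
    ((letterMap t id : QSh (LetterProduct.zero A) →ₐc[ℂ] QSh (LetterProduct.zero A)) :
      QSh (LetterProduct.zero A) →ₐ[ℂ] QSh (LetterProduct.zero A))

theorem expChar_word (t : A → ℂ) (w : List A) :
    expChar t (word _ w) = (w.map t).prod / (w.length.factorial : ℂ) := by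
  change expLin (letterMap t id (word _ w)) = _
  rw [letterMap_word, map_smul, expLin_word]
  simp [div_eq_mul_inv]

theorem convMul_word (f g : Character (QSh L)) (w : List A) : (f * g) (word L w) =
    ∑ i ∈ Finset.range (w.length + 1), f (word L (w.take i)) * g (word L (w.drop i)) := by
  rw [AlgHom.convMul_apply, comul_def, comulLin_word, map_sum]
  rfl

theorem character_ext {f g : Character (QSh L)} (h : ∀ w, f (word L w) = g (word L w)) :
    f = g := by
  have : f.ofConv.toLinearMap = g.ofConv.toLinearMap := lin_ext h
  exact WithConv.ofConv_injective (AlgHom.toLinearMap_injective this)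

/-- The binomial theorem: cutting a word of length n after i letters contributes c^i d^(n-i) / (i!
(n-i)!) times a product of values of `o` that does not depend on the cut. -/
theorem expChar_mul (o : A → ℂ) (c d : ℂ) :
    (WithConv.toConv (expChar fun a => c * o a) * WithConv.toConv (expChar fun a => d * o a) :
      Character (QSh (LetterProduct.zero A))) =
      WithConv.toConv (expChar fun a => (c + d) * o a) := by
  refine character_ext fun w => ?_
  rw [convMul_word]
  simp only [expChar_word, List.prod_map_mul, List.map_const', List.prod_replicate]
  rw [add_pow, Finset.sum_mul, Finset.sum_div]
  refine Finset.sum_congr rfl fun i hi => ?_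
  have hi' : i ≤ w.length := by simpa [Nat.lt_succ_iff] using hi
  have hw : (w.map o).prod = ((w.take i).map o).prod * ((w.drop i).map o).prod := by
    rw [← List.prod_append, ← List.map_append, List.take_append_drop]
  rw [hw, Nat.choose_eq_factorial_div_factorial hi',
    Nat.cast_div (Nat.factorial_mul_factorial_dvd_factorial hi')
      (mod_cast mul_ne_zero i.factorial_ne_zero (w.length - i).factorial_ne_zero)]
  simp only [List.length_take, List.length_drop, min_eq_left hi', Nat.cast_mul]
  have h1 : (i.factorial : ℂ) ≠ 0 := mod_cast i.factorial_ne_zero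
  have h2 : ((w.length - i).factorial : ℂ) ≠ 0 := mod_cast (w.length - i).factorial_ne_zero
  have h3 : (w.length.factorial : ℂ) ≠ 0 := mod_cast w.length.factorial_ne_zero
  field_simp

theorem expChar_zero :
    (WithConv.toConv (expChar fun _ => 0) : Character (QSh (LetterProduct.zero A))) = 1 := by
  classical
  refine character_ext fun w => ?_
  rw [AlgHom.convOne_apply, counit_def, WithConv.ofConv_toConv, expChar_word]
  cases w <;> simp [coeff_word]

end QSh

/-! ### Homogeneous products and unitriangular maps -/

namespace QSh

variable {A : Type} {L L' : LetterProduct A}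

theorem mul_mem_grading {deg : A → ℕ}
    (hdeg : ∀ a b c, L.op a b = some c → deg c = deg a + deg b) {m n : ℕ} {f g : QSh L}
    (hf : f ∈ grading L deg m) (hg : g ∈ grading L deg n) : f * g ∈ grading L deg (m + n) := by
  induction hf using Submodule.span_induction with
  | mem f hf =>
    obtain ⟨u, rfl, rfl⟩ := hf
    induction hg using Submodule.span_induction with
    | mem g hg => obtain ⟨v, rfl, rfl⟩ := hg; exact word_mul_word_mem_grading hdeg u v
    | zero => rw [mul_zero]; exact zero_mem _
    | add f g _ _ hf hg => rw [mul_add]; exact add_mem hf hg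
    | smul c f _ hf => rw [mul_smul_comm]; exact Submodule.smul_mem _ _ hf
  | zero => rw [zero_mul]; exact zero_mem _
  | add f g _ _ hf hg => rw [add_mul]; exact add_mem hf hg
  | smul c f _ hf => rw [smul_mul_assoc]; exact Submodule.smul_mem _ _ hf

theorem map_mem_grading {B : Type} {K : LetterProduct B} {deg : A → ℕ} {deg' : B → ℕ}
    {F : QSh L →ₗ[ℂ] QSh K}
    (hF : ∀ w : List A, F (word L w) ∈ grading K deg' (w.map deg).sum) {n : ℕ} {f : QSh L}
    (hf : f ∈ grading L deg n) : F f ∈ grading K deg' n := by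
  have h : grading L deg n ≤ (grading K deg' n).comap F := by
    refine Submodule.span_le.2 ?_
    rintro _ ⟨w, rfl, rfl⟩
    exact hF w
  exact h hf

theorem eq_sum_coeff (f : QSh L) :
    f = ∑ w ∈ ((basis L).repr f).support, coeff w f • word L w :=
  ((basis L).linearCombination_repr f).symm

/-- A linear map that is unitriangular with respect to the length of words is bijective. -/
theorem bijective_of_unitriangular [DecidableEq A] {F : QSh L →ₗ[ℂ] QSh L'}
    (hF : ∀ u w : List A, u.length ≤ w.length →
      coeff w (F (word L u)) = if w = u then 1 else 0) : Function.Bijective F := by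
  constructor
  · rw [injective_iff_map_eq_zero]
    intro f hf
    by_contra hne
    have hs : ((basis L).repr f).support.Nonempty := by
      rw [Finsupp.support_nonempty_iff]
      simpa using hne
    -- At a longest word of the support no other term of f contributes, so its coefficient survives
    -- in `F f`.
    obtain ⟨w, hw, hmax⟩ := Finset.exists_max_image _ List.length hs
    have h : coeff w (F f) = coeff w f := by
      conv_lhs => rw [eq_sum_coeff f]
      rw [map_sum, map_sum, Finset.sum_eq_single w]
      · rw [map_smul, map_smul, hF w w le_rfl, if_pos rfl, smul_eq_mul, mul_one]
      · intro u hu hne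
        rw [map_smul, map_smul, hF u w (hmax u hu), if_neg hne.symm, smul_zero]
      · intro h; exact absurd hw h
    rw [hf, map_zero] at h
    exact Finsupp.mem_support_iff.1 hw h.symm
  · rw [← LinearMap.range_eq_top, eq_top_iff, ← span_word, Submodule.span_le]
    rintro _ ⟨w, rfl⟩
    -- The image of a word is that word plus strictly shorter ones, which are already in the range
    -- by induction.
    induction h : w.length using Nat.strong_induction_on generalizing w with
    | _ n ih =>
      have h1 : F (word L w) ∈ LinearMap.range F := ⟨_, rfl⟩
      have hww := hF w w le_rfl
      rw [if_pos rfl] at hww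
      have hmem : w ∈ ((basis L').repr (F (word L w))).support :=
        Finsupp.mem_support_iff.2 (by change coeff w (F (word L w)) ≠ 0; simp [hww])
      have h2 := eq_sum_coeff (F (word L w))
      rw [← Finset.add_sum_erase _ _ hmem, hww, one_smul] at h2
      have h3 : word L' w = F (word L w) - ∑ u ∈ ((basis L').repr (F (word L w))).support.erase w,
          coeff u (F (word L w)) • word L' u := eq_sub_of_add_eq h2.symm
      rw [h3]
      refine sub_mem h1 (Submodule.sum_mem _ fun u hu => ?_)
      by_cases hl : w.length ≤ u.length
      · rw [hF w u hl, if_neg (Finset.ne_of_mem_erase hu), zero_smul]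
        exact zero_mem _
      · exact Submodule.smul_mem _ _ (ih u.length (by omega) u rfl)

end QSh

/-! ### The shuffle basis of `QSym` -/

/-- The shuffle algebra on the positive integers. -/
abbrev ShufflePos : Type := QSh (LetterProduct.zero ℕ+)

namespace ShufflePos

/-- The indicator function of the odd integers. -/
def oddInd (a : ℕ+) : ℂ := if Odd (a : ℕ) then 1 else 0

/-- The indicator function of the even integers. -/
def evenInd (a : ℕ+) : ℂ := if Even (a : ℕ) then 1 else 0

/-- The character of the shuffle algebra that corresponds to the canonical character of `QSym`. -/
def shuffleChar : Character ShufflePos :=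
  WithConv.toConv (QSh.expChar evenInd) * WithConv.toConv (QSh.expChar oddInd)

theorem prod_map_oddInd (w : List ℕ+) :
    (w.map oddInd).prod = if ∀ a ∈ w, Odd (a : ℕ) then 1 else 0 := by
  induction w with
  | nil => simp
  | cons a w ih =>
    simp only [List.map_cons, List.prod_cons, ih, oddInd, List.forall_mem_cons]
    grind

theorem prod_map_evenInd (w : List ℕ+) :
    (w.map evenInd).prod = if ∀ a ∈ w, Even (a : ℕ) then 1 else 0 := by
  induction w with
  | nil => simp
  | cons a w ih =>
    simp only [List.map_cons, List.prod_cons, ih, evenInd, List.forall_mem_cons]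
    grind

/-- Forbidding an odd part right before an even one forces all even parts to the front. Admissible
blocks are thus an even prefix followed by an odd suffix, the shape seen by a convolution product of
an even and an odd character. -/
theorem noOtE_iff (w : List ℕ+) : QSym.NoOtE w ↔
    ∃ i ≤ w.length, (∀ a ∈ w.take i, Even (a : ℕ)) ∧ ∀ a ∈ w.drop i, Odd (a : ℕ) := by
  induction w with
  | nil => simp [QSym.NoOtE]
  | cons a w ih =>
    constructor
    · intro h
      obtain ⟨i, hi, h1, h2⟩ := ih.1 h.tail
      by_cases ha : Even (a : ℕ)
      · exact ⟨i + 1, by simpa using hi, by simpa [ha] using h1, by simpa using h2⟩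
      · have ha' : Odd (a : ℕ) := Nat.not_even_iff_odd.1 ha
        refine ⟨0, by simp, by simp, ?_⟩
        cases i with
        | zero => simpa [ha'] using h2
        | succ i =>
          cases w with
          | nil => simpa using ha'
          | cons b w =>
            exact absurd ⟨ha', h1 b (by simp)⟩ (List.isChain_cons_cons.1 h).1
    · rintro ⟨i, hi, h1, h2⟩
      cases i with
      | zero =>
        have hw : ∀ b ∈ w, Odd (b : ℕ) := fun b hb => h2 b (by simp [hb])
        have ht : QSym.NoOtE w := ih.2 ⟨0, by simp, by simp, hw⟩
        cases w with
        | nil => simp [QSym.NoOtE]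
        | cons b w =>
          exact List.isChain_cons_cons.2
            ⟨fun h => (Nat.not_even_iff_odd.2 (hw b (by simp))) h.2, ht⟩
      | succ i =>
        have ht : QSym.NoOtE w := ih.2
          ⟨i, by simpa using hi, fun b hb => h1 b (by simp [hb]), by simpa using h2⟩
        have ha : Even (a : ℕ) := h1 a (by simp)
        cases w with
        | nil => simp [QSym.NoOtE]
        | cons b w => exact List.isChain_cons_cons.2 ⟨fun h => (Nat.not_even_iff_odd.2 h.1) ha, ht⟩

open Classical in
-- At most one cut of the word has an even prefix and an odd suffix, and its term is 1/(e! o!). This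
-- is why the coefficients of the shuffle functions come from a character.
theorem shuffleChar_word (w : List ℕ+) : shuffleChar (QSh.word _ w) =
    if QSym.NoOtE w then QSym.blockCoeff w else 0 := by
  rw [shuffleChar, QSh.convMul_word]
  simp only [QSh.expChar_word, prod_map_evenInd, prod_map_oddInd]
  -- Counting even letters recovers the position of a contributing cut, whence its uniqueness, and
  -- also the two factorials.
  have key : ∀ i ≤ w.length, (∀ a ∈ w.take i, Even (a : ℕ)) → (∀ a ∈ w.drop i, Odd (a : ℕ)) →
      w.countP (fun a : ℕ+ => Even (a : ℕ)) = i ∧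
      w.countP (fun a : ℕ+ => Odd (a : ℕ)) = w.length - i := by
    intro i hi h1 h2
    have e : w = w.take i ++ w.drop i := (List.take_append_drop i w).symm
    have a1 : (w.take i).countP (fun a : ℕ+ => Even (a : ℕ)) = (w.take i).length :=
      List.countP_eq_length.2 (by simpa using h1)
    have a2 : (w.drop i).countP (fun a : ℕ+ => Even (a : ℕ)) = 0 :=
      List.countP_eq_zero.2 (by simpa using h2)
    have a3 : (w.take i).countP (fun a : ℕ+ => Odd (a : ℕ)) = 0 :=
      List.countP_eq_zero.2 (by simpa using h1)
    have a4 : (w.drop i).countP (fun a : ℕ+ => Odd (a : ℕ)) = (w.drop i).length :=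
      List.countP_eq_length.2 (by simpa using h2)
    constructor
    · conv_lhs => rw [e]
      rw [List.countP_append, a1, a2]; simp [hi]
    · conv_lhs => rw [e]
      rw [List.countP_append, a3, a4]; simp
  by_cases h : QSym.NoOtE w
  · rw [if_pos h]
    obtain ⟨i, hi, h1, h2⟩ := (noOtE_iff w).1 h
    rw [Finset.sum_eq_single i]
    · rw [if_pos h1, if_pos h2, QSym.blockCoeff, (key i hi h1 h2).1, (key i hi h1 h2).2]
      simp only [List.length_take, List.length_drop, min_eq_left hi]
      rw [div_mul_div_comm, one_mul, mul_comm]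
    · intro j hj hne
      have hj' : j ≤ w.length := by simpa [Nat.lt_succ_iff] using hj
      by_cases g1 : ∀ a ∈ w.take j, Even (a : ℕ)
      · by_cases g2 : ∀ a ∈ w.drop j, Odd (a : ℕ)
        · exact absurd ((key j hj' g1 g2).1.symm.trans (key i hi h1 h2).1) hne
        · rw [if_neg g2]; simp
      · rw [if_neg g1]; simp
    · intro h; exact absurd (by simpa [Nat.lt_succ_iff] using hi) h
  · rw [if_neg h]
    refine Finset.sum_eq_zero fun j hj => ?_
    have hj' : j ≤ w.length := by simpa [Nat.lt_succ_iff] using hj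
    by_cases g1 : ∀ a ∈ w.take j, Even (a : ℕ)
    · by_cases g2 : ∀ a ∈ w.drop j, Odd (a : ℕ)
      · exact absurd ((noOtE_iff w).2 ⟨j, hj', g1, g2⟩) h
      · rw [if_neg g2]; simp
    · rw [if_neg g1]; simp

end ShufflePos

namespace QSym

/-- Groups the blockings by their first block, whereas `blockings` itself is defined one letter at a
time. -/
theorem sum_blockings_cons {N : Type} [AddCommMonoid N] (G : List (List ℕ+) → N) (a : ℕ+)
    (α : List ℕ+) : ((blockings (a :: α)).map G).sum = ∑ i ∈ Finset.range (α.length + 1),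
      ((blockings (α.drop i)).map fun B => G ((a :: α.take i) :: B)).sum := by
  induction α generalizing a G with
  | nil => simp [blockings]
  | cons b α ih =>
    have hne : ∀ α : List ℕ+, ∀ b, [] ∉ blockings (b :: α) := by
      intro α b h
      rw [blockings, List.mem_flatMap] at h
      obtain ⟨B, _, hB⟩ := h
      cases B <;> simp at hB
    have h1 : ((blockings (a :: b :: α)).map G).sum =
        ((blockings (b :: α)).map fun B => G ([a] :: B)).sum +
        -- The value at `[]` is a dummy: a nonempty composition has no empty blocking. This second
        -- sum, where `a` joins the first block, is handled by applying the induction hypothesis to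
        -- the modified function.
        ((blockings (b :: α)).map fun B => match B with
          | [] => 0
          | c :: B' => G ((a :: c) :: B')).sum := by
      rw [blockings]
      generalize hl : blockings (b :: α) = l
      have hl' : [] ∉ l := hl ▸ hne α b
      clear hl
      induction l with
      | nil => simp
      | cons B l ihl =>
        have := ihl (fun h => hl' (List.mem_cons_of_mem _ h))
        simp only [List.flatMap_cons, List.map_append, List.sum_append, List.map_cons,
          List.sum_cons, this]
        cases B with
        | nil => simp at hl'
        | cons c B =>
          simp only [List.map_cons, List.map_nil, List.sum_cons, List.sum_nil, add_zero]
          abel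
    have h2 := ih (fun B => match B with
      | [] => 0
      | c :: B' => G ((a :: c) :: B')) b
    rw [h1, h2, List.length_cons]
    conv_rhs => rw [Finset.sum_range_succ', add_comm]
    simp

theorem S_nil : S [] = 1 := by
  simp [S, blockings, QSh.one_def]

/-- The recursion on the first block: its coefficient is a value of `shuffleChar`, its sum is the
first letter, and the rest is again a shuffle function. Degree, coproduct, leading term and
character of S_α are all derived from it. -/
theorem S_cons (a : ℕ+) (α : List ℕ+) : S (a :: α) = ∑ i ∈ Finset.range (α.length + 1),
    ShufflePos.shuffleChar (QSh.word _ (a :: α.take i)) •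
      QSh.cons (blockSum (a :: α.take i)) (S (α.drop i)) := by
  classical
  rw [S, sum_blockings_cons]
  refine Finset.sum_congr rfl fun i _ => ?_
  rw [S, map_list_sum, List.map_map, List.smul_sum, List.map_map]
  refine congrArg List.sum (List.map_congr_left fun B _ => ?_)
  simp only [Function.comp_apply, ShufflePos.shuffleChar_word, List.forall_mem_cons,
    List.map_cons, List.prod_cons]
  by_cases h1 : NoOtE (a :: α.take i) <;> by_cases h2 : ∀ b ∈ B, NoOtE b
  · simp only [if_pos h1, if_pos h2, if_pos (And.intro h1 h2), map_smul, QSh.cons_word, mul_smul, M]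
  · simp only [h2, and_false, if_false, map_zero, smul_zero]
  · simp only [h1, false_and, if_false, zero_smul]
  · simp only [h1, false_and, if_false, zero_smul]

theorem blockSum_cons (a : ℕ+) (α : List ℕ+) :
    (blockSum (a :: α) : ℕ) = ((a :: α).map fun a : ℕ+ => (a : ℕ)).sum := by
  rw [blockSum, Nat.toPNat'_coe, if_pos]
  rw [List.map_cons, List.sum_cons]
  exact Nat.add_pos_left a.pos _

theorem shuffleChar_singleton (a : ℕ+) : ShufflePos.shuffleChar (QSh.word _ [a]) = 1 := by
  rw [ShufflePos.shuffleChar_word, if_pos (by simp [NoOtE])]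
  rcases Nat.even_or_odd (a : ℕ) with h | h
  · simp [blockCoeff, h]
  · simp [blockCoeff, h]

theorem blockSum_singleton (a : ℕ+) : blockSum [a] = a :=
  PNat.coe_injective (by rw [blockSum_cons]; simp)

theorem cons_mem_grading (x : ℕ+) {n : ℕ} {f : QSym} (hf : f ∈ grading n) :
    QSh.cons x f ∈ grading (x + n) :=
  QSh.cons_mem_grading x hf

theorem S_mem_grading (α : List ℕ+) : S α ∈ grading (α.map fun a : ℕ+ => (a : ℕ)).sum := by
  induction h : α.length using Nat.strong_induction_on generalizing α with
  | _ n ih =>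
    cases α with
    | nil =>
      rw [S_nil, QSh.one_def]
      exact QSh.word_mem_grading _ []
    | cons a α =>
      rw [S_cons]
      refine Submodule.sum_mem _ fun i _ => Submodule.smul_mem _ _ ?_
      have := cons_mem_grading (blockSum (a :: α.take i))
        (ih _ (by simp at h ⊢; omega) (α.drop i) rfl)
      rw [blockSum_cons] at this
      rw [← List.sum_append, ← List.map_append, List.cons_append,
        List.take_append_drop] at this
      exact this

theorem coeff_nil_S (α : List ℕ+) : QSh.coeff [] (S α) = if α = [] then 1 else 0 := by
  classical
  cases α with
  | nil => rw [S_nil, QSh.one_def, QSh.coeff_word]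
  | cons a α => simp [S_cons, QSh.coeff_nil_cons]

/-- A cut of M_β falls between two blocks and so induces a cut of α; conversely a blocking of each
half of α gives one of the whole. -/
theorem comul_S (α : List ℕ+) : Coalgebra.comul (R := ℂ) (S α) =
    ∑ i ∈ Finset.range (α.length + 1), S (α.take i) ⊗ₜ[ℂ] S (α.drop i) := by
  induction h : α.length using Nat.strong_induction_on generalizing α with
  | _ n ih =>
    subst h
    cases α with
    | nil => simp [S_nil, Algebra.TensorProduct.one_def]
    | cons a α =>
      rw [List.length_cons, Finset.sum_range_succ', List.take_zero, List.drop_zero, S_nil]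
      have h1 : ∀ i ∈ Finset.range (α.length + 1), Coalgebra.comul (R := ℂ)
          (ShufflePos.shuffleChar (QSh.word _ (a :: α.take i)) •
            QSh.cons (blockSum (a :: α.take i)) (S (α.drop i))) =
          (∑ j ∈ Finset.range (α.length - i + 1),
            (ShufflePos.shuffleChar (QSh.word _ (a :: α.take i)) •
            QSh.cons (blockSum (a :: α.take i)) (S ((α.drop i).take j))) ⊗ₜ[ℂ]
              S ((α.drop i).drop j)) +
                1 ⊗ₜ[ℂ] (ShufflePos.shuffleChar (QSh.word _ (a :: α.take i)) •
            QSh.cons (blockSum (a :: α.take i)) (S (α.drop i))) := by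
        intro i _
        rw [map_smul, QSh.comul_cons, ih (α.drop i).length (by simp) (α.drop i) rfl,
          List.length_drop, map_sum, smul_add, add_comm, Finset.smul_sum, tmul_smul]
        simp only [TensorProduct.map_tmul, LinearMap.id_apply, smul_tmul']
      conv_lhs => rw [S_cons, map_sum, Finset.sum_congr rfl h1, Finset.sum_add_distrib,
        ← tmul_sum, ← S_cons]
      congr 1
      have h2 : ∀ k ∈ Finset.range (α.length + 1),
          S ((a :: α).take (k + 1)) ⊗ₜ[ℂ] S ((a :: α).drop (k + 1)) =
          ∑ i ∈ Finset.range (k + 1), (ShufflePos.shuffleChar (QSh.word _ (a :: α.take i)) •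
            QSh.cons (blockSum (a :: α.take i)) (S ((α.drop i).take (k - i)))) ⊗ₜ[ℂ]
              S ((α.drop i).drop (k - i)) := by
        intro k hk
        have hk' : k ≤ α.length := by simpa [Nat.lt_succ_iff] using hk
        rw [List.take_succ_cons, List.drop_succ_cons, S_cons, sum_tmul,
          List.length_take, min_eq_left hk']
        refine Finset.sum_congr rfl fun i hi => ?_
        have hi' : i ≤ k := by simpa [Nat.lt_succ_iff] using hi
        rw [List.take_take, min_eq_left hi', List.drop_take, List.drop_drop,
          Nat.add_sub_cancel' hi']
      rw [Finset.sum_congr rfl h2, Finset.sum_sigma', Finset.sum_sigma']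
      -- The first block has i + 1 letters and j further letters precede the cut; the pair (i, j) is
      -- traded for (i + j, i).
      exact Finset.sum_nbij' (fun x => ⟨x.1 + x.2, x.1⟩) (fun x => ⟨x.2, x.1 - x.2⟩)
        (by simp; omega) (by simp; omega) (by simp)
        (by rintro ⟨k, i⟩ h; simp at h ⊢; omega) (by simp)

/-- Any block with two or more letters shortens the word, so in length at least that of α only the
blocking into singletons remains, with coefficient 1. -/
theorem coeff_S (α w : List ℕ+) (h : α.length ≤ w.length) :
    QSh.coeff w (S α) = if w = α then 1 else 0 := by
  induction hn : α.length using Nat.strong_induction_on generalizing α w with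
  | _ n ih =>
    subst hn
    cases α with
    | nil =>
      classical
      rw [S_nil, QSh.one_def, QSh.coeff_word]
    | cons a α =>
      cases w with
      | nil => simp at h
      | cons x w =>
        have h' : α.length ≤ w.length := by simpa using h
        rw [S_cons, map_sum, Finset.sum_range_succ']
        simp only [map_smul, ← coeff_strip, strip_cons, List.take_zero, List.drop_zero,
          shuffleChar_singleton, blockSum_singleton, one_smul]
        rw [Finset.sum_eq_zero, zero_add]
        · by_cases hax : a = x
          · rw [if_pos hax, ih _ (by simp) α w h' rfl, hax]
            simp
          · rw [if_neg hax, map_zero, if_neg]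
            simp [Ne.symm hax]
        -- A first block of at least two letters leaves a tail shorter than `w`.
        · intro i hi
          have hi' : i < α.length := by simpa using hi
          have hl : (α.drop (i + 1)).length < w.length := by simp; omega
          split_ifs
          · rw [ih _ (by simp) (α.drop (i + 1)) w hl.le rfl, if_neg, smul_zero]
            rintro rfl
            exact lt_irrefl _ hl
          · rw [map_zero, smul_zero]

/-! ### The shuffle isomorphism -/

/-- Among words of positive degree n the character ζ sees only the one-letter word. With
`QSh.coalgHom_ext` this is the uniqueness half of the universal property of `QSym`: a graded
coalgebra map is determined by its composite with ζ. -/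
theorem coeff_singleton {n : ℕ} {f : QSym} (hf : f ∈ grading n) (a : ℕ+) :
    QSh.coeff [a] f = if (a : ℕ) = n then zeta f else 0 := by
  classical
  induction hf using Submodule.span_induction with
  | mem f hf =>
    obtain ⟨w, rfl, rfl⟩ := hf
    rw [QSh.coeff_word]
    change _ = if _ then zetaLin (M w) else 0
    rw [zetaLin_M]
    rcases w with _ | ⟨b, _ | ⟨c, w⟩⟩
    · simp
    · simp
    · simp
  | zero => simp
  | add f g _ _ hf hg => rw [map_add, hf, hg, map_add]; split_ifs <;> simp
  | smul c f _ hf => rw [map_smul, hf, map_smul]; split_ifs <;> simp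

theorem mul_mem_grading {m n : ℕ} {f g : QSym} (hf : f ∈ grading m) (hg : g ∈ grading n) :
    f * g ∈ grading (m + n) :=
  QSh.mul_mem_grading (fun a b c h => by
    rw [QSh.op_add, Option.some_inj] at h; rw [← h, PNat.add_coe]) hf hg

/-- For nonempty α, ζ retains only the blocking with a single block, whose coefficient is the value
of `shuffleChar`. -/
theorem zeta_S (α : List ℕ+) : zeta (S α) = ShufflePos.shuffleChar (QSh.word _ α) := by
  cases α with
  | nil => rw [S_nil, map_one, ← QSh.one_def]; exact (map_one ShufflePos.shuffleChar.ofConv).symm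
  | cons a α =>
    change zetaLin _ = _
    rw [S_cons, map_sum, Finset.sum_eq_single α.length]
    · simp [zetaLin_cons, coeff_nil_S]
    · intro i hi hne
      have hi' : i < α.length := lt_of_le_of_ne (by simpa [Nat.lt_succ_iff] using hi) hne
      rw [map_smul, zetaLin_cons, coeff_nil_S, if_neg, smul_zero]
      simp
      omega
    · simp

end QSym

namespace ShufflePos

/-- The grading of the shuffle algebra in which the letter `a` has degree `a`. -/
def grading : ℕ → Submodule ℂ ShufflePos :=
  QSh.grading (LetterProduct.zero ℕ+) (fun a : ℕ+ => (a : ℕ))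

/-- The linear map that sends the word `α` to the shuffle function `S_α`. -/
def toQSymLin : ShufflePos →ₗ[ℂ] QSym := (QSh.basis _).constr ℂ QSym.S

theorem toQSymLin_word (α : List ℕ+) : toQSymLin (QSh.word _ α) = QSym.S α := by
  simp [toQSymLin, QSh.word, Module.Basis.constr_basis]

theorem toQSymLin_mem_grading {n : ℕ} {f : ShufflePos} (hf : f ∈ grading n) :
    toQSymLin f ∈ QSym.grading n :=
  QSh.map_mem_grading (fun w => by rw [toQSymLin_word]; exact QSym.S_mem_grading w) hf

theorem zeta_toQSymLin (f : ShufflePos) : QSym.zeta (toQSymLin f) = shuffleChar f := by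
  have : QSym.zeta.toLinearMap ∘ₗ toQSymLin = shuffleChar.ofConv.toLinearMap :=
    QSh.lin_ext fun w => by
      rw [LinearMap.comp_apply, toQSymLin_word]; exact QSym.zeta_S w
  exact LinearMap.congr_fun this f

/-- `toQSymLin` as a morphism of coalgebras. -/
def toQSymCoalgHom : ShufflePos →ₗc[ℂ] QSym where
  toLinearMap := toQSymLin
  counit_comp := QSh.lin_ext fun w => by
    classical
    rw [LinearMap.comp_apply, toQSymLin_word]
    change QSh.coeff [] (QSym.S w) = QSh.coeff [] (QSh.word _ w)
    rw [QSym.coeff_nil_S, QSh.coeff_word]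
    simp [eq_comm]
  map_comp_comul := QSh.lin_ext fun w => by
    rw [LinearMap.comp_apply, LinearMap.comp_apply, toQSymLin_word, QSym.comul_S, QSh.comul_def,
      QSh.comulLin_word, map_sum]
    simp only [TensorProduct.map_tmul, toQSymLin_word]

/-- Multiplication of a bialgebra is a coalgebra morphism, so both sides are coalgebra morphisms
from the tensor square. By `QSym.coeff_singleton` their one-letter coefficients on homogeneous
tensors agree, since ζ and `shuffleChar` are multiplicative. -/
theorem toQSymLin_mul (f g : ShufflePos) : toQSymLin (f * g) = toQSymLin f * toQSymLin g := by
  have h : toQSymCoalgHom.comp (Bialgebra.mulCoalgHom ℂ ShufflePos) =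
      (Bialgebra.mulCoalgHom ℂ QSym).comp
        (Coalgebra.TensorProduct.map toQSymCoalgHom toQSymCoalgHom) := by
    refine QSh.coalgHom_ext fun a c => ?_
    induction c using TensorProduct.induction_on with
    | zero => simp only [map_zero]
    | add c d hc hd => simp only [map_add, hc, hd]
    | tmul f g =>
      change QSh.coeff [a] (toQSymLin (f * g)) = QSh.coeff [a] (toQSymLin f * toQSymLin g)
      induction f using QSh.induction with
      | hw u =>
        induction g using QSh.induction with
        | hw v =>
          have hu := QSh.word_mem_grading (L := LetterProduct.zero ℕ+) (fun a : ℕ+ => (a : ℕ)) u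
          have hv := QSh.word_mem_grading (L := LetterProduct.zero ℕ+) (fun a : ℕ+ => (a : ℕ)) v
          have huv := QSh.mul_mem_grading (by simp [LetterProduct.zero]) hu hv
          rw [QSym.coeff_singleton (toQSymLin_mem_grading huv), QSym.coeff_singleton
            (QSym.mul_mem_grading (toQSymLin_mem_grading hu) (toQSymLin_mem_grading hv)),
            map_mul QSym.zeta, zeta_toQSymLin, zeta_toQSymLin, zeta_toQSymLin, map_mul]
        | hadd f g hf hg => simp only [mul_add, map_add, hf, hg]
        | hsmul c f hf => simp only [mul_smul_comm, map_smul, hf]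
      | hadd f g hf hg => simp only [add_mul, map_add, hf, hg]
      | hsmul c f hf => simp only [smul_mul_assoc, map_smul, hf]
  exact CoalgHom.congr_fun h (f ⊗ₜ g)

theorem toQSymLin_bijective : Function.Bijective toQSymLin :=
  QSh.bijective_of_unitriangular fun u w h => by rw [toQSymLin_word, QSym.coeff_S u w h]

/-- The isomorphism of the shuffle algebra onto `QSym` that sends the word `α` to `S_α`. -/
def equivQSym : ShufflePos ≃ₐc[ℂ] QSym :=
  BialgEquiv.ofBijective (bialgHomOfLinearMap toQSymLin
    (by rw [QSh.one_def, toQSymLin_word, QSym.S_nil]) toQSymLin_mul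
    (CoalgHomClass.counit_comp_apply toQSymCoalgHom)
    (fun x => (CoalgHomClass.map_comp_comul_apply toQSymCoalgHom x).symm)) toQSymLin_bijective

theorem equivQSym_word (α : List ℕ+) : equivQSym (QSh.word _ α) = QSym.S α := toQSymLin_word α

theorem zeta_equivQSym (f : ShufflePos) : QSym.zeta (equivQSym f) = shuffleChar f :=
  zeta_toQSymLin f

theorem equivQSym_mem_grading_iff {n : ℕ} {f : ShufflePos} :
    equivQSym f ∈ QSym.grading n ↔ f ∈ grading n :=
  ⟨mem_of_map_mem (f := toQSymLin) (QSh.iSup_grading _) (QSh.iSupIndep_grading _)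
    toQSymLin_bijective.1 (fun _ _ h => toQSymLin_mem_grading h), toQSymLin_mem_grading⟩

end ShufflePos

/-! ### Morphisms into and out of sub-bialgebras -/

namespace Subbialgebra

variable {A B : Type} [Ring A] [Bialgebra ℂ A] [Ring B] [Bialgebra ℂ B]

/-- The inclusion as a morphism of bialgebras. -/
def inclHom (P : Subbialgebra B) : P →ₐc[ℂ] B :=
  bialgHomOfLinearMap P.incl rfl (fun _ _ => rfl) (fun _ => rfl)
    (fun x => (P.map_incl_comulLin x).symm)

/-- A morphism of bialgebras with values in a sub-bialgebra. -/
def codRestrict (P : Subbialgebra B) (f : A →ₐc[ℂ] B) (h : ∀ x, f x ∈ P.toSubalgebra) :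
    A →ₐc[ℂ] P :=
  bialgHomOfLinearMap ((f : A →ₗ[ℂ] B).codRestrict (Subalgebra.toSubmodule P.toSubalgebra) h)
    (Subtype.ext (map_one f)) (fun x y => Subtype.ext (map_mul f x y))
    (fun x => f.counit_apply x)
    (fun x => P.map_incl_injective (by
      refine (P.map_incl_comulLin _).trans ?_
      rw [← LinearMap.comp_apply, ← TensorProduct.map_comp]
      exact f.comul_apply x))

theorem mem_range {f : A →ₐc[ℂ] B} {y : B} : y ∈ (range f).toSubalgebra ↔ ∃ x, f x = y := Iff.rfl

/-- An injective morphism is an isomorphism onto its image. -/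
theorem exists_equiv (P : Subbialgebra B) (f : A →ₐc[ℂ] B) (hf : Function.Injective f)
    (h : ∀ y, y ∈ P.toSubalgebra ↔ ∃ x, f x = y) :
    ∃ e : A ≃ₐc[ℂ] P, ∀ x, P.incl (e x) = f x := by
  refine ⟨BialgEquiv.ofBijective (P.codRestrict f fun x => (h _).2 ⟨x, rfl⟩) ⟨?_, ?_⟩,
    fun x => rfl⟩
  · exact fun x y hxy => hf (congrArg Subtype.val hxy)
  · rintro ⟨y, hy⟩
    obtain ⟨x, rfl⟩ := (h y).1 hy
    exact ⟨x, rfl⟩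

/-- Only the degrees of a spanning family have to be tested, by `mem_spanDegree_iff` applied to the
composite with the inclusion. -/
theorem isGradedEquiv {ι : Type} {C : ι → A} (hC : Submodule.span ℂ (Set.range C) = ⊤)
    {deg : ι → ℕ} {𝒜 : ℕ → Submodule ℂ A} (h𝒜 : ∀ n, 𝒜 n = spanDegree C deg n)
    {ℬ : ℕ → Submodule ℂ B} (hB : iSupIndep ℬ) {P : Subbialgebra B} (e : A ≃ₐc[ℂ] P)
    (he : ∀ i, P.incl (e (C i)) ∈ ℬ (deg i)) : IsGradedEquiv 𝒜 (P.grading ℬ) e := by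
  intro n x
  rw [h𝒜]
  exact mem_spanDegree_iff hC hB (f := P.incl ∘ₗ (e : A →ₐc[ℂ] P))
    (P.incl_injective.comp e.injective) he n x

end Subbialgebra

/-! ### Characters -/

namespace Character

variable {H K : Type} [Ring H] [Bialgebra ℂ H] [Ring K] [Bialgebra ℂ K]

/-- The composition of a character with a morphism of bialgebras. -/
def comap (χ : Character K) (f : H →ₐc[ℂ] K) : Character H :=
  WithConv.toConv (χ.ofConv.comp (f : H →ₐ[ℂ] K))

theorem comap_apply (χ : Character K) (f : H →ₐc[ℂ] K) (x : H) : χ.comap f x = χ (f x) := rfl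

theorem comap_mul (χ ψ : Character K) (f : H →ₐc[ℂ] K) :
    comap (χ * ψ) f = comap χ f * comap ψ f := by
  refine WithConv.ofConv_injective (AlgHom.ext fun x => ?_)
  change (χ * ψ) (f x) = (comap χ f * comap ψ f) x
  rw [AlgHom.convMul_apply, AlgHom.convMul_apply, f.comul_apply]
  generalize Coalgebra.comul (R := ℂ) x = t
  induction t using TensorProduct.induction_on with
  | zero => simp only [map_zero]
  | add a b ha hb => simp only [map_add, ha, hb]
  | tmul a b => rfl

theorem comap_one (f : H →ₐc[ℂ] K) : comap 1 f = 1 := by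
  refine WithConv.ofConv_injective (AlgHom.ext fun x => ?_)
  exact f.counit_apply x

theorem ext_of_grading {𝒜 : ℕ → Submodule ℂ H} (h𝒜 : ⨆ n, 𝒜 n = ⊤) {χ ψ : Character H}
    (h : ∀ n, ∀ x ∈ 𝒜 n, χ x = ψ x) : χ = ψ := by
  refine WithConv.ofConv_injective (AlgHom.ext fun x => ?_)
  have hx : x ∈ ⨆ n, 𝒜 n := h𝒜 ▸ Submodule.mem_top
  induction hx using Submodule.iSup_induction' with
  | mem n x hx => exact h n x hx
  | zero => simp only [map_zero]
  | add x y _ _ hx hy => simp only [map_add, hx, hy]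

end Character

/-- A theta morphism of a graded Hopf algebra that embeds into `QSym` is unique. -/
theorem IsThetaMorphism.unique {H : Type} [Ring H] [Bialgebra ℂ H] {𝒜 : ℕ → Submodule ℂ H}
    (h𝒜 : ⨆ n, 𝒜 n = ⊤) {ζ : Character H} {j : H →ₐc[ℂ] QSym} (hj : Function.Injective j)
    (hgr : ∀ n, ∀ x ∈ 𝒜 n, j x ∈ QSym.grading n) (hζ : ∀ x, QSym.zeta (j x) = ζ x)
    {Θ Θ' : H →ₐc[ℂ] H} (h : IsThetaMorphism 𝒜 ζ Θ) (h' : IsThetaMorphism 𝒜 ζ Θ') : Θ = Θ' := by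
  obtain ⟨ξ, χ, hξ, hχ, hΘ⟩ := h
  obtain ⟨ξ', χ', hξ', hχ', hΘ'⟩ := h'
  -- The convolution inverse is unique, and its bar is then fixed degree by degree.
  obtain rfl : ξ = ξ' := left_inv_eq_right_inv hξ.1 hξ'.2
  obtain rfl : χ = χ' := Character.ext_of_grading h𝒜 fun n x hx => by rw [hχ n x hx, hχ' n x hx]
  have key : ((j.comp Θ : H →ₐc[ℂ] QSym) : H →ₗc[ℂ] QSym) = (j.comp Θ' : H →ₐc[ℂ] QSym) := by
    -- Both composites into `QSym` have the same one-letter coefficients, because these are values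
    -- of the prescribed character.
    refine QSh.coalgHom_ext fun a x => ?_
    change QSh.coeff [a] (j (Θ x)) = QSh.coeff [a] (j (Θ' x))
    have hx : x ∈ ⨆ n, 𝒜 n := h𝒜 ▸ Submodule.mem_top
    induction hx using Submodule.iSup_induction' with
    | mem n x hx =>
      rw [QSym.coeff_singleton (hgr _ _ (hΘ.map_mem n x hx)),
        QSym.coeff_singleton (hgr _ _ (hΘ'.map_mem n x hx)), hζ, hζ, hΘ.character, hΘ'.character]
    | zero => simp only [map_zero]
    | add x y _ _ hx hy => simp only [map_add, hx, hy]
  exact BialgHom.ext fun x => hj (CoalgHom.congr_fun key x)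

/-! ### The theta map of `QSym` -/

namespace ShufflePos

/-- The endomorphism that doubles the odd letters and kills the even ones. -/
def doubleOdd : ShufflePos →ₐc[ℂ] ShufflePos := QSh.letterMap (fun a => 2 * oddInd a) id

open Classical in
theorem doubleOdd_word (α : List ℕ+) : doubleOdd (QSh.word _ α) =
    if ∀ a ∈ α, Odd (a : ℕ) then (2 : ℂ) ^ α.length • QSh.word _ α else 0 := by
  rw [doubleOdd, QSh.letterMap_word, List.map_id, List.prod_map_mul, prod_map_oddInd]
  split_ifs <;> simp

theorem expChar_comap (t s : ℕ+ → ℂ) :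
    Character.comap (WithConv.toConv (QSh.expChar t)) (QSh.letterMap s id) =
      WithConv.toConv (QSh.expChar fun a => s a * t a) := by
  refine QSh.character_ext fun w => ?_
  rw [Character.comap_apply, QSh.letterMap_word, map_smul]
  simp [QSh.expChar_word, mul_div_assoc]

/-- The scaled exponential character of the odd letters. -/
def oddChar (c : ℂ) : Character ShufflePos := WithConv.toConv (QSh.expChar fun a => c * oddInd a)

/-- The scaled exponential character of the even letters. -/
def evenChar (c : ℂ) : Character ShufflePos := WithConv.toConv (QSh.expChar fun a => c * evenInd a)

theorem oddChar_mul (c d : ℂ) : oddChar c * oddChar d = oddChar (c + d) := QSh.expChar_mul _ c d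

theorem evenChar_mul (c d : ℂ) : evenChar c * evenChar d = evenChar (c + d) :=
  QSh.expChar_mul _ c d

theorem oddChar_zero : oddChar 0 = 1 := by simp [oddChar, QSh.expChar_zero]

theorem evenChar_zero : evenChar 0 = 1 := by simp [evenChar, QSh.expChar_zero]

theorem shuffleChar_eq : shuffleChar = evenChar 1 * oddChar 1 := by
  simp [shuffleChar, evenChar, oddChar]

/-- Both factors lie in one-parameter groups, so inversion reverses their order and negates the
parameters. -/
theorem isInverseCharacter_shuffleChar :
    IsInverseCharacter shuffleChar (oddChar (-1) * evenChar (-1)) := by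
  constructor
  · rw [shuffleChar_eq, mul_assoc, ← mul_assoc (evenChar (-1)), evenChar_mul, neg_add_cancel,
      evenChar_zero, one_mul, oddChar_mul, neg_add_cancel, oddChar_zero]
  · rw [shuffleChar_eq, mul_assoc, ← mul_assoc (oddChar 1), oddChar_mul, add_neg_cancel,
      oddChar_zero, one_mul, evenChar_mul, add_neg_cancel, evenChar_zero]

/-- On words of odd letters the degree has the parity of the length, so the sign can be absorbed
into the parameter; for c ≠ 0 these are the only words that matter, both sides being zero elsewhere.
-/
theorem oddChar_bar (c : ℂ) (w : List ℕ+) : oddChar (-c) (QSh.word _ w) =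
    (-1) ^ (w.map fun a : ℕ+ => (a : ℕ)).sum * oddChar c (QSh.word _ w) := by
  change QSh.expChar _ _ = _ * QSh.expChar _ _
  rw [QSh.expChar_word, QSh.expChar_word, ← mul_div_assoc]
  congr 1
  induction w with
  | nil => simp
  | cons a w ih =>
    rw [List.map_cons, List.map_cons, List.map_cons, List.prod_cons, List.prod_cons,
      List.sum_cons, ih, pow_add]
    rcases Nat.even_or_odd (a : ℕ) with h | h
    · simp [oddInd, Nat.not_odd_iff_even.2 h]
    · rw [h.neg_one_pow]; ring

/-- The character vanishes on words with an odd letter, and the remaining words have even degree: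
the bar fixes it. -/
theorem evenChar_bar (c : ℂ) (w : List ℕ+) : evenChar c (QSh.word _ w) =
    (-1) ^ (w.map fun a : ℕ+ => (a : ℕ)).sum * evenChar c (QSh.word _ w) := by
  change QSh.expChar _ _ = _ * QSh.expChar _ _
  rw [QSh.expChar_word, ← mul_div_assoc]
  congr 1
  induction w with
  | nil => simp
  | cons a w ih =>
    rw [List.map_cons, List.map_cons, List.prod_cons, List.sum_cons]
    conv_lhs => rw [ih]
    rw [pow_add]
    rcases Nat.even_or_odd (a : ℕ) with h | h
    · rw [h.neg_one_pow]; ring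
    · simp [evenInd, Nat.not_even_iff_odd.2 h]

/-- Degree is additive along deconcatenation, so the bar acts on the two convolution factors
separately. -/
theorem isBarCharacter : IsBarCharacter grading (oddChar (-1) * evenChar (-1))
    (oddChar 1 * evenChar (-1)) := by
  intro n f hf
  induction hf using Submodule.span_induction with
  | mem f hf =>
    obtain ⟨w, rfl, rfl⟩ := hf
    rw [QSh.convMul_word, QSh.convMul_word, Finset.mul_sum]
    refine Finset.sum_congr rfl fun i _ => ?_
    conv_rhs => rw [← List.take_append_drop i w, List.map_append, List.sum_append, pow_add,
      List.take_append_drop i w]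
    rw [oddChar_bar]
    conv_lhs => rw [evenChar_bar]
    generalize ((w.take i).map fun a : ℕ+ => (a : ℕ)).sum = s
    -- The sign of the prefix occurs twice, once from the degree and once from `oddChar_bar`, and
    -- cancels.
    have hs : ((-1 : ℂ) ^ s) * (-1) ^ s = 1 := by rw [← mul_pow]; simp
    linear_combination (exp := 1) -((-1) ^ ((w.drop i).map fun a : ℕ+ => (a : ℕ)).sum *
      oddChar 1 (QSh.word _ (w.take i)) * evenChar (-1) (QSh.word _ (w.drop i))) * hs
  | zero => simp
  | add f g _ _ hf hg => rw [map_add, hf, hg, map_add, mul_add]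
  | smul c f _ hf => rw [map_smul, hf, map_smul, smul_eq_mul, smul_eq_mul]; ring

/-- The computation behind the theta map: the two even factors in the middle cancel and leave O(2),
while killing even letters and doubling odd ones turns E(1)O(1) into O(2) as well. -/
theorem comap_doubleOdd : Character.comap shuffleChar doubleOdd =
    oddChar 1 * evenChar (-1) * shuffleChar := by
  rw [shuffleChar_eq, Character.comap_mul, mul_assoc, ← mul_assoc (evenChar (-1)), evenChar_mul,
    neg_add_cancel, evenChar_zero, one_mul, oddChar_mul]
  have h1 : Character.comap (evenChar 1) doubleOdd = 1 := by
    rw [evenChar, doubleOdd, expChar_comap, ← QSh.expChar_zero]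
    congr 2
    funext a
    rcases Nat.even_or_odd (a : ℕ) with h | h
    · simp [oddInd, Nat.not_odd_iff_even.2 h]
    · simp [evenInd, Nat.not_even_iff_odd.2 h]
  have h2 : Character.comap (oddChar 1) doubleOdd = oddChar (1 + 1) := by
    rw [oddChar, doubleOdd, expChar_comap, oddChar]
    congr 2
    funext a
    simp only [oddInd]
    split_ifs <;> norm_num
  rw [h1, h2, one_mul]

end ShufflePos

namespace QSym

theorem comap_zeta : Character.comap (WithConv.toConv zeta)
    (ShufflePos.equivQSym : ShufflePos →ₐc[ℂ] QSym) = ShufflePos.shuffleChar :=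
  QSh.character_ext fun _ => ShufflePos.zeta_equivQSym _

/-- The theta map of `QSym`. -/
def theta : QSym →ₐc[ℂ] QSym :=
  (ShufflePos.equivQSym : ShufflePos →ₐc[ℂ] QSym).comp
    (ShufflePos.doubleOdd.comp (ShufflePos.equivQSym.symm : QSym →ₐc[ℂ] ShufflePos))

theorem theta_equivQSym (f : ShufflePos) :
    theta (ShufflePos.equivQSym f) = ShufflePos.equivQSym (ShufflePos.doubleOdd f) := by
  change ShufflePos.equivQSym (ShufflePos.doubleOdd (ShufflePos.equivQSym.symm _)) = _
  rw [BialgEquiv.symm_apply_apply]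

open Classical in
theorem theta_S (α : List ℕ+) :
    theta (S α) = if ∀ a ∈ α, Odd (a : ℕ) then (2 : ℂ) ^ α.length • S α else 0 := by
  rw [← ShufflePos.equivQSym_word, theta_equivQSym, ShufflePos.doubleOdd_word]
  split_ifs <;> simp

theorem comap_symm_comap (χ : Character QSym) :
    Character.comap (Character.comap χ (ShufflePos.equivQSym : ShufflePos →ₐc[ℂ] QSym))
      (ShufflePos.equivQSym.symm : QSym →ₐc[ℂ] ShufflePos) = χ := by
  refine WithConv.ofConv_injective (AlgHom.ext fun x => ?_)
  change χ (ShufflePos.equivQSym (ShufflePos.equivQSym.symm x)) = χ x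
  rw [BialgEquiv.apply_symm_apply]

/-- Everything is transported from the shuffle algebra along `equivQSym`, which matches gradings and
canonical characters. -/
theorem isThetaQSym_theta : IsThetaQSym theta := by
  let i : QSym →ₐc[ℂ] ShufflePos := (ShufflePos.equivQSym.symm : QSym →ₐc[ℂ] ShufflePos)
  have hζ : (WithConv.toConv zeta : Character QSym) = Character.comap ShufflePos.shuffleChar i := by
    rw [← comap_zeta, comap_symm_comap]
  have hmem : ∀ n, ∀ x ∈ grading n, i x ∈ ShufflePos.grading n := fun n x hx => by
    rw [← ShufflePos.equivQSym_mem_grading_iff]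
    change ShufflePos.equivQSym (ShufflePos.equivQSym.symm x) ∈ _
    rwa [BialgEquiv.apply_symm_apply]
  refine ⟨Character.comap (ShufflePos.oddChar (-1) * ShufflePos.evenChar (-1)) i,
    Character.comap (ShufflePos.oddChar 1 * ShufflePos.evenChar (-1)) i, ?_, ?_, ?_, ?_⟩
  · rw [hζ]
    constructor
    · rw [← Character.comap_mul, ShufflePos.isInverseCharacter_shuffleChar.1, Character.comap_one]
    · rw [← Character.comap_mul, ShufflePos.isInverseCharacter_shuffleChar.2, Character.comap_one]
  · exact fun n x hx => ShufflePos.isBarCharacter n (i x) (hmem n x hx)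
  · intro n x hx
    refine ShufflePos.equivQSym_mem_grading_iff.2 ?_
    refine QSh.map_mem_grading (F := (ShufflePos.doubleOdd : ShufflePos →ₗ[ℂ] ShufflePos))
      (fun w => ?_) (hmem n x hx)
    classical
    change ShufflePos.doubleOdd (QSh.word _ w) ∈ _
    rw [ShufflePos.doubleOdd_word]
    split_ifs
    · exact Submodule.smul_mem _ _ (QSh.word_mem_grading _ w)
    · exact zero_mem _
  · intro x
    rw [hζ, ← Character.comap_mul, ← ShufflePos.comap_doubleOdd]
    change Character.comap ShufflePos.shuffleChar i
      (ShufflePos.equivQSym (ShufflePos.doubleOdd (i x))) = _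
    change ShufflePos.shuffleChar (ShufflePos.equivQSym.symm (ShufflePos.equivQSym _)) = _
    rw [BialgEquiv.symm_apply_apply]
    rfl

theorem isThetaQSym_unique {Θ : QSym →ₐc[ℂ] QSym} (h : IsThetaQSym Θ) : Θ = theta :=
  IsThetaMorphism.unique (QSh.iSup_grading _) (j := BialgHom.id ℂ QSym) Function.injective_id
    (fun _ _ h => h) (fun _ => rfl) h isThetaQSym_theta

end QSym

/-! ### The peak algebra -/

namespace ShuffleOdd

/-- The retraction of the positive integers onto the odd ones. -/
def toOdd (a : ℕ+) : OddPos := if h : Odd (a : ℕ) then ⟨a, h⟩ else ⟨1, odd_one⟩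

/-- The inclusion of the shuffle algebra on the odd letters. -/
def toShufflePos : ShuffleOdd →ₐc[ℂ] ShufflePos := QSh.letterMap (fun _ => 1) Subtype.val

theorem toShufflePos_word (α : List OddPos) :
    toShufflePos (word α) = QSh.word _ (α.map Subtype.val) := by
  rw [toShufflePos, word, QSh.letterMap_word]; simp

/-- A retraction of letters induces a left inverse; the value of `toOdd` on even integers plays no
role. -/
theorem toShufflePos_injective : Function.Injective toShufflePos := by
  have h : (QSh.letterMap (fun _ => 1) toOdd : ShufflePos →ₐc[ℂ] ShuffleOdd).toLinearMap ∘ₗ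
      toShufflePos.toLinearMap = LinearMap.id := by
    refine QSh.lin_ext fun w => ?_
    change QSh.letterMap (fun _ => 1) toOdd (toShufflePos (word w)) = word w
    rw [toShufflePos_word, QSh.letterMap_word]
    have : (toOdd ∘ Subtype.val : OddPos → OddPos) = id := by
      funext a
      simp [toOdd, a.2]
    rw [List.map_map (g := toOdd), this, List.map_id, List.map_const', List.prod_replicate,
      one_pow, one_smul]
    rfl
  have hl : Function.LeftInverse (QSh.letterMap (fun _ => 1) toOdd) toShufflePos :=
    LinearMap.congr_fun h
  exact hl.injective

/-- The embedding of the shuffle algebra on the odd letters into `QSym`. -/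
def toQSym : ShuffleOdd →ₐc[ℂ] QSym :=
  (ShufflePos.equivQSym : ShufflePos →ₐc[ℂ] QSym).comp toShufflePos

theorem toQSym_word (α : List OddPos) : toQSym (word α) = QSym.S (α.map Subtype.val) := by
  change ShufflePos.equivQSym (toShufflePos (word α)) = _
  rw [toShufflePos_word, ShufflePos.equivQSym_word]

theorem toQSym_injective : Function.Injective toQSym :=
  ShufflePos.equivQSym.injective.comp toShufflePos_injective

/-- Theta is diagonal in the shuffle basis, with non-zero eigenvalue exactly on odd compositions, so
its image is the span of those S_α. -/
theorem mem_peakAlgebra_iff (y : QSym) :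
    y ∈ (peakAlgebra QSym.theta).toSubalgebra ↔ ∃ x, toQSym x = y := by
  classical
  rw [Subbialgebra.mem_range]
  constructor
  · rintro ⟨x, rfl⟩
    obtain ⟨f, rfl⟩ : ∃ f, ShufflePos.equivQSym f = x := ⟨_, BialgEquiv.apply_symm_apply _ x⟩
    change _ ∈ LinearMap.range toQSym.toLinearMap
    induction f using QSh.induction with
    | hw w =>
      rw [ShufflePos.equivQSym_word, QSym.theta_S]
      split_ifs with h
      · refine Submodule.smul_mem _ _ ⟨word (w.pmap Subtype.mk h), ?_⟩
        change toQSym _ = _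
        rw [toQSym_word, List.map_pmap]
        simp
      · exact zero_mem _
    | hadd f g hf hg => rw [map_add, map_add]; exact add_mem hf hg
    | hsmul c f hf => rw [map_smul, map_smul]; exact Submodule.smul_mem _ _ hf
  · rintro ⟨x, rfl⟩
    change _ ∈ LinearMap.range QSym.theta.toLinearMap
    induction x using QSh.induction with
    | hw w =>
      refine ⟨((2 : ℂ) ^ w.length)⁻¹ • QSym.S (w.map Subtype.val), ?_⟩
      change QSym.theta _ = toQSym (word w)
      rw [map_smul, QSym.theta_S, if_pos, toQSym_word, List.length_map, smul_smul,
        inv_mul_cancel₀ (pow_ne_zero _ two_ne_zero), one_smul]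
      intro a ha
      obtain ⟨b, _, rfl⟩ := List.mem_map.1 ha
      exact b.2
    | hadd f g hf hg => rw [map_add]; exact add_mem hf hg
    | hsmul c f hf => rw [map_smul]; exact Submodule.smul_mem _ _ hf

theorem exists_equiv_peakAlgebra : ∃ e : ShuffleOdd ≃ₐc[ℂ] peakAlgebra QSym.theta,
    IsGradedEquiv ShuffleOdd.grading (peakGrading QSym.theta) e ∧
      ∀ α : List OddPos, (peakAlgebra QSym.theta).incl (e (ShuffleOdd.word α)) =
        QSym.S (α.map Subtype.val) := by
  obtain ⟨e, he⟩ := (peakAlgebra QSym.theta).exists_equiv toQSym toQSym_injective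
    mem_peakAlgebra_iff
  refine ⟨e, Subbialgebra.isGradedEquiv QSh.span_word (fun n => rfl)
    (QSh.iSupIndep_grading _) e fun w => ?_, fun α => (he _).trans (toQSym_word α)⟩
  rw [he]
  change toQSym (word w) ∈ _
  rw [toQSym_word]
  have := QSym.S_mem_grading (w.map Subtype.val)
  rw [List.map_map] at this
  exact this

end ShuffleOdd

/-! ### Symmetric functions are generated by the power sums -/

namespace QSym

theorem S_singleton (n : ℕ+) : S [n] = M [n] := by
  rw [S_cons]
  simp [shuffleChar_singleton, blockSum_singleton, S_nil, QSh.one_def, QSh.cons_word]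

theorem coeff_m (s : Multiset ℕ+) (w : List ℕ+) :
    QSh.coeff w (m s) = if s = (w : Multiset ℕ+) then 1 else 0 := by
  classical
  simp only [m, map_sum, QSh.coeff_word, Finset.sum_ite_eq, mem_arrangements]

theorem strip_m (x : ℕ+) (s : Multiset ℕ+) :
    strip x (m s) = if x ∈ s then m (s.erase x) else 0 := by
  refine ext_coeff fun w => ?_
  rw [coeff_strip, coeff_m, ← Multiset.cons_coe]
  by_cases hx : x ∈ s
  · rw [if_pos hx, coeff_m]
    refine if_congr ?_ rfl rfl
    constructor
    · rintro rfl; simp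
    · intro h; rw [← h, Multiset.cons_erase hx]
  · rw [if_neg hx, map_zero, if_neg]
    rintro rfl
    simp at hx

theorem isSymm_M_singleton (n : ℕ+) : IsSymm (M [n]) := by
  classical
  intro α β h
  rw [QSh.coeff_word, QSh.coeff_word]
  have : α = [n] ↔ β = [n] :=
    ⟨fun e => List.perm_singleton.1 (e ▸ h.symm), fun e => List.perm_singleton.1 (e ▸ h)⟩
  simp [this]

theorem strip_M_singleton (x a : ℕ+) : strip x (M [a]) = if a = x then 1 else 0 := by
  rw [M, ← QSh.cons_word, strip_cons, QSh.one_def]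

/-- The coefficients of long words in the product of a power sum and a monomial function. -/
theorem coeff_M_mul_m (a : ℕ+) (t : Multiset ℕ+) (w : List ℕ+) (hw : t.card + 1 ≤ w.length) :
    ∃ k : ℕ, QSh.coeff w (M [a] * m t) = k ∧ (k ≠ 0 ↔ (w : Multiset ℕ+) = a ::ₘ t) := by
  induction w generalizing t with
  | nil => simp at hw
  | cons x w ih =>
    have hw' : t.card ≤ w.length := by simpa using hw
    have h0 : ∑ p ∈ splits x, strip p.1 (M [a]) * strip p.2 (m t) =
        ∑ p ∈ splits x, if a = p.1 then strip p.2 (m t) else 0 := by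
      refine Finset.sum_congr rfl fun p _ => ?_
      rw [strip_M_singleton]
      split_ifs <;> simp
    -- Merging `a` with a letter of t leaves only the other letters of t, too few to form `w`.
    have h1 : QSh.coeff w (∑ p ∈ splits x, if a = p.1 then strip p.2 (m t) else 0) = 0 := by
      rw [map_sum]
      refine Finset.sum_eq_zero fun p _ => ?_
      rw [strip_m]
      split_ifs with h2 h3
      · rw [coeff_m, if_neg]
        intro h4
        have := congrArg Multiset.card h4
        rw [Multiset.card_erase_of_mem h3, Multiset.coe_card, Nat.pred_eq_sub_one] at this
        have := Multiset.card_pos_iff_exists_mem.2 ⟨_, h3⟩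
        omega
      · exact map_zero _
      · exact map_zero _
    obtain ⟨k, hk, hk'⟩ : ∃ k : ℕ, QSh.coeff w (M [a] * strip x (m t)) = k ∧
        (k ≠ 0 ↔ x ∈ t ∧ (w : Multiset ℕ+) = a ::ₘ t.erase x) := by
      rw [strip_m]
      by_cases hx : x ∈ t
      · have hpos := Multiset.card_pos_iff_exists_mem.2 ⟨_, hx⟩
        obtain ⟨k, hk, hk'⟩ := ih (t.erase x)
          (by rw [Multiset.card_erase_of_mem hx, Nat.pred_eq_sub_one]; omega)
        exact ⟨k, by rw [if_pos hx, hk], by rw [hk']; simp [hx]⟩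
      · exact ⟨0, by simp [hx], by simp [hx]⟩
    -- The first letter `x` is either the new letter `a`, counted by the indicator, or a letter of
    -- t, counted by `k`. Both counts are natural numbers, so nothing cancels.
    refine ⟨(if x = a ∧ (w : Multiset ℕ+) = t then 1 else 0) + k, ?_, ?_⟩
    · rw [← coeff_strip, strip_mul, h0, map_add, map_add, h1, hk, add_zero, Nat.cast_add]
      congr 1
      rw [strip_M_singleton]
      by_cases hxa : a = x
      · subst hxa
        rw [if_pos rfl, one_mul, coeff_m]
        simp [eq_comm]
      · rw [if_neg hxa, zero_mul, map_zero, if_neg (fun h => hxa h.1.symm), Nat.cast_zero]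
    · rw [Ne, Nat.add_eq_zero_iff, not_and_or, ← Ne, ← Ne, hk', ← Multiset.cons_coe]
      constructor
      · rintro (h | ⟨h, h'⟩)
        · have : x = a ∧ (w : Multiset ℕ+) = t := by by_contra h'; simp [h'] at h
          rw [this.1, this.2]
        · rw [h', Multiset.cons_swap, Multiset.cons_erase h]
      · intro h
        by_cases hxa : x = a
        · subst hxa
          left
          simp [(Multiset.cons_inj_right x).1 h]
        · right
          have hx : x ∈ a ::ₘ t := h ▸ Multiset.mem_cons_self x _
          have hx' : x ∈ t := (Multiset.mem_cons.1 hx).resolve_left hxa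
          refine ⟨hx', ?_⟩
          rw [← Multiset.erase_cons_tail t (Ne.symm hxa), ← h, Multiset.erase_cons_head]

/-- Induction on the number of parts: the product of M_(a) and m_t is a positive multiple of the
monomial function of a ∪ t plus functions with fewer parts, and the multiple is invertible in
characteristic zero. -/
theorem m_mem_adjoin (s : Multiset ℕ+) :
    m s ∈ Algebra.adjoin ℂ (Set.range fun n : ℕ+ => M [n]) := by
  induction h : s.card using Nat.strong_induction_on generalizing s with
  | _ n ih =>
    induction s using Multiset.induction with
    | empty =>
      have : m 0 = 1 := ext_coeff fun w => by
        classical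
        rw [coeff_m, QSh.one_def, QSh.coeff_word]
        simp [eq_comm]
      rw [this]
      exact one_mem _
    | cons a t _ =>
      have ht : m t ∈ Algebra.adjoin ℂ (Set.range fun n : ℕ+ => M [n]) :=
        ih t.card (by rw [← h]; simp) t rfl
      have hg : M [a] * m t ∈ Algebra.adjoin ℂ (Set.range fun n : ℕ+ => M [n]) :=
        mul_mem (Algebra.subset_adjoin ⟨a, rfl⟩) ht
      obtain ⟨T, c, hT⟩ := ((isSymm_M_singleton a).mul (isSymm_m t)).eq_sum
      have hc : ∀ w : List ℕ+, QSh.coeff w (M [a] * m t) =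
          if (w : Multiset ℕ+) ∈ T then c w else 0 := by
        intro w
        rw [hT]
        simp only [map_sum, map_smul, coeff_m, smul_eq_mul, mul_ite, mul_one, mul_zero]
        rw [Finset.sum_ite_eq']
      have hsmall : ∀ s ∈ T, s ≠ a ::ₘ t → c s • m s ∈
          Algebra.adjoin ℂ (Set.range fun n : ℕ+ => M [n]) := by
        intro s hs hne
        by_cases hcard : t.card + 1 ≤ s.card
        · obtain ⟨k, hk, hk'⟩ := coeff_M_mul_m a t s.toList (by simpa using hcard)
          rw [hc, Multiset.coe_toList, if_pos hs] at hk
          rw [Multiset.coe_toList] at hk'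
          have : k = 0 := by by_contra hk0; exact hne (hk'.1 hk0)
          rw [hk, this, Nat.cast_zero, zero_smul]
          exact zero_mem _
        · exact Subalgebra.smul_mem _ (ih s.card (by rw [← h]; simp; omega) s rfl) _
      obtain ⟨k, hk, hk'⟩ := coeff_M_mul_m a t (a ::ₘ t).toList (by simp)
      rw [hc, Multiset.coe_toList] at hk
      rw [Multiset.coe_toList] at hk'
      have hk0 : (k : ℂ) ≠ 0 := Nat.cast_ne_zero.2 (hk'.2 rfl)
      have hmem : a ::ₘ t ∈ T := by
        by_contra hn
        rw [if_neg hn] at hk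
        exact hk0 hk.symm
      rw [if_pos hmem] at hk
      rw [← Finset.add_sum_erase _ _ hmem] at hT
      have hm : m (a ::ₘ t) = (k : ℂ)⁻¹ • (M [a] * m t - ∑ s ∈ T.erase (a ::ₘ t), c s • m s) := by
        rw [hT, add_sub_cancel_right, smul_smul, hk, inv_mul_cancel₀ hk0, one_smul]
      rw [hm]
      exact Subalgebra.smul_mem _ (sub_mem hg (sum_mem fun s hs =>
        hsmall s (Finset.mem_of_mem_erase hs) (Finset.ne_of_mem_erase hs))) _

theorem m_mem_grading (s : Multiset ℕ+) : m s ∈ grading (s.map fun a : ℕ+ => (a : ℕ)).sum := by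
  refine Submodule.sum_mem _ fun α hα => ?_
  rw [mem_arrangements] at hα
  subst hα
  exact QSh.word_mem_grading _ α

theorem theta_M_singleton (n : ℕ+) :
    theta (M [n]) = if Odd (n : ℕ) then (2 : ℂ) • M [n] else 0 := by
  rw [← S_singleton, theta_S]
  simp

end QSym

/-! ### The theta map of Sym -/

namespace SymFn

/-- The power sums, as elements of the algebra of symmetric functions. -/
def powerSum (n : ℕ+) : SymFn := ⟨QSym.M [n], QSym.isSymm_M_singleton n⟩

theorem adjoin_powerSum : Algebra.adjoin ℂ (Set.range powerSum) = ⊤ := by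
  rw [eq_top_iff]
  rintro ⟨f, hf⟩ -
  have h : f ∈ (Algebra.adjoin ℂ (Set.range powerSum)).map SymFn.toSubalgebra.val := by
    rw [AlgHom.map_adjoin, ← Set.range_comp]
    obtain ⟨T, c, rfl⟩ := QSym.IsSymm.eq_sum hf
    exact sum_mem fun s _ => Subalgebra.smul_mem _ (QSym.m_mem_adjoin s) _
  obtain ⟨g, hg, rfl⟩ := h
  exact hg

theorem iSup_grading : ⨆ n, grading n = ⊤ := by
  rw [eq_top_iff]
  rintro ⟨f, hf⟩ -
  obtain ⟨T, c, rfl⟩ := QSym.IsSymm.eq_sum hf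
  have : (⟨∑ s ∈ T, c s • QSym.m s, hf⟩ : SymFn) =
      ∑ s ∈ T, c s • (⟨QSym.m s, QSym.isSymm_m s⟩ : SymFn) := by
    refine SymFn.incl_injective ?_
    rw [map_sum]
    rfl
  rw [this]
  exact Submodule.sum_mem _ fun s _ => Submodule.smul_mem _ _
    (Submodule.mem_iSup_of_mem _ (QSym.m_mem_grading s))

theorem iSupIndep_grading : iSupIndep grading := by
  intro n
  rw [Submodule.disjoint_def]
  intro x hx hx'
  refine SymFn.incl_injective ((Submodule.disjoint_def.1 (QSh.iSupIndep_grading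
    (L := LetterProduct.add) (fun a : ℕ+ => (a : ℕ)) n) _ hx ?_).trans (map_zero _).symm)
  have h : (⨆ (m) (_ : m ≠ n), grading m) ≤
      (⨆ (m) (_ : m ≠ n), QSym.grading m).comap SymFn.incl :=
    iSup₂_le fun m hm y hy => Submodule.mem_iSup_of_mem m (Submodule.mem_iSup_of_mem hm hy)
  exact h hx'

/-- Enough on the generators: each power sum is a one-letter shuffle function, hence an eigenvector
of theta. -/
theorem theta_mem (f : SymFn) : QSym.theta.comp SymFn.inclHom f ∈ SymFn.toSubalgebra := by
  have h : (⊤ : Subalgebra ℂ SymFn) ≤ SymFn.toSubalgebra.comap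
      ((QSym.theta.comp SymFn.inclHom : SymFn →ₐc[ℂ] QSym) : SymFn →ₐ[ℂ] QSym) := by
    rw [← adjoin_powerSum, Algebra.adjoin_le_iff]
    rintro _ ⟨n, rfl⟩
    change QSym.theta (QSym.M [n]) ∈ SymFn.toSubalgebra
    rw [QSym.theta_M_singleton]
    split_ifs
    · exact Subalgebra.smul_mem _ (QSym.isSymm_M_singleton n) _
    · exact zero_mem _
  exact h (Algebra.mem_top (x := f))

/-- The theta map of the algebra of symmetric functions. -/
def theta : SymFn →ₐc[ℂ] SymFn :=
  SymFn.codRestrict (QSym.theta.comp SymFn.inclHom) theta_mem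

theorem theta_powerSum (n : ℕ+) :
    theta (powerSum n) = if Odd (n : ℕ) then (2 : ℂ) • powerSum n else 0 := by
  refine SymFn.incl_injective ((QSym.theta_M_singleton n).trans ?_)
  split_ifs <;> rfl

/-- Restriction of characters to a sub-bialgebra respects convolution, so the data found for `QSym`
restrict. -/
theorem isThetaSym_theta : IsThetaSym theta := by
  obtain ⟨ξ, χ, hξ, hχ, hΘ⟩ := QSym.isThetaQSym_theta
  have hζ : (WithConv.toConv SymFn.zeta : Character SymFn) =
      Character.comap (WithConv.toConv QSym.zeta) SymFn.inclHom := rfl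
  refine ⟨Character.comap ξ SymFn.inclHom, Character.comap χ SymFn.inclHom, ⟨?_, ?_⟩, ?_, ?_, ?_⟩
  · rw [hζ, ← Character.comap_mul, hξ.1, Character.comap_one]
  · rw [hζ, ← Character.comap_mul, hξ.2, Character.comap_one]
  · exact fun n x hx => hχ n x hx
  · exact fun n x hx => hΘ.map_mem n x hx
  · intro x
    rw [hζ, ← Character.comap_mul]
    exact hΘ.character x

theorem isThetaSym_unique {Θ : SymFn →ₐc[ℂ] SymFn} (h : IsThetaSym Θ) : Θ = theta :=
  IsThetaMorphism.unique iSup_grading (j := SymFn.inclHom) SymFn.incl_injective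
    (fun _ _ h => h) (fun _ => rfl) h isThetaSym_theta

end SymFn

/-! ### Products of letters in a shuffle algebra -/

namespace QSh

variable {A : Type}

/-- The shuffle product of a multiset of letters. -/
def letterProd (s : Multiset A) : QSh (LetterProduct.zero A) :=
  (s.map fun a => word (LetterProduct.zero A) [a]).prod

theorem letterProd_zero : letterProd (0 : Multiset A) = 1 := by simp [letterProd]

theorem letterProd_cons (a : A) (s : Multiset A) :
    letterProd (a ::ₘ s) = word _ [a] * letterProd s := by simp [letterProd]

variable [DecidableEq A]

/-- Removing a first letter `x`, a derivation of the shuffle algebra. -/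
def deriv (x : A) : QSh (LetterProduct.zero A) →ₗ[ℂ] QSh (LetterProduct.zero A) :=
  (basis _).constr ℂ fun w => match w with
    | [] => 0
    | y :: w => if y = x then word _ w else 0

theorem deriv_one (x : A) : deriv x 1 = 0 := by
  simp [one_def, deriv, word, Module.Basis.constr_basis]

theorem deriv_cons (x y : A) (f : QSh (LetterProduct.zero A)) :
    deriv x (cons y f) = if y = x then f else 0 := by
  induction f using QSh.induction with
  | hw u => rw [cons_word]; simp [deriv, word, Module.Basis.constr_basis]
  | hadd f g hf hg => simp only [map_add, hf, hg]; split_ifs <;> simp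
  | hsmul c f hf => simp only [map_smul, hf]; split_ifs <;> simp

theorem coeff_deriv (x : A) (f : QSh (LetterProduct.zero A)) (w : List A) :
    coeff w (deriv x f) = coeff (x :: w) f := by
  induction f using QSh.induction with
  | hw u =>
    cases u with
    | nil => rw [← one_def, deriv_one, one_def, coeff_word]; simp
    | cons y u =>
      rw [← cons_word, deriv_cons, cons_word, coeff_word]
      by_cases h : y = x
      · subst h; simp [coeff_word]
      · simp [h, Ne.symm h]
  | hadd f g hf hg => simp only [map_add, hf, hg]
  | hsmul c f hf => simp only [map_smul, hf]

theorem deriv_mul (x : A) (f g : QSh (LetterProduct.zero A)) :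
    deriv x (f * g) = deriv x f * g + f * deriv x g := by
  induction f using QSh.induction with
  | hw u =>
    induction g using QSh.induction with
    | hw v =>
      cases u with
      | nil => rw [← one_def]; simp [deriv_one]
      | cons y u =>
        cases v with
        | nil => rw [← one_def]; simp [deriv_one]
        | cons z v =>
          rw [← cons_word, ← cons_word, cons_shuffle_cons, map_add]
          simp only [deriv_cons]
          congr 1 <;> split_ifs <;> simp
    | hadd f g hf hg => simp only [mul_add, map_add, hf, hg]; abel
    | hsmul c f hf => simp only [mul_smul_comm, map_smul, hf, smul_add]
  | hadd f g hf hg => simp only [add_mul, map_add, hf, hg]; abel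
  | hsmul c f hf => simp only [smul_mul_assoc, map_smul, hf, smul_add]

theorem deriv_letterProd (a : A) (s : Multiset A) :
    deriv a (letterProd s) = (s.count a : ℂ) • letterProd (s.erase a) := by
  induction s using Multiset.induction with
  | empty => simp [letterProd_zero, deriv_one]
  | cons b s ih =>
    rw [letterProd_cons, deriv_mul, ih, ← cons_word, deriv_cons, ← one_def]
    by_cases h : b = a
    · subst h
      rw [if_pos rfl, one_mul, Multiset.erase_cons_head, Multiset.count_cons_self, Nat.cast_succ,
        add_smul, one_smul, add_comm, mul_smul_comm, one_def, cons_word, ← letterProd_cons]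
      congr 1
      by_cases hb : b ∈ s
      · rw [Multiset.cons_erase hb]
      · rw [Multiset.count_eq_zero_of_notMem hb]; simp
    · rw [if_neg h, zero_mul, zero_add, mul_smul_comm, one_def, cons_word, ← letterProd_cons,
        Multiset.count_cons_of_ne (Ne.symm h), Multiset.erase_cons_tail s h]

theorem coeff_cons_letterProd (a : A) (w : List A) (s : Multiset A) :
    coeff (a :: w) (letterProd s) = s.count a * coeff w (letterProd (s.erase a)) := by
  rw [← coeff_deriv, deriv_letterProd, map_smul, smul_eq_mul]

/-- Reading `w` letter by letter, each derivation removes a letter from s and multiplies by its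
multiplicity, which is non-zero in ℂ as long as the letter is still present. -/
theorem coeff_letterProd_ne_zero (w : List A) (s : Multiset A) :
    coeff w (letterProd s) ≠ 0 ↔ (w : Multiset A) = s := by
  induction w generalizing s with
  | nil =>
    induction s using Multiset.induction with
    | empty => rw [letterProd_zero, one_def, coeff_word]; simp
    | cons a s _ =>
      rw [letterProd_cons, coeff_nil_mul, coeff_word]
      simp
  | cons a w ih =>
    rw [coeff_cons_letterProd, mul_ne_zero_iff, ih, Nat.cast_ne_zero, Multiset.count_ne_zero,
      ← Multiset.cons_coe]
    constructor
    · rintro ⟨h, h'⟩; rw [h', Multiset.cons_erase h]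
    · rintro rfl; simp

theorem coeff_letterProd_perm {u v : List A} (h : u.Perm v) (s : Multiset A) :
    coeff u (letterProd s) = coeff v (letterProd s) := by
  induction h generalizing s with
  | nil => rfl
  | cons x _ ih => rw [coeff_cons_letterProd, coeff_cons_letterProd, ih]
  | swap x y w =>
    rw [coeff_cons_letterProd, coeff_cons_letterProd, coeff_cons_letterProd,
      coeff_cons_letterProd, Multiset.erase_comm]
    by_cases hxy : x = y
    · rw [hxy]
    · rw [Multiset.count_erase_of_ne hxy, Multiset.count_erase_of_ne (Ne.symm hxy)]
      ring
  | trans _ _ ih1 ih2 => rw [ih1, ih2]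

end QSh

/-! ### The symmetric algebra on the odd generators -/

theorem linearIndependent_of_dual {M ι : Type} [AddCommGroup M] [Module ℂ M] (v : ι → M)
    (f : ι → Module.Dual ℂ M) (hne : ∀ i, f i (v i) ≠ 0) (h : ∀ i j, i ≠ j → f i (v j) = 0) :
    LinearIndependent ℂ v :=
  LinearIndependent.of_pairwise_dual_eq_zero_one v (fun i => (f i (v i))⁻¹ • f i)
    (fun i j hij => by simp [h i j hij]) (fun i => by simp [hne i])

theorem finite_lists_of_sum (n : ℕ) :
    {w : List ℕ+ | (w.map fun a : ℕ+ => (a : ℕ)).sum = n}.Finite := by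
  refine (Set.finite_range fun c : Composition n => c.blocks.map Nat.toPNat').subset ?_
  intro w hw
  refine ⟨⟨w.map fun a : ℕ+ => (a : ℕ), ?_, hw⟩, ?_⟩
  · intro i hi
    obtain ⟨a, _, rfl⟩ := List.mem_map.1 hi
    exact a.pos
  · simp [List.map_map, Function.comp_def]

theorem finite_odd_lists_of_sum (n : ℕ) :
    {w : List OddPos | (w.map fun a => (a.1 : ℕ)).sum = n}.Finite := by
  refine Set.Finite.of_finite_image (f := List.map Subtype.val)
    ((finite_lists_of_sum n).subset ?_) (Subtype.val_injective.list_map.injOn)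
  rintro _ ⟨w, hw, rfl⟩
  simpa [List.map_map, Function.comp_def] using hw

theorem finite_odd_multisets_of_sum (n : ℕ) :
    {s : Multiset OddPos | (s.map fun a => (a.1 : ℕ)).sum = n}.Finite := by
  refine ((finite_odd_lists_of_sum n).image fun l : List OddPos => (l : Multiset OddPos)).subset
    fun s hs => ?_
  refine ⟨s.toList, ?_, Multiset.coe_toList s⟩
  change (s.toList.map fun a => (a.1 : ℕ)).sum = n
  rw [← Multiset.sum_coe, ← Multiset.map_coe, Multiset.coe_toList]
  exact hs

namespace SymOdd

/-- The monomial attached to a multiset of generators. -/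
def monomial (s : Multiset OddPos) : SymOdd := (s.map gen).prod

theorem monomial_cons (a : OddPos) (s : Multiset OddPos) :
    monomial (a ::ₘ s) = gen a * monomial s := by simp [monomial]

theorem adjoin_gen : Algebra.adjoin ℂ (Set.range gen) = ⊤ := by
  rw [eq_top_iff]
  rintro x -
  induction x using SymmetricAlgebra.induction with
  | algebraMap r => exact algebraMap_mem _ r
  | ι x =>
    induction x using Finsupp.induction_linear with
    | zero => rw [map_zero]; exact zero_mem _
    | add x y hx hy => rw [map_add]; exact add_mem hx hy
    | single a c =>
      rw [← mul_one c, ← smul_eq_mul, ← Finsupp.smul_single, map_smul]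
      exact Subalgebra.smul_mem _ (Algebra.subset_adjoin (Set.mem_range_self (f := gen) a)) c
  | mul x y hx hy => exact mul_mem hx hy
  | add x y hx hy => exact add_mem hx hy

theorem span_monomial : Submodule.span ℂ (Set.range monomial) = ⊤ := by
  rw [eq_top_iff]
  rintro x -
  have hx : x ∈ Algebra.adjoin ℂ (Set.range gen) := adjoin_gen ▸ Algebra.mem_top
  induction hx using Algebra.adjoin_induction with
  | mem x hx =>
    obtain ⟨a, rfl⟩ := hx
    exact Submodule.subset_span ⟨{a}, by simp [monomial]⟩
  | algebraMap r =>
    rw [Algebra.algebraMap_eq_smul_one]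
    exact Submodule.smul_mem _ _ (Submodule.subset_span ⟨0, by simp [monomial]⟩)
  | add x y _ _ hx hy => exact add_mem hx hy
  | mul x y _ _ hx hy =>
    have h := Submodule.mul_mem_mul hx hy
    rw [Submodule.span_mul_span] at h
    refine Submodule.span_mono ?_ h
    rintro _ ⟨_, ⟨s, rfl⟩, _, ⟨t, rfl⟩, rfl⟩
    exact ⟨s + t, by simp [monomial]⟩

theorem comul_letter (a : OddPos) : Coalgebra.comul (R := ℂ) (ShuffleOdd.word [a]) =
    ShuffleOdd.word [a] ⊗ₜ[ℂ] 1 + 1 ⊗ₜ[ℂ] ShuffleOdd.word [a] := by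
  rw [ShuffleOdd.word, QSh.comul_def, QSh.comulLin_word]
  simp [Finset.sum_range_succ, QSh.one_def, add_comm]

/-- The morphism into the shuffle algebra that sends `vᵢ` to the letter `vᵢ / i`. -/
def toShuffleOdd : SymOdd →ₐc[ℂ] ShuffleOdd :=
  BialgHom.ofAlgHom (SymmetricAlgebra.lift (Finsupp.linearCombination ℂ fun a : OddPos =>
      -- The factor 1/i is the one in p_i = M_(i) / i.
      (1 / (a.1 : ℂ)) • ShuffleOdd.word [a]))
    (by
      classical
      ext a
      have h : Coalgebra.counit (R := ℂ) (ShuffleOdd.word [a]) = 0 := by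
        rw [QSh.counit_def, ShuffleOdd.word, QSh.coeff_word]; simp
      simpa [h] using (SymmetricAlgebra.algebraMapInv_ι _).symm)
    (by
      ext a
      simp [comul_letter, smul_tmul'])

theorem toShuffleOdd_gen (a : OddPos) :
    toShuffleOdd (gen a) = (1 / (a.1 : ℂ)) • ShuffleOdd.word [a] := by
  change SymmetricAlgebra.lift _ (gen a) = _
  rw [gen, SymmetricAlgebra.lift_ι_apply]
  simp

theorem toShuffleOdd_monomial (s : Multiset OddPos) : ∃ c : ℂ, c ≠ 0 ∧
    toShuffleOdd (monomial s) = c • QSh.letterProd s := by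
  induction s using Multiset.induction with
  | empty => exact ⟨1, one_ne_zero, by simp [monomial, QSh.letterProd]⟩
  | cons a s ih =>
    obtain ⟨c, hc, h⟩ := ih
    have ha : (a.1 : ℂ) ≠ 0 := by exact_mod_cast a.1.ne_zero
    refine ⟨1 / (a.1 : ℂ) * c, mul_ne_zero (one_div_ne_zero ha) hc, ?_⟩
    rw [monomial_cons, map_mul, h, toShuffleOdd_gen, QSh.letterProd_cons, smul_mul_smul_comm]
    rfl

theorem coeff_toShuffleOdd_monomial (w : List OddPos) (s : Multiset OddPos) :
    QSh.coeff w (toShuffleOdd (monomial s)) ≠ 0 ↔ (w : Multiset OddPos) = s := by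
  obtain ⟨c, hc, h⟩ := toShuffleOdd_monomial s
  rw [h, map_smul, smul_eq_mul, mul_ne_zero_iff, QSh.coeff_letterProd_ne_zero]
  simp [hc]

theorem coeff_toShuffleOdd_perm {u v : List OddPos} (h : u.Perm v) (x : SymOdd) :
    QSh.coeff u (toShuffleOdd x) = QSh.coeff v (toShuffleOdd x) := by
  have key : QSh.coeff u ∘ₗ toShuffleOdd.toLinearMap = QSh.coeff v ∘ₗ toShuffleOdd.toLinearMap := by
    refine LinearMap.ext_on_range span_monomial fun s => ?_
    obtain ⟨c, _, hs⟩ := toShuffleOdd_monomial s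
    change QSh.coeff u (toShuffleOdd _) = QSh.coeff v (toShuffleOdd _)
    rw [hs, map_smul, map_smul, QSh.coeff_letterProd_perm h]
  exact LinearMap.congr_fun key x

/-- The coefficient of the monomial `s` in the shuffle algebra. -/
def coeffForm (s : Multiset OddPos) : Module.Dual ℂ SymOdd :=
  QSh.coeff s.toList ∘ₗ toShuffleOdd.toLinearMap

/-- Frees `coeffForm` from the ordering chosen by `toList`, so that words may be concatenated. -/
theorem coeffForm_coe (w : List OddPos) (x : SymOdd) :
    coeffForm (w : Multiset OddPos) x = QSh.coeff w (toShuffleOdd x) :=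
  coeff_toShuffleOdd_perm (Multiset.coe_eq_coe.1 (Multiset.coe_toList _)) x

theorem coeffForm_monomial (s t : Multiset OddPos) : coeffForm s (monomial t) ≠ 0 ↔ s = t := by
  change QSh.coeff s.toList (toShuffleOdd (monomial t)) ≠ 0 ↔ _
  rw [coeff_toShuffleOdd_monomial, Multiset.coe_toList]

/-- The basis of monomials. -/
def monomialBasis : Module.Basis (Multiset OddPos) ℂ SymOdd :=
  Module.Basis.mk (v := monomial) (linearIndependent_of_dual _ coeffForm
    (fun s => (coeffForm_monomial s s).2 rfl)
    (fun s t h => by by_contra h'; exact h ((coeffForm_monomial s t).1 h'))) span_monomial.ge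

theorem monomialBasis_apply (s : Multiset OddPos) : monomialBasis s = monomial s :=
  Module.Basis.mk_apply _ _ s

/-- Monomials go to non-zero multiples of shuffle products of letters, which are separated by their
coefficients at one arrangement each. -/
theorem toShuffleOdd_injective : Function.Injective toShuffleOdd := by
  have h : LinearIndependent ℂ (toShuffleOdd.toLinearMap ∘ monomialBasis) := by
    refine linearIndependent_of_dual _ (fun s => QSh.coeff s.toList) (fun s => ?_) (fun s t h => ?_)
    · rw [Function.comp_apply, monomialBasis_apply]
      exact (coeffForm_monomial s s).2 rfl
    · rw [Function.comp_apply, monomialBasis_apply]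
      by_contra h'
      exact h ((coeffForm_monomial s t).1 h')
  rw [injective_iff_map_eq_zero]
  intro x hx
  have h0 : Finsupp.linearCombination ℂ (toShuffleOdd.toLinearMap ∘ monomialBasis)
      (monomialBasis.repr x) = 0 := by
    rw [← Finsupp.apply_linearCombination, monomialBasis.linearCombination_repr]
    exact hx
  exact (LinearEquiv.map_eq_zero_iff _).1 (linearIndependent_iff.1 h _ h0)

/-- The pairing of monomials with coefficients of monomials. -/
def pairing : SymOdd →ₗ[ℂ] Module.Dual ℂ SymOdd := monomialBasis.constr ℂ coeffForm

theorem pairing_monomial (s : Multiset OddPos) : pairing (monomial s) = coeffForm s := by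
  rw [pairing, ← monomialBasis_apply, Module.Basis.constr_basis]

theorem pairing_gen (a : OddPos) (x : SymOdd) :
    pairing (gen a) x = QSh.coeff [a] (toShuffleOdd x) := by
  have : gen a = monomial (([a] : List OddPos) : Multiset OddPos) := by simp [monomial]
  rw [this, pairing_monomial, coeffForm_coe]

/-- Products of monomials correspond to concatenated words, and concatenation is dual to
deconcatenation. The other compatibility needs only the primitive generators. -/
theorem isHopfPairing : IsHopfPairing pairing := by
  have one : pairing 1 = Coalgebra.counit := by
    have : (1 : SymOdd) = monomial (([] : List OddPos) : Multiset OddPos) := by simp [monomial]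
    ext x
    rw [this, pairing_monomial, coeffForm_coe]
    exact toShuffleOdd.counit_apply x
  refine isHopfPairing_of_generators adjoin_gen one ?_ ?_ ?_
  · intro x y
    have hx : x ∈ Submodule.span ℂ (Set.range monomial) := span_monomial ▸ Submodule.mem_top
    have hy : y ∈ Submodule.span ℂ (Set.range monomial) := span_monomial ▸ Submodule.mem_top
    induction hx using Submodule.span_induction with
    | mem x hx =>
      obtain ⟨s, rfl⟩ := hx
      induction hy using Submodule.span_induction with
      | mem y hy =>
        obtain ⟨t, rfl⟩ := hy
        have hst : monomial s * monomial t =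
            monomial ((s.toList ++ t.toList : List OddPos) : Multiset OddPos) := by
          rw [← Multiset.coe_add, Multiset.coe_toList, Multiset.coe_toList]
          simp [monomial]
        refine LinearMap.ext fun z => ?_
        rw [hst, pairing_monomial, pairing_monomial, pairing_monomial, coeffForm_coe,
          QSh.coeff_append, toShuffleOdd.comul_apply,
          ← LinearMap.comp_apply (TensorProduct.map _ _),
          ← TensorProduct.map_comp]
        rfl
      | zero => simp
      | add x y _ _ hx hy =>
        rw [mul_add, map_add, hx, hy, map_add, TensorProduct.map_add_right, LinearMap.add_comp,
          LinearMap.comp_add]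
      | smul c x _ hx =>
        rw [mul_smul_comm, map_smul, hx, map_smul, TensorProduct.map_smul_right,
          LinearMap.smul_comp, LinearMap.comp_smul]
    | zero => simp
    | add x y _ _ hx hy =>
      rw [add_mul, map_add, hx, hy, map_add, TensorProduct.map_add_left, LinearMap.add_comp,
        LinearMap.comp_add]
    | smul c x _ hx =>
      rw [smul_mul_assoc, map_smul, hx, map_smul, TensorProduct.map_smul_left,
        LinearMap.smul_comp, LinearMap.comp_smul]
  · rintro _ ⟨a, rfl⟩
    classical
    rw [pairing_gen, map_one, QSh.one_def, QSh.coeff_word, gen, SymmetricAlgebra.counit_ι]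
    simp
  · rintro _ ⟨a, rfl⟩ h k
    have hε : ∀ x, pairing 1 x = QSh.coeff [] (toShuffleOdd x) := fun x => by
      rw [one]; exact (toShuffleOdd.counit_apply x).symm
    -- The one-letter coefficient is a derivation followed by the counit, which matches the
    -- coproduct of a primitive element.
    rw [pairing_gen, gen, SymmetricAlgebra.comul_ι, map_mul, ← QSh.coeff_deriv, QSh.deriv_mul,
      map_add, QSh.coeff_nil_mul, QSh.coeff_nil_mul, QSh.coeff_deriv, QSh.coeff_deriv]
    change _ = LinearMap.mul' ℂ ℂ (TensorProduct.map (pairing.flip h) (pairing.flip k)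
      (gen a ⊗ₜ 1 + 1 ⊗ₜ gen a))
    simp [pairing_gen, hε]

/-- The product of scaled power sums, as a symmetric function. -/
theorem toQSym_mem (x : SymOdd) : ShuffleOdd.toQSym.comp toShuffleOdd x ∈ SymFn.toSubalgebra := by
  have h : (⊤ : Subalgebra ℂ SymOdd) ≤ SymFn.toSubalgebra.comap
      ((ShuffleOdd.toQSym.comp toShuffleOdd : SymOdd →ₐc[ℂ] QSym) : SymOdd →ₐ[ℂ] QSym) := by
    rw [← adjoin_gen, Algebra.adjoin_le_iff]
    rintro _ ⟨a, rfl⟩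
    change ShuffleOdd.toQSym (toShuffleOdd (gen a)) ∈ SymFn.toSubalgebra
    rw [toShuffleOdd_gen, map_smul, ShuffleOdd.toQSym_word]
    refine Subalgebra.smul_mem _ ?_ _
    rw [List.map_cons, List.map_nil, QSym.S_singleton]
    exact QSym.isSymm_M_singleton _
  exact h (Algebra.mem_top (x := x))

/-- The morphism into the symmetric functions that sends `vᵢ` to `pᵢ`. -/
def toSymFn : SymOdd →ₐc[ℂ] SymFn :=
  SymFn.codRestrict (ShuffleOdd.toQSym.comp toShuffleOdd) toQSym_mem

theorem toSymFn_gen (a : OddPos) : (toSymFn (gen a) : QSym) = QSym.p a.1 := by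
  change ShuffleOdd.toQSym (toShuffleOdd (gen a)) = _
  rw [toShuffleOdd_gen, map_smul, ShuffleOdd.toQSym_word, List.map_cons, List.map_nil,
    QSym.S_singleton]
  rfl

theorem toSymFn_injective : Function.Injective toSymFn := fun _ _ h =>
  toShuffleOdd_injective (ShuffleOdd.toQSym_injective (congrArg Subtype.val h))

theorem toSymFn_gen_eq (a : OddPos) :
    toSymFn (gen a) = (1 / (a.1 : ℂ)) • SymFn.powerSum a.1 :=
  Subtype.ext (toSymFn_gen a)

/-- Both images are subalgebras, so they are compared on generators: theta doubles odd power sums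
and kills even ones. -/
theorem mem_schurQAlgebra_iff (y : SymFn) :
    y ∈ (schurQAlgebra SymFn.theta).toSubalgebra ↔ ∃ x, toSymFn x = y := by
  have ha : ∀ a : OddPos, (a.1 : ℂ) ≠ 0 := fun a => by exact_mod_cast a.1.ne_zero
  rw [Subbialgebra.mem_range]
  constructor
  · rintro ⟨f, rfl⟩
    have h : (⊤ : Subalgebra ℂ SymFn) ≤ (toSymFn : SymOdd →ₐ[ℂ] SymFn).range.comap
        (SymFn.theta : SymFn →ₐ[ℂ] SymFn) := by
      rw [← SymFn.adjoin_powerSum, Algebra.adjoin_le_iff]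
      rintro _ ⟨n, rfl⟩
      change SymFn.theta (SymFn.powerSum n) ∈ (toSymFn : SymOdd →ₐ[ℂ] SymFn).range
      rw [SymFn.theta_powerSum]
      split_ifs with hn
      -- The 2 is the eigenvalue of theta, and n undoes the scaling of p_n.
      · refine ⟨(2 * (n : ℂ)) • gen ⟨n, hn⟩, ?_⟩
        change toSymFn _ = _
        rw [map_smul, toSymFn_gen_eq, smul_smul]
        congr 1
        have := ha ⟨n, hn⟩
        field_simp
      · exact zero_mem _
    exact h (Algebra.mem_top (x := f))
  · rintro ⟨x, rfl⟩
    have h : (⊤ : Subalgebra ℂ SymOdd) ≤ (SymFn.theta : SymFn →ₐ[ℂ] SymFn).range.comap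
        (toSymFn : SymOdd →ₐ[ℂ] SymFn) := by
      rw [← adjoin_gen, Algebra.adjoin_le_iff]
      rintro _ ⟨a, rfl⟩
      refine ⟨(1 / 2 * (1 / (a.1 : ℂ))) • SymFn.powerSum a.1, ?_⟩
      change SymFn.theta _ = toSymFn (gen a)
      rw [map_smul, SymFn.theta_powerSum, if_pos a.2, toSymFn_gen_eq, smul_smul]
      congr 1
      field_simp
    exact h (Algebra.mem_top (x := x))

theorem toSymFn_monomial_mem_grading (s : Multiset OddPos) :
    (toSymFn (monomial s) : QSym) ∈ QSym.grading (s.map fun a => (a.1 : ℕ)).sum := by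
  induction s using Multiset.induction with
  | empty =>
    have : (toSymFn (monomial 0) : QSym) = 1 := by simp [monomial]
    rw [this, QSh.one_def]
    exact QSh.word_mem_grading _ []
  | cons a s ih =>
    rw [monomial_cons, map_mul, Multiset.map_cons, Multiset.sum_cons]
    refine QSym.mul_mem_grading ?_ ih
    rw [toSymFn_gen]
    refine Submodule.smul_mem _ _ ?_
    have := QSh.word_mem_grading (L := LetterProduct.add) (fun a : ℕ+ => (a : ℕ)) [a.1]
    rw [List.map_cons, List.map_nil, List.sum_singleton] at this
    exact this

/-- The symmetric algebra is isomorphic to the algebra of Schur `Q`-functions. -/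
theorem exists_equiv_schurQAlgebra : ∃ e : SymOdd ≃ₐc[ℂ] schurQAlgebra SymFn.theta,
    ∀ x, (schurQAlgebra SymFn.theta).incl (e x) = toSymFn x :=
  Subbialgebra.exists_equiv _ toSymFn toSymFn_injective mem_schurQAlgebra_iff

theorem isGradedEquiv_schurQAlgebra {e : SymOdd ≃ₐc[ℂ] schurQAlgebra SymFn.theta}
    (he : ∀ x, (schurQAlgebra SymFn.theta).incl (e x) = toSymFn x) :
    IsGradedEquiv SymOdd.grading (schurQGrading SymFn.theta) e := by
  have hspan : Submodule.span ℂ (Set.range fun l : List OddPos => (l.map gen).prod) = ⊤ := by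
    rw [eq_top_iff, ← span_monomial]
    refine Submodule.span_mono ?_
    rintro _ ⟨s, rfl⟩
    refine ⟨s.toList, ?_⟩
    change (s.toList.map gen).prod = (s.map gen).prod
    conv_rhs => rw [← Multiset.coe_toList s, Multiset.map_coe, Multiset.prod_coe]
  refine Subbialgebra.isGradedEquiv hspan (fun n => rfl) SymFn.iSupIndep_grading e fun l => ?_
  rw [he]
  have := toSymFn_monomial_mem_grading (l : Multiset OddPos)
  rw [Multiset.map_coe, Multiset.sum_coe, monomial, Multiset.map_coe, Multiset.prod_coe] at this
  exact this

theorem exists_graded_equiv_schurQAlgebra : ∃ e : SymOdd ≃ₐc[ℂ] schurQAlgebra SymFn.theta,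
    IsGradedEquiv SymOdd.grading (schurQGrading SymFn.theta) e ∧
    ∀ a : OddPos,
      SymFn.incl ((schurQAlgebra SymFn.theta).incl (e (SymOdd.gen a))) = QSym.p a.1 := by
  obtain ⟨e, he⟩ := exists_equiv_schurQAlgebra
  exact ⟨e, isGradedEquiv_schurQAlgebra he, fun a => by rw [he]; exact toSymFn_gen a⟩

/-- The pairing on the symmetric algebra is carried over to Ω. There the monomials are orthogonal
with non-zero squares, so they serve as both of the dual families. -/
theorem schurQAlgebra_selfDual :
    ∃ e : schurQAlgebra SymFn.theta ≃ₗ[ℂ] gradedDual (schurQGrading SymFn.theta),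
      IsHopfIsoGradedDual (schurQGrading SymFn.theta) (schurQGrading SymFn.theta) e := by
  obtain ⟨e, he⟩ := exists_equiv_schurQAlgebra
  let f : schurQAlgebra SymFn.theta →ₐc[ℂ] SymOdd :=
    (e.symm : schurQAlgebra SymFn.theta →ₐc[ℂ] SymOdd)
  have hf : ∀ x, f (e x) = x := e.symm_apply_apply
  have hspan : Submodule.span ℂ (Set.range fun s => e (monomial s)) = ⊤ := by
    rw [eq_top_iff]
    rintro y -
    have h1 : f y ∈ Submodule.span ℂ (Set.range monomial) := span_monomial ▸ Submodule.mem_top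
    have h2 := Submodule.mem_map_of_mem
      (f := (e : SymOdd →ₐc[ℂ] schurQAlgebra SymFn.theta).toLinearMap) h1
    rw [Submodule.map_span, ← Set.range_comp] at h2
    have h3 : e (f y) = y := e.apply_symm_apply y
    rw [← h3]
    exact h2
  have hgr : ∀ n, schurQGrading SymFn.theta n = spanDegree (fun s => e (monomial s))
      (fun s : Multiset OddPos => (s.map fun a => (a.1 : ℕ)).sum) n := by
    intro n
    ext y
    rw [mem_spanDegree_iff hspan (ℬ := SymFn.grading) SymFn.iSupIndep_grading
      (f := (schurQAlgebra SymFn.theta).incl) (Subbialgebra.incl_injective _) (fun s => ?_)]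
    · rfl
    · rw [he]
      exact toSymFn_monomial_mem_grading s
  refine (isHopfPairing.comp f f).exists_equiv_gradedDual
    (C := fun s => e (monomial s)) (B := fun s => e (monomial s))
    finite_odd_multisets_of_sum hspan hspan (fun s => ?_) (fun s t hst => ?_) hgr hgr
  · change pairing (f (e _)) (f (e _)) ≠ 0
    rw [hf, pairing_monomial, coeffForm_monomial]
  · change pairing (f (e _)) (f (e _)) = 0
    rw [hf, hf, pairing_monomial]
    by_contra h
    exact hst ((coeffForm_monomial s t).1 h)

end SymOdd

/-! ### Noncommutative symmetric functions -/

theorem QSh.coeff_eq_zero_of_mem_grading {A : Type} {L : LetterProduct A} {deg : A → ℕ} {n : ℕ}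
    {f : QSh L} (hf : f ∈ grading L deg n) {w : List A} (hw : (w.map deg).sum ≠ n) :
    coeff w f = 0 := by
  classical
  induction hf using Submodule.span_induction with
  | mem f hf =>
    obtain ⟨u, rfl, rfl⟩ := hf
    rw [coeff_word, if_neg]
    rintro rfl
    exact hw rfl
  | zero => exact map_zero _
  | add f g _ _ hf hg => rw [map_add, hf, hg, add_zero]
  | smul c f _ hf => rw [map_smul, hf, smul_zero]

theorem QSym.span_S : Submodule.span ℂ (Set.range S) = ⊤ := by
  rw [eq_top_iff]
  rintro f -
  have h1 : ShufflePos.equivQSym.symm f ∈ Submodule.span ℂ (Set.range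
      (QSh.word (LetterProduct.zero ℕ+))) := QSh.span_word ▸ Submodule.mem_top
  have h2 := Submodule.mem_map_of_mem (f := ShufflePos.toQSymLin) h1
  rw [Submodule.map_span, ← Set.range_comp] at h2
  have h3 : ShufflePos.toQSymLin (ShufflePos.equivQSym.symm f) = f :=
    BialgEquiv.apply_symm_apply ShufflePos.equivQSym f
  have h4 : ShufflePos.toQSymLin ∘ QSh.word (LetterProduct.zero ℕ+) = S :=
    funext ShufflePos.toQSymLin_word
  rwa [h3, h4] at h2

namespace NSym

/-- The product `H_{α₁} ⋯ H_{αₗ}`. -/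
def monomial (α : List ℕ+) : NSym := (α.map fun a : ℕ+ => H a).prod

theorem basisFreeMonoid_apply (α : List ℕ+) :
    FreeAlgebra.basisFreeMonoid ℂ ℕ+ (FreeMonoid.ofList α) = monomial α := by
  change MonoidAlgebra.lift ℂ (FreeAlgebra ℂ ℕ+) (FreeMonoid ℕ+)
    (FreeMonoid.lift (FreeAlgebra.ι ℂ)) (MonoidAlgebra.single (FreeMonoid.ofList α) 1) = _
  rw [MonoidAlgebra.lift_single, one_smul, FreeMonoid.lift_apply, FreeMonoid.toList_ofList,
    monomial]
  simp only [H_pnat]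

/-- The basis of the products `H_α`. -/
def basis : Module.Basis (List ℕ+) ℂ NSym :=
  (FreeAlgebra.basisFreeMonoid ℂ ℕ+).reindex FreeMonoid.toList

theorem basis_apply (α : List ℕ+) : basis α = monomial α := by
  rw [basis, Module.Basis.reindex_apply]
  exact basisFreeMonoid_apply α

theorem span_monomial : Submodule.span ℂ (Set.range monomial) = ⊤ := by
  rw [← funext basis_apply]
  exact basis.span_eq

theorem pairing_monomial (α : List ℕ+) : pairing (monomial α) = QSh.coeff α := by
  rw [← basisFreeMonoid_apply, pairing, Module.Basis.constr_basis, FreeMonoid.toList_ofList]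

theorem monomial_mem_grading (α : List ℕ+) :
    monomial α ∈ grading (α.map fun a : ℕ+ => (a : ℕ)).sum :=
  mem_spanDegree monomial (fun α => (α.map fun a : ℕ+ => (a : ℕ)).sum) α

theorem iSupIndep_grading : iSupIndep grading := by
  have h := iSupIndep_spanDegree basis (fun α => (α.map fun a : ℕ+ => (a : ℕ)).sum)
  rwa [funext basis_apply] at h

theorem pairing_M (x : NSym) (α : List ℕ+) : pairing x (QSym.M α) = basis.repr x α := by
  classical
  have h : pairing.flip (QSym.M α) = basis.coord α := by
    refine basis.ext fun β => ?_
    rw [LinearMap.flip_apply, basis_apply, pairing_monomial, QSh.coeff_word, ← basis_apply,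
      Module.Basis.coord_apply, Module.Basis.repr_self, Finsupp.single_apply]
  exact LinearMap.congr_fun h x

theorem ext_pairing {x y : NSym} (h : ∀ f, pairing x f = pairing y f) : x = y :=
  basis.ext_elem fun α => by rw [← pairing_M, ← pairing_M, h]

theorem ext_pairing_S {x y : NSym} (h : ∀ α, pairing x (QSym.S α) = pairing y (QSym.S α)) :
    x = y :=
  ext_pairing (LinearMap.congr_fun (LinearMap.ext_on_range QSym.span_S h))

/-- Non-degeneracy on the tensor square; coproducts in `NSym` can then be compared through products
in `QSym`. -/
theorem ext_pairing_tensor {s t : NSym ⊗[ℂ] NSym} (h : ∀ f g,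
    LinearMap.mul' ℂ ℂ (TensorProduct.map (pairing.flip f) (pairing.flip g) s) =
      LinearMap.mul' ℂ ℂ (TensorProduct.map (pairing.flip f) (pairing.flip g) t)) : s = t := by
  refine (basis.tensorProduct basis).ext_elem fun ⟨α, β⟩ => ?_
  have key : ∀ s, (basis.tensorProduct basis).repr s (α, β) = LinearMap.mul' ℂ ℂ
      (TensorProduct.map (pairing.flip (QSym.M α)) (pairing.flip (QSym.M β)) s) := by
    intro s
    induction s using TensorProduct.induction_on with
    | zero => simp
    | add a b ha hb => simp only [map_add, Finsupp.add_apply, ha, hb]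
    | tmul x y =>
      rw [Module.Basis.tensorProduct_repr_tmul_apply, TensorProduct.map_tmul,
        LinearMap.mul'_apply, LinearMap.flip_apply, LinearMap.flip_apply, pairing_M, pairing_M]
      exact mul_comm _ _
  rw [key, key, h]

theorem monomial_singleton (n : ℕ+) : monomial [n] = H n := by simp [monomial]

theorem pairing_H (n : ℕ+) : pairing (H n) = QSh.coeff [n] := by
  rw [← monomial_singleton, pairing_monomial]

theorem pairing_one : pairing 1 = QSh.coeff [] := pairing_monomial []

/-- Reconciles the coproduct of H_n, indexed by pairs of naturals, with the product rule
`QSym.strip_mul`, whose merging terms are indexed by pairs of positive integers; the two boundary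
terms come from H_0 = 1. -/
theorem sum_antidiagonal_pnat (n : ℕ+) (F : ℕ × ℕ → ℂ) :
    ∑ p ∈ Finset.HasAntidiagonal.antidiagonal (n : ℕ), F p =
      F (n, 0) + F (0, n) + ∑ p ∈ QSym.splits n, F ((p.1 : ℕ), (p.2 : ℕ)) := by
  classical
  have h : Finset.HasAntidiagonal.antidiagonal (n : ℕ) = insert ((n : ℕ), 0) (insert (0, (n : ℕ))
      ((QSym.splits n).image fun p => ((p.1 : ℕ), (p.2 : ℕ)))) := by
    ext ⟨i, j⟩
    simp only [Finset.HasAntidiagonal.mem_antidiagonal, Finset.mem_insert, Finset.mem_image,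
      QSym.mem_splits, Prod.mk.injEq, Prod.exists]
    constructor
    · intro hij
      rcases Nat.eq_zero_or_pos i with rfl | hi
      · right; left; simpa using hij
      · rcases Nat.eq_zero_or_pos j with rfl | hj
        · left; simpa using hij
        · exact Or.inr (Or.inr ⟨⟨i, hi⟩, ⟨j, hj⟩, PNat.coe_injective hij, rfl, rfl⟩)
    · rintro (⟨rfl, rfl⟩ | ⟨rfl, rfl⟩ | ⟨a, b, hab, rfl, rfl⟩)
      · simp
      · simp
      · rw [← hab, PNat.add_coe]
  have hn := n.ne_zero
  rw [h, Finset.sum_insert, Finset.sum_insert, Finset.sum_image, add_assoc]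
  · rintro ⟨a, b⟩ _ ⟨c, d⟩ _ h
    simpa using h
  · simp
  · simp [hn]

theorem adjoin_H : Algebra.adjoin ℂ (Set.range fun n : ℕ+ => H n) = ⊤ := by
  rw [funext H_pnat]
  exact FreeAlgebra.adjoin_range_ι ℂ ℕ+

/-- Concatenation of compositions is dual to deconcatenation. On H_n the remaining rule is the
formula for the one-letter coefficient of a quasi-shuffle product. -/
theorem isHopfPairing : IsHopfPairing pairing := by
  refine isHopfPairing_of_generators adjoin_H pairing_one ?_ ?_ ?_
  · intro x y
    have hx : x ∈ Submodule.span ℂ (Set.range monomial) := span_monomial ▸ Submodule.mem_top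
    have hy : y ∈ Submodule.span ℂ (Set.range monomial) := span_monomial ▸ Submodule.mem_top
    induction hx using Submodule.span_induction with
    | mem x hx =>
      obtain ⟨α, rfl⟩ := hx
      induction hy using Submodule.span_induction with
      | mem y hy =>
        obtain ⟨β, rfl⟩ := hy
        have h : monomial α * monomial β = monomial (α ++ β) := by simp [monomial]
        refine LinearMap.ext fun z => ?_
        rw [h, pairing_monomial, pairing_monomial, pairing_monomial, QSh.coeff_append]
        rfl
      | zero => simp
      | add x y _ _ hx hy =>
        rw [mul_add, map_add, hx, hy, map_add, TensorProduct.map_add_right, LinearMap.add_comp,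
          LinearMap.comp_add]
      | smul c x _ hx =>
        rw [mul_smul_comm, map_smul, hx, map_smul, TensorProduct.map_smul_right,
          LinearMap.smul_comp, LinearMap.comp_smul]
    | zero => simp
    | add x y _ _ hx hy =>
      rw [add_mul, map_add, hx, hy, map_add, TensorProduct.map_add_left, LinearMap.add_comp,
        LinearMap.comp_add]
    | smul c x _ hx =>
      rw [smul_mul_assoc, map_smul, hx, map_smul, TensorProduct.map_smul_left,
        LinearMap.smul_comp, LinearMap.comp_smul]
  · rintro _ ⟨n, rfl⟩
    classical
    have h : Coalgebra.counit (R := ℂ) (H n) = 0 := (counitAlg_H n).trans (if_neg n.ne_zero)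
    rw [h, pairing_H, QSh.one_def, QSh.coeff_word]
    simp
  · rintro _ ⟨n, rfl⟩ f g
    have h : Coalgebra.comul (R := ℂ) (H n) =
        ∑ p ∈ Finset.HasAntidiagonal.antidiagonal (n : ℕ), H p.1 ⊗ₜ[ℂ] H p.2 := comulAlg_H n
    rw [h, pairing_H, ← QSym.coeff_strip, QSym.strip_mul, map_sum, map_sum, sum_antidiagonal_pnat]
    simp [H_zero, pairing_one, pairing_H, QSh.coeff_nil_mul, QSym.coeff_strip]

/-! ### The dual shuffle basis -/

/-- The basis dual to the shuffle basis. -/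
def dualShuffle (α : List ℕ+) : NSym :=
  ∑ β ∈ (finite_lists_of_sum (α.map fun a : ℕ+ => (a : ℕ)).sum).toFinset,
    QSh.coeff α (ShufflePos.equivQSym.symm (QSym.M β)) • monomial β

theorem pairing_dualShuffle (α : List ℕ+) (f : ShufflePos) :
    pairing (dualShuffle α) (ShufflePos.equivQSym f) = QSh.coeff α f := by
  classical
  -- The finite sum in `dualShuffle` loses nothing: `equivQSym` preserves degree, so compositions of
  -- another degree have coefficient zero.
  have h : pairing (dualShuffle α) =
      QSh.coeff α ∘ₗ
        ((ShufflePos.equivQSym.symm : QSym →ₐc[ℂ] ShufflePos) : QSym →ₗ[ℂ] ShufflePos) := by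
    refine QSh.lin_ext fun β => ?_
    change _ = QSh.coeff α (ShufflePos.equivQSym.symm (QSym.M β))
    rw [dualShuffle, map_sum, LinearMap.sum_apply]
    simp only [map_smul, LinearMap.smul_apply, pairing_monomial, QSh.coeff_word, smul_eq_mul,
      mul_ite, mul_one, mul_zero]
    rw [Finset.sum_ite_eq']
    split_ifs with hβ
    · rfl
    · have hmem : ShufflePos.equivQSym.symm (QSym.M β) ∈
          ShufflePos.grading (β.map fun a : ℕ+ => (a : ℕ)).sum := by
        rw [← ShufflePos.equivQSym_mem_grading_iff, BialgEquiv.apply_symm_apply]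
        exact QSh.word_mem_grading _ β
      refine (QSh.coeff_eq_zero_of_mem_grading hmem fun h => hβ ?_).symm
      exact (Set.Finite.mem_toFinset _).2 h.symm
  rw [h]
  change QSh.coeff α (ShufflePos.equivQSym.symm (ShufflePos.equivQSym f)) = _
  rw [BialgEquiv.symm_apply_apply]

theorem isDualShuffleBasis_dualShuffle : IsDualShuffleBasis dualShuffle := by
  intro α β
  rw [← ShufflePos.equivQSym_word, pairing_dualShuffle, QSh.coeff_word]

theorem isDualShuffleBasis_unique {b : List ℕ+ → NSym} (hb : IsDualShuffleBasis b) :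
    b = dualShuffle :=
  funext fun α => ext_pairing_S fun β => by rw [hb, isDualShuffleBasis_dualShuffle]

theorem dualShuffle_mem_grading (α : List ℕ+) :
    dualShuffle α ∈ grading (α.map fun a : ℕ+ => (a : ℕ)).sum := by
  refine Submodule.sum_mem _ fun β hβ => Submodule.smul_mem _ _ ?_
  have hβ' := (Set.Finite.mem_toFinset _).1 hβ
  have h : (β.map fun a : ℕ+ => (a : ℕ)).sum = (α.map fun a : ℕ+ => (a : ℕ)).sum := hβ'
  rw [← h]
  exact monomial_mem_grading β

theorem span_dualShuffle : Submodule.span ℂ (Set.range dualShuffle) = ⊤ := by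
  rw [eq_top_iff, ← span_monomial, Submodule.span_le]
  rintro _ ⟨α, rfl⟩
  -- Expansion in the dual family; homogeneity of the S_β restricts it to the finitely many
  -- compositions of the same degree.
  have h : monomial α = ∑ β ∈ (finite_lists_of_sum (α.map fun a : ℕ+ => (a : ℕ)).sum).toFinset,
      pairing (monomial α) (QSym.S β) • dualShuffle β := by
    refine ext_pairing_S fun γ => ?_
    rw [map_sum, LinearMap.sum_apply]
    simp only [map_smul, LinearMap.smul_apply, isDualShuffleBasis_dualShuffle _ γ, smul_eq_mul,
      mul_ite, mul_one, mul_zero]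
    rw [Finset.sum_ite_eq']
    split_ifs with hγ
    · rfl
    · rw [pairing_monomial]
      refine QSh.coeff_eq_zero_of_mem_grading (QSym.S_mem_grading γ) fun h => hγ ?_
      exact (Set.Finite.mem_toFinset _).2 h.symm
  rw [h]
  exact Submodule.sum_mem _ fun β _ => Submodule.smul_mem _ _ (Submodule.subset_span ⟨β, rfl⟩)

/-- `dualShuffle` as a basis. -/
def dualShuffleBasis : Module.Basis (List ℕ+) ℂ NSym :=
  Module.Basis.mk (v := dualShuffle) (linearIndependent_of_dual _
    (fun β => pairing.flip (QSym.S β))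
    (fun β => by
      rw [LinearMap.flip_apply, isDualShuffleBasis_dualShuffle, if_pos rfl]
      exact one_ne_zero)
    (fun β α h => by
      rw [LinearMap.flip_apply, isDualShuffleBasis_dualShuffle, if_neg (Ne.symm h)]))
    span_dualShuffle.ge

theorem dualShuffleBasis_apply (α : List ℕ+) : dualShuffleBasis α = dualShuffle α :=
  Module.Basis.mk_apply _ _ α

/-! ### The theta map of `NSym` -/

open Classical in
/-- The theta map of `NSym`, as a linear map. -/
def thetaLin : NSym →ₗ[ℂ] NSym := dualShuffleBasis.constr ℂ fun α =>
  if ∀ a ∈ α, Odd (a : ℕ) then (2 : ℂ) ^ α.length • dualShuffle α else 0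

open Classical in
theorem thetaLin_dualShuffle (α : List ℕ+) : thetaLin (dualShuffle α) =
    if ∀ a ∈ α, Odd (a : ℕ) then (2 : ℂ) ^ α.length • dualShuffle α else 0 := by
  rw [← dualShuffleBasis_apply, thetaLin, Module.Basis.constr_basis, dualShuffleBasis_apply]

/-- The theta maps of `NSym` and `QSym` are adjoint. -/
theorem pairing_thetaLin (x : NSym) (f : QSym) :
    pairing (thetaLin x) f = pairing x (QSym.theta f) := by
  classical
  have h : pairing ∘ₗ thetaLin = pairing.compl₂ (QSym.theta : QSym →ₗ[ℂ] QSym) := by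
    refine dualShuffleBasis.ext fun α => LinearMap.ext_on_range QSym.span_S fun β => ?_
    change pairing (thetaLin (dualShuffleBasis α)) (QSym.S β) =
      pairing (dualShuffleBasis α) (QSym.theta (QSym.S β))
    rw [dualShuffleBasis_apply, thetaLin_dualShuffle, QSym.theta_S]
    -- Both maps are diagonal in dual bases with the same eigenvalues.
    by_cases hαβ : α = β
    · subst hαβ; split_ifs <;> simp
    · have h0 : pairing (dualShuffle α) (QSym.S β) = 0 := by
        rw [isDualShuffleBasis_dualShuffle, if_neg hαβ]
      split_ifs <;> simp [h0]
  exact LinearMap.congr_fun (LinearMap.congr_fun h x) f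

/-- The theta map of `NSym`. -/
def theta : NSym →ₐc[ℂ] NSym :=
  bialgHomOfLinearMap thetaLin
    (ext_pairing fun f => by
      rw [pairing_thetaLin, isHopfPairing.map_one]; exact QSym.theta.counit_apply f)
    -- Multiplicativity is the transpose of the compatibility of the theta map of `QSym` with
    -- coproducts.
    (fun x y => ext_pairing fun f => by
      rw [pairing_thetaLin, isHopfPairing.map_mul, isHopfPairing.map_mul, LinearMap.comp_apply,
        LinearMap.comp_apply, LinearMap.comp_apply, LinearMap.comp_apply,
        QSym.theta.comul_apply, ← LinearMap.comp_apply (TensorProduct.map _ _),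
        ← TensorProduct.map_comp]
      have h : ∀ x, pairing x ∘ₗ QSym.theta.toLinearMap = pairing (thetaLin x) :=
        fun x => LinearMap.ext fun f => (pairing_thetaLin x f).symm
      exact congrArg₂ (fun l l' => LinearMap.mul' ℂ ℂ (TensorProduct.map l l' (Coalgebra.comul f)))
        (h x) (h y))
    (fun x => by
      rw [← isHopfPairing.map_counit, ← isHopfPairing.map_counit, pairing_thetaLin, map_one])
    -- Dually, compatibility with coproducts is the transpose of multiplicativity.
    (fun x => ext_pairing_tensor fun f g => by
      rw [← isHopfPairing.map_comul, pairing_thetaLin, map_mul, isHopfPairing.map_comul,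
        ← LinearMap.comp_apply (TensorProduct.map _ _) (TensorProduct.map thetaLin thetaLin),
        ← TensorProduct.map_comp]
      have h : ∀ f, pairing.flip (QSym.theta f) = pairing.flip f ∘ₗ thetaLin :=
        fun f => LinearMap.ext fun x => (pairing_thetaLin x f).symm
      rw [h, h])

theorem isThetaNSym_theta : IsThetaNSym dualShuffle theta := by
  classical
  intro α
  rw [← thetaLin_dualShuffle]
  rfl

theorem isThetaNSym_unique {Θ : NSym →ₐc[ℂ] NSym} (h : IsThetaNSym dualShuffle Θ) : Θ = theta := by
  have key : Θ.toLinearMap = theta.toLinearMap :=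
    LinearMap.ext_on_range span_dualShuffle fun α => (h α).trans (isThetaNSym_theta α).symm
  exact BialgHom.ext fun x => LinearMap.congr_fun key x

theorem dualShuffle_mem_range (α : List OddPos) :
    dualShuffle (α.map Subtype.val) ∈ (Subbialgebra.range theta).toSubalgebra := by
  classical
  refine ⟨((2 : ℂ) ^ α.length)⁻¹ • dualShuffle (α.map Subtype.val), ?_⟩
  change theta _ = _
  rw [map_smul, isThetaNSym_theta, if_pos, List.length_map, smul_smul,
    inv_mul_cancel₀ (pow_ne_zero _ two_ne_zero), one_smul]
  intro a ha
  obtain ⟨b, _, rfl⟩ := List.mem_map.1 ha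
  exact b.2

/-- The members of the dual shuffle basis in the image of the theta map. -/
def oddDualShuffle (α : List OddPos) : Subbialgebra.range theta :=
  ⟨dualShuffle (α.map Subtype.val), dualShuffle_mem_range α⟩

theorem span_oddDualShuffle : Submodule.span ℂ (Set.range oddDualShuffle) = ⊤ := by
  classical
  rw [eq_top_iff]
  rintro ⟨_, x, rfl⟩ -
  have h : (⊤ : Submodule ℂ NSym) ≤ (Submodule.span ℂ (Set.range oddDualShuffle)).comap
      ((Subbialgebra.range theta).codRestrict theta fun x => ⟨x, rfl⟩).toLinearMap := by
    rw [← span_dualShuffle, Submodule.span_le]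
    rintro _ ⟨α, rfl⟩
    rw [SetLike.mem_coe, Submodule.mem_comap]
    by_cases hα : ∀ a ∈ α, Odd (a : ℕ)
    · have : ((Subbialgebra.range theta).codRestrict theta fun x => ⟨x, rfl⟩).toLinearMap
          (dualShuffle α) =
          (2 : ℂ) ^ α.length • oddDualShuffle (α.pmap Subtype.mk hα) := by
        refine Subtype.ext ((isThetaNSym_theta α).trans ?_)
        rw [if_pos hα]
        change _ = _ • dualShuffle ((α.pmap Subtype.mk hα).map Subtype.val)
        rw [List.map_pmap]
        simp
      rw [this]
      exact Submodule.smul_mem _ _ (Submodule.subset_span ⟨_, rfl⟩)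
    · have : ((Subbialgebra.range theta).codRestrict theta fun x => ⟨x, rfl⟩).toLinearMap
          (dualShuffle α) = 0 :=
        Subtype.ext ((isThetaNSym_theta α).trans (if_neg hα))
      rw [this]
      exact zero_mem _
  exact h (Submodule.mem_top (x := x))

/-- The pairing of `NSym` with `QSym` restricts along both inclusions to a Hopf pairing of the image
with Π. The odd dual shuffle elements and the odd S_α span the two sides and are dual to each other.
-/
theorem range_theta_dual : ∃ e : Subbialgebra.range theta ≃ₗ[ℂ] gradedDual (peakGrading QSym.theta),
    IsHopfIsoGradedDual (imageGrading theta) (peakGrading QSym.theta) e := by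
  obtain ⟨e, _, he⟩ := ShuffleOdd.exists_equiv_peakAlgebra
  have hdeg : ∀ α : List OddPos, ((α.map Subtype.val).map fun a : ℕ+ => (a : ℕ)).sum =
      (α.map fun a => (a.1 : ℕ)).sum := fun α => by rw [List.map_map]; rfl
  have hspan : Submodule.span ℂ (Set.range fun α => e (ShuffleOdd.word α)) = ⊤ := by
    rw [eq_top_iff]
    rintro y -
    have h1 : e.symm y ∈ Submodule.span ℂ (Set.range ShuffleOdd.word) :=
      (QSh.span_word (L := LetterProduct.zero OddPos)) ▸ Submodule.mem_top
    have h2 := Submodule.mem_map_of_mem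
      (f := (e : ShuffleOdd →ₐc[ℂ] peakAlgebra QSym.theta).toLinearMap) h1
    rw [Submodule.map_span, ← Set.range_comp] at h2
    have h3 : e (e.symm y) = y := e.apply_symm_apply y
    rw [← h3]
    exact h2
  refine (isHopfPairing.comp (Subbialgebra.range theta).inclHom
    (peakAlgebra QSym.theta).inclHom).exists_equiv_gradedDual (C := oddDualShuffle)
    (B := fun α => e (ShuffleOdd.word α)) finite_odd_lists_of_sum span_oddDualShuffle hspan
    (fun α => ?_) (fun α β hαβ => ?_) (fun n => ?_) (fun n => ?_)
  · change pairing (dualShuffle (α.map Subtype.val))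
      ((peakAlgebra QSym.theta).incl (e (ShuffleOdd.word α))) ≠ 0
    rw [he, isDualShuffleBasis_dualShuffle, if_pos rfl]
    exact one_ne_zero
  · change pairing (dualShuffle (α.map Subtype.val))
      ((peakAlgebra QSym.theta).incl (e (ShuffleOdd.word β))) = 0
    rw [he, isDualShuffleBasis_dualShuffle, if_neg]
    exact fun h => hαβ (Subtype.val_injective.list_map h)
  · ext x
    rw [mem_spanDegree_iff span_oddDualShuffle (ℬ := grading) iSupIndep_grading
      (f := (Subbialgebra.range theta).incl) (Subbialgebra.incl_injective _) (fun α => ?_)]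
    · rfl
    · rw [← hdeg]
      exact dualShuffle_mem_grading _
  · ext x
    rw [mem_spanDegree_iff hspan (ℬ := QSym.grading) (QSh.iSupIndep_grading _)
      (f := (peakAlgebra QSym.theta).incl) (Subbialgebra.incl_injective _) (fun α => ?_)]
    · rfl
    · rw [← hdeg, he]
      exact QSym.S_mem_grading _

end NSym

end

/-! ### The main theorem -/

theorem mainTheorem11 :
    (∃! Θ : QSym →ₐc[ℂ] QSym, IsThetaQSym Θ) ∧
    (∃! Θ : SymFn →ₐc[ℂ] SymFn, IsThetaSym Θ) ∧
    (∃! b : List ℕ+ → NSym, NSym.IsDualShuffleBasis b) ∧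
    (∀ b, NSym.IsDualShuffleBasis b → ∃! Θ : NSym →ₐc[ℂ] NSym, NSym.IsThetaNSym b Θ) ∧
    ∀ (ΘQ : QSym →ₐc[ℂ] QSym) (ΘS : SymFn →ₐc[ℂ] SymFn) (b : List ℕ+ → NSym)
      (ΘN : NSym →ₐc[ℂ] NSym),
      IsThetaQSym ΘQ → IsThetaSym ΘS → NSym.IsDualShuffleBasis b → NSym.IsThetaNSym b ΘN →
      -- the peak algebra is the shuffle algebra on the odd letters
      (∃ e : ShuffleOdd ≃ₐc[ℂ] peakAlgebra ΘQ,
        IsGradedEquiv ShuffleOdd.grading (peakGrading ΘQ) e ∧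
        ∀ α : List OddPos,
          (peakAlgebra ΘQ).incl (e (ShuffleOdd.word α)) = QSym.S (α.map Subtype.val)) ∧
      -- the algebra of Schur Q-functions is the symmetric algebra on the odd generators
      (∃ e : SymOdd ≃ₐc[ℂ] schurQAlgebra ΘS,
        IsGradedEquiv SymOdd.grading (schurQGrading ΘS) e ∧
        ∀ a : OddPos,
          SymFn.incl ((schurQAlgebra ΘS).incl (e (SymOdd.gen a))) = QSym.p a.1) ∧
      -- the algebra of Schur Q-functions is self-dual
      (∃ e : schurQAlgebra ΘS ≃ₗ[ℂ] gradedDual (schurQGrading ΘS),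
        IsHopfIsoGradedDual (schurQGrading ΘS) (schurQGrading ΘS) e) ∧
      -- the image of the theta map of NSym is the graded dual of the peak algebra
      (∃ e : Subbialgebra.range ΘN ≃ₗ[ℂ] gradedDual (peakGrading ΘQ),
        IsHopfIsoGradedDual (imageGrading ΘN) (peakGrading ΘQ) e) := by
  refine ⟨⟨QSym.theta, QSym.isThetaQSym_theta, fun _ h => QSym.isThetaQSym_unique h⟩,
    ⟨SymFn.theta, SymFn.isThetaSym_theta, fun _ h => SymFn.isThetaSym_unique h⟩,
    ⟨NSym.dualShuffle, NSym.isDualShuffleBasis_dualShuffle,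
      fun _ h => NSym.isDualShuffleBasis_unique h⟩, ?_, ?_⟩
  · intro b hb
    obtain rfl := NSym.isDualShuffleBasis_unique hb
    exact ⟨NSym.theta, NSym.isThetaNSym_theta, fun _ h => NSym.isThetaNSym_unique h⟩
  · intro ΘQ ΘS b ΘN hQ hS hb hN
    -- By uniqueness the given maps and dual family are the ones constructed explicitly.
    obtain rfl := QSym.isThetaQSym_unique hQ
    obtain rfl := SymFn.isThetaSym_unique hS
    obtain rfl := NSym.isDualShuffleBasis_unique hb
    obtain rfl := NSym.isThetaNSym_unique hN
    exact ⟨ShuffleOdd.exists_equiv_peakAlgebra, SymOdd.exists_graded_equiv_schurQAlgebra,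
      SymOdd.schurQAlgebra_selfDual, NSym.range_theta_dual⟩
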